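/- **Setting.** Let $n,d\ge 1$, $\tau>0$, $K=B_1^d=\{\alpha\in\mathbb R^d:\|\alpha\|_1\le 1\}$ with Minkowski functional $\varphi_K(\alpha)=\inf\{r>0:\alpha\in rK\}$. For $X\in\mathbb R^{n\times d}$, $\alpha^\star\in\tau B_1^d$ and $y=X\alpha^\star+\xi$ with $\xi\sim\mathcal N(0,I_n)$, put $\mathcal R_n(\alpha)=\frac1n\|X\alpha-y\|_2^2$ and $\mathcal R(\alpha)=\frac1n\|X(\alpha-\alpha^\star)\|_2^2$. Let $D_\psi(\alpha,\alpha')=\psi(\alpha)-\psi(\alpha')-\langle\nabla\psi(\alpha'),\alpha-\alpha'\rangle$; $\psi$ is $\rho$-strongly convex with respect to a norm $N$ if $D_\psi(\alpha,\alpha')\ge\frac\rho2N(\alpha-\alpha')^2$ for all $\alpha,\alpha'$, and $f$ is $\beta$-smooth with respect to $N$ if $f(\alpha)\le f(\alpha')+\langle\nabla f(\alpha'),\alpha-\alpha'\rangle+\frac\beta2N(\alpha-\alpha')^2$ for all $\alpha,\alpha'$. *Conditions on $\psi:\mathbb R^d\to[0,\infty)$, with constants $c_l,c_u>0$.* (I)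 $\psi$ is differentiable (for continuous time: twice differentiable) and $\nabla\psi(0)=0$; (II) $\sqrt\psi$ is convex; (III) for discrete time: $\psi$ is $\rho$-strongly convex with respect to some norm, $\rho>0$; for continuous time: $\psi$ is strictly convex; (IV) $\varphi_K(\alpha)\le c_l\sqrt{\psi(\alpha)}$ for all $\alpha\in\mathbb R^d$, and $\sqrt{\psi(\alpha)}\le c_u\tau$ for all $\alpha\in\tau K$. Put $c_a=c_lc_u$. *Mirror descent*, always started at $\alpha_0=0$. Continuous time: $\frac{d}{dt}\alpha_t=-(\nabla^2\psi(\alpha_t))^{-1}\nabla\mathcal R_n(\alpha_t)$ for $t\ge0$, where $\psi$ has positive definite Hessian everywhere. Discrete time with step size $\eta>0$: $\nabla\psi(\alpha_{t+1})=\nabla\psi(\alpha_t)-\eta\nabla\mathcal R_n(\alpha_t)$, where $\psi$ is strictly convex with surjective gradient. For an accuracy $\varepsilon>0$ let $T=c_u^2\tau^2/\varepsilon$ in continuous time and $T=\lceil 2c_u^2\tau^2/(\varepsilon\eta)\rceil$ in discrete time, and let $t^\star\in\operatorname{argmin}_{0\le t\le T}\mathcal R(\alpha_t)$. In discrete time the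 step size satisfies $0<\eta\le\frac{\rho}{\beta}\wedge\frac{c_u^2\tau^2}{2}$, where $\psi$ is $\rho$-strongly convex and $\mathcal R_n$ is $\beta$-smooth, $\beta>0$, with respect to a common norm. *Potentials.* 1. (discrete time) $\psi(\alpha)=\|\alpha\|_p^2$ with $1<p\le 2$ and $(p-1)\log d\le1$; $\rho=2(p-1)$ with respect to $\|\cdot\|_p$, $c_l=e$, $c_u=1$. 2. (discrete time) $\psi(\alpha)=\big(\sum_i h_\lambda(\alpha_i)+\frac{d\lambda}2\big)^2+\|\alpha\|_2^2$ with $0<\lambda\le 2\tau/d$, where $h_\lambda(x)=\frac{x^2}{2\lambda}$ for $|x|\le\lambda$ and $|x|-\frac\lambda2$ otherwise; $\rho=2$ with respect to $\|\cdot\|_2$, $c_l=1$, $c_u=\sqrt5$. 3. (discrete and continuous time) $\psi(\alpha)=\Big(\sum_i\frac{\alpha_i\operatorname{arcsinh}(\alpha_i/\gamma)-\sqrt{\alpha_i^2+\gamma^2}+\gamma+1}{\operatorname{arcsinh}(\gamma^{-1})}\Big)^2$ with $0<\gamma\le\sinh(d/\tau)^{-1}\wedge(4\tau)^{-1}\wedge2^{-1/2}$;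 $\rho=\operatorname{arcsinh}(\gamma^{-1})^{-2}$ with respect to $\|\cdot\|_2$, $c_l=1$, $c_u=3$. 4. (continuous time) $\psi(\alpha)=\Big(\sum_i\frac{\log(1+e^{-\gamma\alpha_i})+\log(1+e^{\gamma\alpha_i})}{\gamma}\Big)^2$ with $\gamma\ge d\log(4)/\tau$; $c_l=1$, $c_u=2$. **Theorem 4.1.** (a) For all $d\ge1$, $\tau>0$, each of these potentials satisfies, in the listed time settings, the above requirements on a mirror descent potential and (I)–(IV) with the listed $\rho$, norm, $c_l$ and $c_u$, so that $c_a=e,\sqrt5,3,2$, respectively. Moreover $2(p-1)\le2/\log d$ in 1 (for $d\ge2$) and $\rho\le(\tau/d)^2$ in 3, and in continuous time a trajectory on $[0,\infty)$ exists for all $X$ and $y$. There is an absolute constant $C>0$ such that for all $n,d\ge 1$ and $\tau>0$ with $d\ge\tau\sqrt n$ and each of these potentials, in the listed time settings: (b) If every column of $X$ has Euclidean norm at most $\sqrt n$ and $\delta\in(0,1)$, then with probability at least $1-e^{-0.1n}-\delta$ over $\xi$, for all $\alpha^\star\in\tau B_1^d$ and all $\varepsilon>0$ (and all $\eta$ as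 above) $t^\star$ exists and $$\mathcal R(\alpha_{t^\star})\le C\left[\left(\frac{\operatorname{rank}X}{n}\wedge c_a\tau\sqrt{\frac{\log(ed/(\tau\sqrt n))}{n}}\right)+\frac{\log(1/\delta)}{n}\right]+\varepsilon .$$ (c) If $d\ge2$ and $X$ has i.i.d. $\mathcal N(0,1)$ entries, independent of $\xi$, then with probability at least $0.99-2e^{-0.1n}$ jointly over $X$ and $\xi$, for all $\alpha^\star\in\tau B_1^d$ and all $\varepsilon>0$ (and all $\eta$ as above) $t^\star$ exists and $$\mathcal R(\alpha_{t^\star})\le C\left(1\wedge c_a\tau\sqrt{\frac{\log d}{n}}\right)+\varepsilon .$$ In particular, when $\varepsilon$ is chosen equal to the quantity multiplied by $C$ (whenever that is positive), $\mathcal R(\alpha_{t^\star})$ is at most $C+1$ times that quantity. -/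

import Mathlib

open scoped Pointwise

noncomputable section

namespace ESMD

/-- The space `ℝᵈ` with its Euclidean structure. -/
abbrev E (d : ℕ) : Type := EuclideanSpace ℝ (Fin d)

/-! ### Norms, balls, Bregman divergences -/

/-- The `ℓ_p`-norm for a real exponent `1 ≤ p < ∞`. -/
def lpNorm {d : ℕ} (p : ℝ) (α : E d) : ℝ := (∑ i, |α i| ^ p) ^ (1 / p)

/-- The unit ball `B₁ᵈ` of the `ℓ₁`-norm. -/
def l1Ball (d : ℕ) : Set (E d) := {α | ∑ i, |α i| ≤ 1}

/-- `N` is a norm on `ℝᵈ`. -/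
structure IsNorm {d : ℕ} (N : E d → ℝ) : Prop where
  triangle : ∀ x y, N (x + y) ≤ N x + N y
  homogeneous : ∀ (c : ℝ) (x : E d), N (c • x) = |c| * N x
  nonneg : ∀ x, 0 ≤ N x
  definite : ∀ x, N x = 0 → x = 0

/-- The Bregman divergence `D_ψ(α, α')`. -/
def bregman {d : ℕ} (ψ : E d → ℝ) (α α' : E d) : ℝ :=
  ψ α - ψ α' - inner ℝ (gradient ψ α') (α - α')

/-- `ρ`-strong convexity of a differentiable function with respect to the norm `N`. -/
def StronglyConvexWrt {d : ℕ} (ψ : E d → ℝ) (ρ : ℝ) (N : E d → ℝ) : Prop :=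
  ∀ α α', ρ / 2 * N (α - α') ^ 2 ≤ bregman ψ α α'

/-- `β`-smoothness of a differentiable function with respect to the norm `N`. -/
def SmoothWrt {d : ℕ} (f : E d → ℝ) (β : ℝ) (N : E d → ℝ) : Prop :=
  ∀ α α', f α ≤ f α' + inner ℝ (gradient f α') (α - α') + β / 2 * N (α - α') ^ 2

/-- The Hessian `∇²ψ(α)`, as a linear map. -/
def hessian {d : ℕ} (ψ : E d → ℝ) (α : E d) : E d →L[ℝ] E d :=
  fderiv ℝ (gradient ψ) α

/-! ### Linear regression -/

/-- The empirical risk `‖X α - y‖² / n`. -/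
def empRisk {n d : ℕ} (X : Matrix (Fin n) (Fin d) ℝ) (y : E n) (α : E d) : ℝ :=
  1 / (n : ℝ) * ‖Matrix.toEuclideanLin X α - y‖ ^ 2

/-- The in-sample risk `‖X (α - α⋆)‖² / n`. -/
def inSampleRisk {n d : ℕ} (X : Matrix (Fin n) (Fin d) ℝ) (αs α : E d) : ℝ :=
  1 / (n : ℝ) * ‖Matrix.toEuclideanLin X (α - αs)‖ ^ 2

/-- The responses `y = X α⋆ + ξ`. -/
def response {n d : ℕ} (X : Matrix (Fin n) (Fin d) ℝ) (αs : E d) (ξ : Fin n → ℝ) : E n :=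
  Matrix.toEuclideanLin X αs + WithLp.toLp 2 ξ

/-- Every column of `X` has Euclidean norm at most `√n`. -/
def ColumnNormalized {n d : ℕ} (X : Matrix (Fin n) (Fin d) ℝ) : Prop :=
  ∀ j, √(∑ i, X i j ^ 2) ≤ √(n : ℝ)

/-- The law of the noise: `n` independent standard Gaussians. -/
def noiseLaw (n : ℕ) : MeasureTheory.Measure (Fin n → ℝ) :=
  MeasureTheory.Measure.pi fun _ => ProbabilityTheory.gaussianReal 0 1

/-- The law of a Gaussian design: `n * d` independent standard Gaussian entries. -/
def designLaw (n d : ℕ) : MeasureTheory.Measure (Fin n → Fin d → ℝ) :=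
  MeasureTheory.Measure.pi fun _ =>
    MeasureTheory.Measure.pi fun _ => ProbabilityTheory.gaussianReal 0 1

/-- `P` holds with probability at least `q` under `μ`: it holds on a measurable event of
probability at least `q`. -/
def WithProbAtLeast {Ω : Type*} [MeasurableSpace Ω] (μ : MeasureTheory.Measure Ω) (q : ℝ)
    (P : Ω → Prop) : Prop :=
  ∃ A : Set Ω, MeasurableSet A ∧ ENNReal.ofReal q ≤ μ A ∧ ∀ ω ∈ A, P ω

/-! ### Mirror descent -/

/-- The requirements on a potential in the definition of continuous-time mirror descent. -/
structure IsContinuousMirrorMap {d : ℕ} (ψ : E d → ℝ) : Prop where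
  differentiable : Differentiable ℝ ψ
  gradient_differentiable : Differentiable ℝ (gradient ψ)
  hessian_pos : ∀ α v, v ≠ 0 → 0 < inner ℝ (hessian ψ α v) v

/-- The requirements on a potential in the definition of discrete-time mirror descent. -/
structure IsDiscreteMirrorMap {d : ℕ} (ψ : E d → ℝ) : Prop where
  differentiable : Differentiable ℝ ψ
  strictConvex : StrictConvexOn ℝ Set.univ ψ
  gradient_surjective : Function.Surjective (gradient ψ)

/-- Continuous-time mirror descent on the empirical risk, started at `0`. -/
structure IsContinuousMD {n d : ℕ} (ψ : E d → ℝ) (X : Matrix (Fin n) (Fin d) ℝ) (y : E n)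
    (α : ℝ → E d) : Prop where
  init : α 0 = 0
  flow : ∀ t, 0 ≤ t → HasDerivWithinAt α
    (-((hessian ψ (α t)).inverse (gradient (empRisk X y) (α t)))) (Set.Ici 0) t

/-- Discrete-time mirror descent on the empirical risk with step size `η`, started at `0`. -/
structure IsDiscreteMD {n d : ℕ} (ψ : E d → ℝ) (X : Matrix (Fin n) (Fin d) ℝ) (y : E n)
    (η : ℝ) (α : ℕ → E d) : Prop where
  init : α 0 = 0
  step : ∀ t, gradient ψ (α (t + 1)) = gradient ψ (α t) - η • gradient (empRisk X y) (α t)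

/-! ### The sufficient conditions (I)-(IV) on a potential -/

/-- The conditions that are common to continuous and discrete time: `ψ ≥ 0`, the gradient
vanishes at the origin, `√ψ` is convex, and `√ψ` is comparable with the Minkowski functional
of `K` with constants `cl`, `cu`. -/
structure CommonAssumption {d : ℕ} (K : Set (E d)) (τ : ℝ) (ψ : E d → ℝ) (cl cu : ℝ) :
    Prop where
  nonneg : ∀ α, 0 ≤ ψ α
  differentiable : Differentiable ℝ ψ
  gradient_zero : gradient ψ 0 = 0
  sqrt_convex : ConvexOn ℝ Set.univ fun α => √(ψ α)
  cl_pos : 0 < cl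
  cu_pos : 0 < cu
  lower : ∀ α, gauge K α ≤ cl * √(ψ α)
  upper : ∀ α ∈ τ • K, √(ψ α) ≤ cu * τ

/-- The continuous-time version of the conditions. -/
structure ContinuousAssumption {d : ℕ} (K : Set (E d)) (τ : ℝ) (ψ : E d → ℝ) (cl cu : ℝ) :
    Prop extends CommonAssumption K τ ψ cl cu where
  gradient_differentiable : Differentiable ℝ (gradient ψ)
  strictConvex : StrictConvexOn ℝ Set.univ ψ

/-- The discrete-time version of the conditions, with `ψ` being `ρ`-strongly convex with
respect to the norm `N`. -/
structure DiscreteAssumption {d : ℕ} (K : Set (E d)) (τ : ℝ) (ψ : E d → ℝ) (N : E d → ℝ)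
    (ρ cl cu : ℝ) : Prop extends CommonAssumption K τ ψ cl cu where
  isNorm : IsNorm N
  rho_pos : 0 < ρ
  stronglyConvex : StronglyConvexWrt ψ ρ N

/-! ### The four potentials -/

/-- The squared `ℓ_p`-norm. -/
def lpPotential (d : ℕ) (p : ℝ) (α : E d) : ℝ := lpNorm p α ^ 2

/-- The Huber loss. -/
def huber (lam x : ℝ) : ℝ := if |x| ≤ lam then x ^ 2 / (2 * lam) else |x| - lam / 2

/-- The squared Moreau envelope / Huber potential with parameter `ρ = 2`. -/
def moreauPotential (d : ℕ) (lam : ℝ) (α : E d) : ℝ :=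
  (∑ i, huber lam (α i) + d * lam / 2) ^ 2 + 2 / 2 * ‖α‖ ^ 2

/-- The adjusted squared hypentropy. -/
def hypentropyPotential (d : ℕ) (γ : ℝ) (α : E d) : ℝ :=
  (∑ i, (α i * Real.arsinh (α i / γ) - √(α i ^ 2 + γ ^ 2) + γ + 1) / Real.arsinh γ⁻¹) ^ 2

/-- The sigmoidal potential. -/
def sigmoidalPotential (d : ℕ) (γ : ℝ) (α : E d) : ℝ :=
  (∑ i, (Real.log (1 + Real.exp (-(γ * α i))) + Real.log (1 + Real.exp (γ * α i))) / γ) ^ 2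

/-- The admissible hypentropy parameters
`0 < γ ≤ min (1 / sinh (d / τ)) (1 / (4 τ)) (1 / √2)`. -/
structure HypentropyParam (d : ℕ) (τ γ : ℝ) : Prop where
  pos : 0 < γ
  le_sinh : γ ≤ (Real.sinh (d / τ))⁻¹
  le_tau : γ ≤ (4 * τ)⁻¹
  le_sqrt : γ ≤ (√2)⁻¹

/-- The potentials for discrete time; `DiscreteRow d τ ψ N ρ cl cu` lists the potential `ψ`, the
norm `N` and parameter `ρ` of strong convexity, and the constants `cl`, `cu`.
The condition `(p - 1) * log d ≤ 1` is `p ≤ 1 + 1 / log d`, also meaningful for `d = 1`. -/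
inductive DiscreteRow (d : ℕ) (τ : ℝ) : (E d → ℝ) → (E d → ℝ) → ℝ → ℝ → ℝ → Prop
  | lp (p : ℝ) (h1 : 1 < p) (h2 : p ≤ 2) (hp : (p - 1) * Real.log d ≤ 1) :
      DiscreteRow d τ (lpPotential d p) (lpNorm p) (2 * (p - 1)) (Real.exp 1) 1
  | moreau (lam : ℝ) (h0 : 0 < lam) (hl : lam ≤ 2 * τ / d) :
      DiscreteRow d τ (moreauPotential d lam) (fun α => ‖α‖) 2 1 (√5)
  | hypentropy (γ : ℝ) (hγ : HypentropyParam d τ γ) :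
      DiscreteRow d τ (hypentropyPotential d γ) (fun α => ‖α‖) ((Real.arsinh γ⁻¹) ^ 2)⁻¹ 1 3

/-- The potentials for continuous time, with the constants `cl`, `cu`. -/
inductive ContinuousRow (d : ℕ) (τ : ℝ) : (E d → ℝ) → ℝ → ℝ → Prop
  | hypentropy (γ : ℝ) (hγ : HypentropyParam d τ γ) :
      ContinuousRow d τ (hypentropyPotential d γ) 1 3
  | sigmoidal (γ : ℝ) (hγ : d * Real.log 4 / τ ≤ γ) :
      ContinuousRow d τ (sigmoidalPotential d γ) 1 2

/-! ### Guarantees for optimally stopped mirror descent -/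

/-- For the noise realization `ξ` and every target accuracy `ε > 0`, the oracle optimal stopping
time of continuous-time mirror descent before the horizon `cu² τ² / ε` exists, and the in-sample
risk at that time is at most `B + ε`. -/
def ContinuousGuarantee {n d : ℕ} (ψ : E d → ℝ) (cu τ : ℝ) (X : Matrix (Fin n) (Fin d) ℝ)
    (αs : E d) (ξ : Fin n → ℝ) (B : ℝ) : Prop :=
  ∀ α : ℝ → E d, IsContinuousMD ψ X (response X αs ξ) α → ∀ ε : ℝ, 0 < ε →
    ∃ t ∈ Set.Icc 0 (cu ^ 2 * τ ^ 2 / ε),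
      (∀ s ∈ Set.Icc 0 (cu ^ 2 * τ ^ 2 / ε),
        inSampleRisk X αs (α t) ≤ inSampleRisk X αs (α s)) ∧
      inSampleRisk X αs (α t) ≤ B + ε

/-- For the noise realization `ξ`, every target accuracy `ε > 0` and every step size
`0 < η ≤ min (ρ / β) (cu² τ² / 2)`, where `ψ` is `ρ`-strongly convex and the empirical risk is
`β`-smooth with respect to the same norm, the in-sample risk of discrete-time mirror descent at
the oracle optimal stopping time before the horizon `⌈2 cu² τ² / (ε η)⌉` is at most `B + ε`. -/
def DiscreteGuarantee {n d : ℕ} (ψ : E d → ℝ) (cu τ : ℝ) (X : Matrix (Fin n) (Fin d) ℝ)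
    (αs : E d) (ξ : Fin n → ℝ) (B : ℝ) : Prop :=
  ∀ (N : E d → ℝ) (ρ β η : ℝ), IsNorm N → StronglyConvexWrt ψ ρ N →
    SmoothWrt (empRisk X (response X αs ξ)) β N → 0 < β →
    0 < η → η ≤ ρ / β → η ≤ cu ^ 2 * τ ^ 2 / 2 →
    ∀ α : ℕ → E d, IsDiscreteMD ψ X (response X αs ξ) η α → ∀ ε : ℝ, 0 < ε →
      ∃ t ≤ ⌈2 * cu ^ 2 * τ ^ 2 / (ε * η)⌉₊,
        (∀ s ≤ ⌈2 * cu ^ 2 * τ ^ 2 / (ε * η)⌉₊,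
          inSampleRisk X αs (α t) ≤ inSampleRisk X αs (α s)) ∧
        inSampleRisk X αs (α t) ≤ B + ε

/-- The rate for a fixed design `X`. -/
def fixedRate {n d : ℕ} (X : Matrix (Fin n) (Fin d) ℝ) (ca τ δ : ℝ) : ℝ :=
  min ((X.rank : ℝ) / n) (ca * τ * √(Real.log (Real.exp 1 * d / (τ * √(n : ℝ))) / n))
    + Real.log (1 / δ) / n

/-- The rate for a Gaussian design. -/
def gaussianRate (n d : ℕ) (ca τ : ℝ) : ℝ :=
  min 1 (ca * τ * √(Real.log d / n))

end ESMD

end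

/-! The argument splits into a deterministic part on an event `GoodNoise` and a probabilistic bound
for that event.

Deterministic part. The Bregman divergence `D(α⋆, α_t)` is a Lyapunov function. Since `R_n` is
quadratic, its Taylor expansion is exact and the remainder is the in-sample risk `R`. In continuous
time the divergence therefore decreases at rate `e_t = R_n(α_t) - R_n(α⋆) + R(α_t)`. In discrete
time each step decreases it by at least `η e_t`, with `α_{t+1}` in the first term (`bregman_step`).
As `0 ≤ D` and `D(α⋆, 0) ≤ c_u²τ²`, the rate `e_t` must fall below the accuracy before the horizon.
At the first such time `D(α⋆, ·)` is still of order `c_u²τ²`. Convexity of `√ψ` gives `(√ψ(a) -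
√ψ(b))² ≤ D(a, b)` (`sq_sub_sqrt_le_bregman`), so condition (IV) places `v = α_t - α⋆` (or `α_{t+1}
- α⋆`) in `10 τ B₁` (`CommonAssumption.sum_abs_sub_le`). A small `e_t` is an offset inequality: `R`
is at most the accuracy plus a multiple of `⟨ξ, Xv⟩ - ‖Xv‖²/4`. It remains to bound the supremum of
this offset Gaussian process over `10 τ B₁`. The event involves neither `α⋆` nor `ε` nor `η`, hence
the uniformity in them.

Probabilistic part. By completing the square the process is at most the squared norm of the
projection of `ξ` onto the range of `X` (`rank_event`). In terms of the `ℓ₁`-radius, the image of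
the ball is the convex hull of `2d` signed columns. Maurey's method, applied to the offset
functional itself, replaces a point of the hull by an average of `k` columns
(`exists_sym_offset_le`), and a union bound over multisets follows (`offset_event`, `l1_event`).
Counting multisets is what yields `log(ed/(τ√n))` instead of `log d`. For a Gaussian design, `⟨ξ,
X_j⟩` is Gaussian given `ξ`, and duality of `ℓ₁` and `ℓ_∞` suffices (`gaussian_design_event`).

Potentials. Numbers 3 and 4 are squares of a separable sum with a smooth convex profile, whose
Hessian is explicit (`IsProfile`). Number 2 is a squared convex function plus `‖·‖²`. For number 1
strong convexity is proved on a smooth approximation, by Hölder, and passed to the limit. The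
continuous flow exists globally because a least-squares solution `a` makes `D(a, ·)` nonincreasing,
which confines the trajectory to a ball. -/

noncomputable section

namespace ESMD

/-! ### The `ℓ₁`-ball -/

theorem mem_smul_l1Ball {d : ℕ} {r : ℝ} (hr : 0 < r) (α : E d) :
    α ∈ r • l1Ball d ↔ ∑ i, |α i| ≤ r := by
  rw [Set.mem_smul_set_iff_inv_smul_mem₀ hr.ne']
  simp only [l1Ball, Set.mem_ofPred_eq, PiLp.smul_apply, smul_eq_mul, abs_mul, abs_inv,
    abs_of_pos hr, ← Finset.mul_sum]
  rw [inv_mul_le_iff₀ hr, mul_one]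

theorem gauge_l1Ball {d : ℕ} (α : E d) : gauge (l1Ball d) α = ∑ i, |α i| := by
  have h0 : 0 ≤ ∑ i, |α i| := Finset.sum_nonneg fun i _ => abs_nonneg _
  apply le_antisymm
  · refine le_of_forall_pos_le_add fun ε hε => ?_
    exact gauge_le_of_mem (by positivity)
      ((mem_smul_l1Ball (by positivity) α).2 (by linarith))
  · rw [gauge_def]
    refine le_csInf ⟨(∑ i, |α i|) + 1, Set.mem_Ioi.2 (by positivity),
      (mem_smul_l1Ball (by positivity) α).2 (by linarith)⟩ ?_
    rintro r ⟨hr, hα⟩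
    exact (mem_smul_l1Ball hr α).1 hα

/-! ### Bregman divergences -/

theorem hasDerivAt_line {d : ℕ} {ψ : E d → ℝ} (hψ : Differentiable ℝ ψ) (b v : E d) (t : ℝ) :
    HasDerivAt (fun s : ℝ => ψ (b + s • v)) (inner ℝ (gradient ψ (b + t • v)) v) t := by
  have h1 : HasDerivAt (fun s : ℝ => b + s • v) v t := by
    simpa using ((hasDerivAt_id t).smul_const v).const_add b
  have h2 := (hψ (b + t • v)).hasFDerivAt.comp_hasDerivAt t h1
  rwa [inner_gradient_left]

theorem deriv_le_of_le_right {f g : ℝ → ℝ} {f' g' : ℝ} (hf : HasDerivAt f f' 0)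
    (hg : HasDerivAt g g' 0) (h0 : f 0 = g 0) (h : ∀ t ∈ Set.Ioo (0 : ℝ) 1, f t ≤ g t) :
    f' ≤ g' := by
  have hfg := (hg.sub hf).hasDerivWithinAt (s := Set.Ioi 0)
  rw [hasDerivWithinAt_iff_tendsto_slope' (by simp)] at hfg
  have : 0 ≤ g' - f' := by
    refine ge_of_tendsto hfg ?_
    filter_upwards [Ioo_mem_nhdsGT (zero_lt_one' ℝ)] with t ht
    have := h t ht
    simp only [slope_def_field, Pi.sub_apply, h0, sub_self, sub_zero]
    exact div_nonneg (by linarith) ht.1.le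
  linarith

/-- On the segment from `b` to `a`, `ψ` lies below the square of the linear interpolation of `√ψ`,
with equality at `b`. Comparing one-sided derivatives there bounds `⟨∇ψ(b), a - b⟩`, without
differentiating `√ψ` where `ψ` vanishes. -/
theorem sq_sub_sqrt_le_bregman {d : ℕ} {ψ : E d → ℝ} (hψ : Differentiable ℝ ψ)
    (h0 : ∀ α, 0 ≤ ψ α) (hc : ConvexOn ℝ Set.univ fun α => √(ψ α)) (a b : E d) :
    (√(ψ a) - √(ψ b)) ^ 2 ≤ bregman ψ a b := by
  have h1 := hasDerivAt_line hψ b (a - b) 0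
  have h2 : HasDerivAt (fun t : ℝ => (√(ψ b) + t * (√(ψ a) - √(ψ b))) ^ 2)
      (2 * √(ψ b) * (√(ψ a) - √(ψ b))) 0 := by
    have := (((hasDerivAt_id (0 : ℝ)).mul_const (√(ψ a) - √(ψ b))).const_add (√(ψ b))).pow 2
    convert! this using 1
    simp
  have h3 := deriv_le_of_le_right h1 h2 (by simp [Real.sq_sqrt (h0 b)]) (by
    intro t ht
    have := hc.2 (Set.mem_univ b) (Set.mem_univ a) (sub_nonneg.2 ht.2.le) ht.1.le (by ring)
    have e : (1 - t) • b + t • a = b + t • (a - b) := by module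
    rw [e] at this
    simp only [smul_eq_mul] at this
    rw [← Real.sq_sqrt (h0 (b + t • (a - b)))]
    apply pow_le_pow_left₀ (Real.sqrt_nonneg _)
    linarith)
  simp only [zero_smul, add_zero] at h3
  unfold bregman
  nlinarith [Real.sq_sqrt (h0 a), Real.sq_sqrt (h0 b)]

theorem CommonAssumption.sq_sub_le {d : ℕ} {K : Set (E d)} {τ : ℝ} {ψ : E d → ℝ} {cl cu : ℝ}
    (h : CommonAssumption K τ ψ cl cu) (a b : E d) :
    (√(ψ a) - √(ψ b)) ^ 2 ≤ bregman ψ a b :=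
  sq_sub_sqrt_le_bregman h.differentiable h.nonneg h.sqrt_convex a b

theorem CommonAssumption.bregman_nonneg {d : ℕ} {K : Set (E d)} {τ : ℝ} {ψ : E d → ℝ}
    {cl cu : ℝ} (h : CommonAssumption K τ ψ cl cu) (a b : E d) : 0 ≤ bregman ψ a b :=
  (sq_nonneg _).trans (h.sq_sub_le a b)

/-- Points whose Bregman divergence to a point of `τ B₁` is controlled stay in an `ℓ₁`-ball. -/
theorem CommonAssumption.sum_abs_sub_le {d : ℕ} {τ : ℝ} {ψ : E d → ℝ} {cl cu : ℝ}
    (h : CommonAssumption (l1Ball d) τ ψ cl cu) (hτ : 0 < τ) (hc : cl * cu ≤ 3) {αs α : E d}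
    (hs : αs ∈ τ • l1Ball d) (hD : bregman ψ αs α ≤ 2 * (cu ^ 2 * τ ^ 2)) :
    ∑ i, |(α - αs) i| ≤ 10 * τ := by
  have h1 := h.sq_sub_le αs α
  have h2 := h.upper αs hs
  have hcu := h.cu_pos
  have hcl := h.cl_pos
  -- `√2 ≤ 2` gives `√ψ(α) ≤ 3 c_u τ`, hence `‖α‖₁ ≤ 3 c_l c_u τ ≤ 9 τ`; `αs` contributes the tenth
  -- `τ`.
  have h3 : √(ψ α) - √(ψ αs) ≤ 2 * (cu * τ) := by
    apply le_of_abs_le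
    apply abs_le_of_sq_le_sq _ (by positivity)
    nlinarith [mul_pos hcu hτ]
  have h4 : ∑ i, |α i| ≤ 9 * τ := by
    have := h.lower α
    rw [gauge_l1Ball] at this
    have h5 : cl * √(ψ α) ≤ cl * (3 * (cu * τ)) :=
      mul_le_mul_of_nonneg_left (by linarith) hcl.le
    nlinarith
  have h5 := (mem_smul_l1Ball hτ αs).1 hs
  calc ∑ i, |(α - αs) i| ≤ ∑ i, (|α i| + |αs i|) :=
        Finset.sum_le_sum fun i _ => by simpa using abs_sub (α i) (αs i)
    _ ≤ 10 * τ := by rw [Finset.sum_add_distrib]; linarith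

theorem CommonAssumption.bregman_zero_le {d : ℕ} {τ : ℝ} {ψ : E d → ℝ} {cl cu : ℝ}
    (h : CommonAssumption (l1Ball d) τ ψ cl cu) {αs : E d}
    (hs : αs ∈ τ • l1Ball d) : bregman ψ αs 0 ≤ cu ^ 2 * τ ^ 2 := by
  have h2 := h.upper αs hs
  have := pow_le_pow_left₀ (Real.sqrt_nonneg _) h2 2
  rw [Real.sq_sqrt (h.nonneg _), mul_pow] at this
  simp only [bregman, h.gradient_zero, inner_zero_left]
  linarith [h.nonneg 0]

/-! ### The empirical risk -/

theorem hasGradientAt_empRisk {n d : ℕ} (X : Matrix (Fin n) (Fin d) ℝ) (y : E n) (α : E d) :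
    HasGradientAt (empRisk X y)
      ((2 / (n : ℝ)) • (Matrix.toEuclideanLin X).adjoint (Matrix.toEuclideanLin X α - y)) α := by
  rw [hasGradientAt_iff_hasFDerivAt]
  have h1 : HasFDerivAt (fun α : E d => Matrix.toEuclideanLin X α - y)
      (Matrix.toEuclideanLin X).toContinuousLinearMap α :=
    ((Matrix.toEuclideanLin X).toContinuousLinearMap.hasFDerivAt).sub_const y
  have h2 := h1.norm_sq.const_mul (1 / (n : ℝ))
  convert! h2 using 1
  ext v
  simp [LinearMap.adjoint_inner_left]
  ring

theorem gradient_empRisk {n d : ℕ} (X : Matrix (Fin n) (Fin d) ℝ) (y : E n) (α : E d) :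
    gradient (empRisk X y) α =
      (2 / (n : ℝ)) • (Matrix.toEuclideanLin X).adjoint (Matrix.toEuclideanLin X α - y) :=
  (hasGradientAt_empRisk X y α).gradient

theorem inner_gradient_empRisk {n d : ℕ} (X : Matrix (Fin n) (Fin d) ℝ) (y : E n) (α v : E d) :
    inner ℝ (gradient (empRisk X y) α) v =
      2 / n * inner ℝ (Matrix.toEuclideanLin X α - y) (Matrix.toEuclideanLin X v) := by
  rw [gradient_empRisk, inner_smul_left, LinearMap.adjoint_inner_left]
  simp

theorem contDiff_gradient_empRisk {n d : ℕ} (X : Matrix (Fin n) (Fin d) ℝ) (y : E n)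
    {k : WithTop ℕ∞} : ContDiff ℝ k (gradient (empRisk X y)) := by
  have : gradient (empRisk X y) = fun α => (2 / (n : ℝ)) •
      (Matrix.toEuclideanLin X).adjoint.toContinuousLinearMap
        ((Matrix.toEuclideanLin X).toContinuousLinearMap α - y) := by
    ext1 α
    rw [gradient_empRisk]
    rfl
  rw [this]
  fun_prop

/-- Exactness of the second-order expansion is how the unobserved risk `R` enters the descent
inequalities. -/
theorem empRisk_expand {n d : ℕ} (X : Matrix (Fin n) (Fin d) ℝ) (y : E n) (u w : E d) :
    empRisk X y u = empRisk X y w + inner ℝ (gradient (empRisk X y) w) (u - w) +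
      inSampleRisk X w u := by
  rw [inner_gradient_empRisk, empRisk, empRisk, inSampleRisk]
  have : Matrix.toEuclideanLin X u - y =
      (Matrix.toEuclideanLin X w - y) + Matrix.toEuclideanLin X (u - w) := by
    rw [map_sub]; abel
  rw [this, norm_add_sq_real]
  ring

theorem inSampleRisk_nonneg {n d : ℕ} (X : Matrix (Fin n) (Fin d) ℝ) (a b : E d) :
    0 ≤ inSampleRisk X a b := by unfold inSampleRisk; positivity

theorem inSampleRisk_comm {n d : ℕ} (X : Matrix (Fin n) (Fin d) ℝ) (a b : E d) :
    inSampleRisk X a b = inSampleRisk X b a := by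
  unfold inSampleRisk
  rw [← neg_sub a b, map_neg, norm_neg]

theorem continuous_inSampleRisk {n d : ℕ} (X : Matrix (Fin n) (Fin d) ℝ) (a : E d) :
    Continuous (inSampleRisk X a) := by
  have : inSampleRisk X a = fun α => 1 / (n : ℝ) *
      ‖(Matrix.toEuclideanLin X).toContinuousLinearMap (α - a)‖ ^ 2 := rfl
  rw [this]
  fun_prop

theorem empRisk_sub {n d : ℕ} (X : Matrix (Fin n) (Fin d) ℝ) (αs α : E d) (ξ : Fin n → ℝ) :
    empRisk X (response X αs ξ) α - empRisk X (response X αs ξ) αs =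
      inSampleRisk X αs α -
        2 / n * inner ℝ (WithLp.toLp 2 ξ) (Matrix.toEuclideanLin X (α - αs)) := by
  rw [empRisk_expand X _ α αs, inner_gradient_empRisk]
  simp only [response, sub_add_cancel_left, inner_neg_left]
  ring

/-- The event on which mirror descent is analysed: the noise is of typical size and the offset
Gaussian process over `10 τ B₁` is bounded. -/
def GoodNoise {n d : ℕ} (X : Matrix (Fin n) (Fin d) ℝ) (τ B : ℝ) (ξ : Fin n → ℝ) : Prop :=
  ‖(WithLp.toLp 2 ξ : E n)‖ ^ 2 ≤ 2 * n ∧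
  ∀ v : E d, ∑ i, |v i| ≤ 10 * τ →
    4 / n * (inner ℝ (WithLp.toLp 2 ξ) (Matrix.toEuclideanLin X v) -
      ‖Matrix.toEuclideanLin X v‖ ^ 2 / 4) ≤ B

theorem GoodNoise.nonneg {n d : ℕ} {X : Matrix (Fin n) (Fin d) ℝ} {τ B : ℝ} {ξ : Fin n → ℝ}
    (hτ : 0 < τ) (h : GoodNoise X τ B ξ) : 0 ≤ B := by
  simpa using h.2 0 (by simpa using hτ.le)

/-! ### Discrete time -/

/-- By the three-point identity the step changes `D(a, ·)` by `-D(u, w) + η⟨∇R_n(w), a - u⟩`. Since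
`ηβ ≤ ρ`, the term `D(u, w)` pays for the smoothness remainder, and the exact expansion of `R_n` at
`w` leaves the extra gain `R(w)`. -/
theorem bregman_step {n d : ℕ} {ψ : E d → ℝ} {N : E d → ℝ} {ρ β η : ℝ}
    {X : Matrix (Fin n) (Fin d) ℝ} {y : E n} (hψ : StronglyConvexWrt ψ ρ N)
    (hR : SmoothWrt (empRisk X y) β N) (hβ : 0 < β) (hη : 0 < η) (hηρ : η ≤ ρ / β)
    (a u w : E d) (hu : gradient ψ u = gradient ψ w - η • gradient (empRisk X y) w) :
    bregman ψ a u ≤ bregman ψ a w -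
      η * (empRisk X y u - empRisk X y a + inSampleRisk X a w) := by
  have h1 : bregman ψ a u = bregman ψ a w - bregman ψ u w +
      η * inner ℝ (gradient (empRisk X y) w) (a - u) := by
    simp only [bregman, hu, inner_sub_left, inner_smul_left, inner_sub_right]
    simp only [conj_trivial]
    ring
  have h2 := hψ u w
  have h3 := hR u w
  have h4 := empRisk_expand X y a w
  have h5 : η * β ≤ ρ := (le_div_iff₀ hβ).1 hηρ
  have h6 : inner ℝ (gradient (empRisk X y) w) (a - u) =
      inner ℝ (gradient (empRisk X y) w) (a - w) -
        inner ℝ (gradient (empRisk X y) w) (u - w) := by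
    rw [← inner_sub_right]; congr 1; abel
  have h7 : η * (β / 2 * N (u - w) ^ 2) ≤ ρ / 2 * N (u - w) ^ 2 := by
    nlinarith [sq_nonneg (N (u - w))]
  rw [h1, h6, inSampleRisk_comm]
  have h8 := mul_le_mul_of_nonneg_left h3 hη.le
  have h9 := congrArg (η * ·) h4
  nlinarith

theorem discreteGuarantee_of_goodNoise {n d : ℕ} (hn : 0 < n) {τ : ℝ} (hτ : 0 < τ)
    {ψ : E d → ℝ} {cl cu : ℝ} (h : CommonAssumption (l1Ball d) τ ψ cl cu) (hc : cl * cu ≤ 3)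
    {X : Matrix (Fin n) (Fin d) ℝ} {αs : E d} (hs : αs ∈ τ • l1Ball d) {ξ : Fin n → ℝ} {B : ℝ}
    (hgood : GoodNoise X τ B ξ) : DiscreteGuarantee ψ cu τ X αs ξ B := by
  intro N ρ β η _ hψ hR hβ hη hηρ hητ α hα ε hε
  set T := ⌈2 * cu ^ 2 * τ ^ 2 / (ε * η)⌉₊ with hT
  set y := response X αs ξ
  have hcu := h.cu_pos
  have hn' : (0 : ℝ) < n := by exact_mod_cast hn
  set e : ℕ → ℝ := fun t => empRisk X y (α (t + 1)) - empRisk X y αs + inSampleRisk X αs (α t)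
    with he
  set D : ℕ → ℝ := fun t => bregman ψ αs (α t) with hDdef
  have hstep : ∀ t, D (t + 1) ≤ D t - η * e t := fun t =>
    bregman_step hψ hR hβ hη hηρ αs (α (t + 1)) (α t) (hα.step t)
  have hD0 : D 0 ≤ cu ^ 2 * τ ^ 2 := by
    simp only [hDdef, hα.init]; exact h.bregman_zero_le hs
  -- Strictness for `0 < m` is needed because the horizon only gives `T η ε / 2 ≥ c_u²τ²`, with
  -- possible equality.
  have hind : ∀ m : ℕ, (∀ t < m, ε / 2 < e t) →
      D m + m * (η * ε / 2) ≤ D 0 ∧ (0 < m → D m + m * (η * ε / 2) < D 0) := by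
    intro m
    induction m with
    | zero => intro _; simp
    | succ m ih =>
      intro hm
      have h1 := (ih fun t ht => hm t (by omega)).1
      have h2 := hstep m
      have h3 := mul_lt_mul_of_pos_left (hm m (by omega)) hη
      have : D (m + 1) + ((m + 1 : ℕ) : ℝ) * (η * ε / 2) < D 0 := by
        push_cast; nlinarith
      exact ⟨this.le, fun _ => this⟩
  have hTle : 2 * cu ^ 2 * τ ^ 2 / (ε * η) ≤ T := Nat.le_ceil _
  have hTpos : 0 < T := Nat.ceil_pos.2 (by positivity)
  have hex : ∃ t, t < T ∧ e t ≤ ε / 2 := by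
    by_contra! hno
    have h1 := (hind T hno).2 hTpos
    have h2 : 0 ≤ D T := h.bregman_nonneg _ _
    rw [div_le_iff₀ (by positivity)] at hTle
    nlinarith
  classical
  obtain ⟨htT, hte⟩ := Nat.find_spec hex
  set t := Nat.find hex with htdef
  have hDt : D t ≤ cu ^ 2 * τ ^ 2 := by
    have := (hind t fun s hs' => by
      have := Nat.find_min hex hs'
      push Not at this
      exact this (hs'.trans htT)).1
    have h0 : (0 : ℝ) ≤ t * (η * ε / 2) := by positivity
    linarith
  set z := Matrix.toEuclideanLin X (α (t + 1) - αs) with hz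
  have hsub := empRisk_sub X αs (α (t + 1)) ξ
  have hRt := inSampleRisk_nonneg X αs (α t)
  have hR1 : inSampleRisk X αs (α (t + 1)) = 1 / n * ‖z‖ ^ 2 := rfl
  have hinner : 2 * inner ℝ (WithLp.toLp 2 ξ : E n) z ≤ ‖(WithLp.toLp 2 ξ : E n)‖ ^ 2 + ‖z‖ ^ 2 := by
    have := norm_sub_sq_real (WithLp.toLp 2 ξ : E n) z
    nlinarith [sq_nonneg ‖(WithLp.toLp 2 ξ : E n) - z‖]
  -- Nonnegativity of `R_n(α (t + 1))` in another form: its excess over `R_n(αs)` is at least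
  -- `-‖ξ‖²/n`.
  have hlow : -2 ≤ e t := by
    have h1 : 2 * inner ℝ (WithLp.toLp 2 ξ : E n) z - ‖z‖ ^ 2 ≤ 2 * n := by linarith [hgood.1]
    have h2 : 1 / (n : ℝ) * (2 * inner ℝ (WithLp.toLp 2 ξ : E n) z - ‖z‖ ^ 2) ≤ 2 := by
      rw [one_div, inv_mul_le_iff₀ hn']; linarith
    have h3 : e t = 1 / (n : ℝ) * ‖z‖ ^ 2 - 2 / n * inner ℝ (WithLp.toLp 2 ξ : E n) z
        + inSampleRisk X αs (α t) := by
      simp only [he]; rw [← hR1]; linarith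
    have h4 : 1 / (n : ℝ) * (2 * inner ℝ (WithLp.toLp 2 ξ : E n) z - ‖z‖ ^ 2) =
      -(1 / (n : ℝ) * ‖z‖ ^ 2 - 2 / n * inner ℝ (WithLp.toLp 2 ξ : E n) z) := by ring
    linarith
  -- The last step, where `e t` may be negative, raises the divergence by at most `2η ≤ c_u²τ²`;
  -- this is the purpose of the second bound on `η`.
  have hD1 : D (t + 1) ≤ 2 * (cu ^ 2 * τ ^ 2) := by
    have := hstep t
    nlinarith
  have hv := h.sum_abs_sub_le hτ hc hs hD1
  have hfin : inSampleRisk X αs (α (t + 1)) ≤ B + ε := by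
    have h1 := hgood.2 _ hv
    have h3 : e t = 1 / (n : ℝ) * ‖z‖ ^ 2 - 2 / n * inner ℝ (WithLp.toLp 2 ξ : E n) z
        + inSampleRisk X αs (α t) := by
      simp only [he]; rw [← hR1]; linarith
    rw [← hz] at h1
    -- The bracket on the right is minus the excess empirical risk, which is at least `-ε / 2`;
    -- doubling it costs exactly `ε`.
    have h4 : 4 / n * (inner ℝ (WithLp.toLp 2 ξ) z - ‖z‖ ^ 2 / 4) =
      2 * (2 / n * inner ℝ (WithLp.toLp 2 ξ) z - 1 / n * ‖z‖ ^ 2) + 1 / n * ‖z‖ ^ 2 := by ring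
    linarith
  obtain ⟨t', ht', hmin⟩ := Finset.exists_min_image (Finset.range (T + 1))
    (fun s => inSampleRisk X αs (α s)) ⟨0, by simp⟩
  refine ⟨t', by simpa [Nat.lt_succ_iff] using ht', fun s hs' => hmin s (by simp; omega), ?_⟩
  exact (hmin (t + 1) (by simp; omega)).trans hfin

/-! ### Continuous time -/

theorem IsContinuousMirrorMap.hessian_isInvertible {d : ℕ} {ψ : E d → ℝ}
    (h : IsContinuousMirrorMap ψ) (α : E d) : (hessian ψ α).IsInvertible := by
  have hinj : Function.Injective (hessian ψ α : E d →ₗ[ℝ] E d) := by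
    rw [← LinearMap.ker_eq_bot, LinearMap.ker_eq_bot']
    intro v hv
    by_contra hne
    have := h.hessian_pos α v hne
    have hv' : hessian ψ α v = 0 := hv
    simp [hv'] at this
  refine ⟨(LinearEquiv.ofInjectiveEndo _ hinj).toContinuousLinearEquiv, ?_⟩
  ext v
  simp

theorem IsContinuousMirrorMap.hessian_inverse {d : ℕ} {ψ : E d → ℝ}
    (h : IsContinuousMirrorMap ψ) (α w : E d) :
    hessian ψ α ((hessian ψ α).inverse w) = w := by
  have := (h.hessian_isInvertible α).self_comp_inverse
  exact congrArg (fun f : E d →L[ℝ] E d => f w) this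

/-- The first-order terms of `ψ` cancel and only the Hessian remains. Along the flow it meets its
inverse, leaving `⟨∇R_n, a - α⟩`. -/
theorem IsContinuousMirrorMap.hasDerivWithinAt_bregman {d : ℕ} {ψ : E d → ℝ}
    (h : IsContinuousMirrorMap ψ) (a : E d) {α : ℝ → E d} {w : E d} {s : Set ℝ} {t : ℝ}
    (hα : HasDerivWithinAt α w s t) :
    HasDerivWithinAt (fun t => bregman ψ a (α t))
      (-inner ℝ (hessian ψ (α t) w) (a - α t)) s t := by
  have h1 := (h.differentiable (α t)).hasFDerivAt.comp_hasDerivWithinAt t hα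
  have h2 := (h.gradient_differentiable (α t)).hasFDerivAt.comp_hasDerivWithinAt t hα
  have h3 := h2.inner ℝ (hα.const_sub a)
  have h4 := (h1.const_sub (ψ a)).sub h3
  convert! h4 using 1
  simp only [Function.comp, inner_neg_right, inner_gradient_left, hessian]
  ring

theorem le_sub_of_deriv_le {f f' : ℝ → ℝ} {T c : ℝ} (hT : 0 ≤ T)
    (h : ∀ t, 0 ≤ t → HasDerivWithinAt f (f' t) (Set.Ici 0) t)
    (hc : ∀ t ∈ Set.Ioo 0 T, f' t ≤ -c) : f T ≤ f 0 - c * T := by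
  have hd : ∀ t ∈ interior (Set.Icc 0 T), HasDerivAt f (f' t) t := by
    intro t ht
    rw [interior_Icc] at ht
    exact (h t ht.1.le).hasDerivAt (Ici_mem_nhds ht.1)
  have := (convex_Icc 0 T).image_sub_le_mul_sub_of_deriv_le
    (f := f) (C := -c) (fun t ht => (h t ht.1).continuousWithinAt.mono Set.Icc_subset_Ici_self)
    (fun t ht => (hd t ht).differentiableAt.differentiableWithinAt)
    (fun t ht => by rw [(hd t ht).deriv]; exact hc t (by rwa [interior_Icc] at ht))
    0 ⟨le_rfl, hT⟩ T ⟨hT, le_rfl⟩ hT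
  linarith

theorem continuousGuarantee_of_goodNoise {n d : ℕ} {τ : ℝ} (hτ : 0 < τ)
    {ψ : E d → ℝ} {cl cu : ℝ} (hm : IsContinuousMirrorMap ψ)
    (h : CommonAssumption (l1Ball d) τ ψ cl cu) (hc : cl * cu ≤ 3)
    {X : Matrix (Fin n) (Fin d) ℝ} {αs : E d} (hs : αs ∈ τ • l1Ball d) {ξ : Fin n → ℝ} {B : ℝ}
    (hgood : GoodNoise X τ B ξ) : ContinuousGuarantee ψ cu τ X αs ξ B := by
  intro α hα ε hε
  set T := cu ^ 2 * τ ^ 2 / ε with hT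
  set y := response X αs ξ
  have hcu := h.cu_pos
  have hTpos : 0 < T := by positivity
  have hcont : ContinuousOn α (Set.Ici 0) := fun t ht => (hα.flow t ht).continuousWithinAt
  have hcontT : ContinuousOn α (Set.Icc 0 T) := hcont.mono Set.Icc_subset_Ici_self
  set e : ℝ → ℝ := fun t => inner ℝ (gradient (empRisk X y) (α t)) (α t - αs) with he
  set D : ℝ → ℝ := fun t => bregman ψ αs (α t) with hDdef
  have hD : ∀ t, 0 ≤ t → HasDerivWithinAt D (-e t) (Set.Ici 0) t := by
    intro t ht
    have := hm.hasDerivWithinAt_bregman αs (hα.flow t ht)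
    convert! this using 1
    rw [map_neg, hm.hessian_inverse, inner_neg_left, neg_neg, he, ← inner_neg_right, neg_sub]
  have hecont : ContinuousOn e (Set.Icc 0 T) := by
    refine ContinuousOn.inner ?_ (hcontT.sub continuousOn_const)
    exact (contDiff_gradient_empRisk X y (k := 0)).continuous.comp_continuousOn hcontT
  have hD0 : D 0 ≤ cu ^ 2 * τ ^ 2 := by
    simp only [hDdef, hα.init]; exact h.bregman_zero_le hs
  have heT : ε * T = cu ^ 2 * τ ^ 2 := by rw [hT]; field_simp
  have hex : ∃ t ∈ Set.Icc 0 T, e t ≤ ε := by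
    by_contra! hno
    -- The minimum of `e` over the compact interval is one constant exceeding `ε`, so the total
    -- decrease is strictly more than `ε T = c_u²τ²`.
    obtain ⟨t₁, ht₁, hmin⟩ := isCompact_Icc.exists_isMinOn ⟨0, le_rfl, hTpos.le⟩ hecont
    have h1 := le_sub_of_deriv_le (c := e t₁) hTpos.le hD
      (fun t ht => neg_le_neg (hmin ⟨ht.1.le, ht.2.le⟩))
    have h2 : 0 ≤ D T := h.bregman_nonneg _ _
    have h3 := mul_lt_mul_of_pos_right (hno t₁ ht₁) hTpos
    linarith
  have hS : IsCompact (Set.Icc 0 T ∩ e ⁻¹' Set.Iic ε) :=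
    isCompact_Icc.of_isClosed_subset
      (hecont.preimage_isClosed_of_isClosed isClosed_Icc isClosed_Iic) Set.inter_subset_left
  obtain ⟨t, ⟨ht, hte⟩, htmin⟩ := hS.exists_isLeast (by
    obtain ⟨t, ht, h'⟩ := hex
    exact ⟨t, ht, h'⟩)
  -- Before the first time with `e ≤ ε` the rate is positive, so `D t ≤ D 0`; the factor 2 only
  -- matches the lemma shared with discrete time.
  have hDt : D t ≤ 2 * (cu ^ 2 * τ ^ 2) := by
    have h1 := le_sub_of_deriv_le (c := 0) ht.1 hD (fun s hs' => by
      have : ε < e s := by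
        by_contra! hle
        exact absurd (htmin ⟨⟨hs'.1.le, hs'.2.le.trans ht.2⟩, hle⟩) (not_le.2 hs'.2)
      linarith)
    have : 0 ≤ cu ^ 2 * τ ^ 2 := by positivity
    linarith
  have hv := h.sum_abs_sub_le hτ hc hs hDt
  have hfin : inSampleRisk X αs (α t) ≤ B + ε := by
    set z := Matrix.toEuclideanLin X (α t - αs) with hz
    have h1 := hgood.2 _ hv
    have hB := hgood.nonneg hτ
    have hsub := empRisk_sub X αs (α t) ξ
    have h2 := empRisk_expand X y αs (α t)
    have h3 : e t = -inner ℝ (gradient (empRisk X y) (α t)) (αs - α t) := by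
      rw [he, ← inner_neg_right, neg_sub]
    have hR1 : inSampleRisk X αs (α t) = 1 / n * ‖z‖ ^ 2 := rfl
    rw [inSampleRisk_comm] at h2
    rw [← hz] at h1 hsub
    have h4 : 4 / n * (inner ℝ (WithLp.toLp 2 ξ) z - ‖z‖ ^ 2 / 4) =
      2 * (2 / n * inner ℝ (WithLp.toLp 2 ξ) z) - 1 / n * ‖z‖ ^ 2 := by ring
    have hte' : e t ≤ ε := hte
    have hRn := inSampleRisk_nonneg X αs (α t)
    linarith
  obtain ⟨t', ht', hmin⟩ := isCompact_Icc.exists_isMinOn ⟨0, le_rfl, hTpos.le⟩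
    ((continuous_inSampleRisk X αs).comp_continuousOn hcontT)
  exact ⟨t', ht', fun s hs' => hmin hs', (hmin ht).trans hfin⟩

/-! ### High-probability bounds for the offset Gaussian process. -/

section Probability

open MeasureTheory ProbabilityTheory

/-! ### Events of large probability -/

theorem WithProbAtLeast.mono {Ω : Type*} [MeasurableSpace Ω] {μ : Measure Ω} {q q' : ℝ}
    {P P' : Ω → Prop} (h : WithProbAtLeast μ q P) (hq : q' ≤ q) (hP : ∀ ω, P ω → P' ω) :
    WithProbAtLeast μ q' P' := by
  obtain ⟨A, hA, hμ, hAP⟩ := h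
  exact ⟨A, hA, (ENNReal.ofReal_le_ofReal hq).trans hμ, fun ω hω => hP ω (hAP ω hω)⟩

theorem one_sub_le_measure {Ω : Type*} [MeasurableSpace Ω] {μ : Measure Ω}
    [IsProbabilityMeasure μ] {A : Set Ω} (hA : MeasurableSet A) {a : ℝ} (ha : 0 ≤ a)
    (h : μ Aᶜ ≤ ENNReal.ofReal a) : ENNReal.ofReal (1 - a) ≤ μ A := by
  rw [prob_compl_eq_one_sub hA, tsub_le_iff_right] at h
  rw [ENNReal.ofReal_sub _ ha, ENNReal.ofReal_one, tsub_le_iff_right, add_comm]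
  exact h

theorem measure_compl_le_of_le {Ω : Type*} [MeasurableSpace Ω] {μ : Measure Ω}
    [IsProbabilityMeasure μ] {A : Set Ω} (hA : MeasurableSet A) {a : ℝ} (ha : 0 ≤ a)
    (h : ENNReal.ofReal (1 - a) ≤ μ A) : μ Aᶜ ≤ ENNReal.ofReal a := by
  rw [ENNReal.ofReal_sub _ ha, ENNReal.ofReal_one, tsub_le_iff_right] at h
  rw [prob_compl_eq_one_sub hA, tsub_le_iff_left]
  exact h

theorem WithProbAtLeast.and {Ω : Type*} [MeasurableSpace Ω] {μ : Measure Ω}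
    [IsProbabilityMeasure μ] {a b : ℝ} (ha : 0 ≤ a) (hb : 0 ≤ b)
    {P Q : Ω → Prop} (hP : WithProbAtLeast μ (1 - a) P) (hQ : WithProbAtLeast μ (1 - b) Q) :
    WithProbAtLeast μ (1 - (a + b)) fun ω => P ω ∧ Q ω := by
  obtain ⟨A, hA, hμA, hAP⟩ := hP
  obtain ⟨A', hA', hμA', hAQ⟩ := hQ
  refine ⟨A ∩ A', hA.inter hA', ?_, fun ω hω => ⟨hAP ω hω.1, hAQ ω hω.2⟩⟩
  refine one_sub_le_measure (hA.inter hA') (add_nonneg ha hb) ?_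
  rw [Set.compl_inter, ENNReal.ofReal_add ha hb]
  exact (measure_union_le _ _).trans (add_le_add (measure_compl_le_of_le hA ha hμA)
    (measure_compl_le_of_le hA' hb hμA'))

/-- Markov's inequality. Lower Lebesgue integrals spare every later use an integrability proof. -/
theorem withProbAtLeast_of_lintegral_le {Ω : Type*} [MeasurableSpace Ω] {μ : Measure Ω}
    [IsProbabilityMeasure μ] {F : Ω → ℝ} (hF : Measurable F) {b δ : ℝ} (hb : 0 < b)
    (hδ : 0 < δ) (h : ∫⁻ ω, ENNReal.ofReal (F ω) ∂μ ≤ ENNReal.ofReal b) :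
    WithProbAtLeast μ (1 - δ) fun ω => F ω ≤ b / δ := by
  have hA : MeasurableSet {ω | F ω ≤ b / δ} := measurableSet_le hF measurable_const
  refine ⟨_, hA, one_sub_le_measure hA hδ.le ?_, fun ω hω => hω⟩
  have hbδ : 0 < b / δ := by positivity
  calc μ {ω | F ω ≤ b / δ}ᶜ ≤ μ {ω | ENNReal.ofReal (b / δ) ≤ ENNReal.ofReal (F ω)} := by
        refine measure_mono fun ω hω => ?_
        have hω' : ¬ F ω ≤ b / δ := hω
        exact ENNReal.ofReal_le_ofReal (not_le.1 hω').le
    _ ≤ (∫⁻ ω, ENNReal.ofReal (F ω) ∂μ) / ENNReal.ofReal (b / δ) :=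
        meas_ge_le_lintegral_div hF.ennreal_ofReal.aemeasurable (by simpa using hbδ) (by simp)
    _ ≤ ENNReal.ofReal b / ENNReal.ofReal (b / δ) := by gcongr
    _ = ENNReal.ofReal δ := by
        rw [← ENNReal.ofReal_div_of_pos hbδ]; congr 1; field_simp

/-! ### Gaussian integrals -/

instance (n : ℕ) : IsProbabilityMeasure (noiseLaw n) := by unfold noiseLaw; infer_instance

instance (n d : ℕ) : IsProbabilityMeasure (designLaw n d) := by unfold designLaw; infer_instance

theorem lintegral_noiseLaw_prod (n : ℕ) {f : Fin n → ℝ → ℝ} (hf0 : ∀ i x, 0 ≤ f i x)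
    (hf : ∀ i, Integrable (f i) (gaussianReal 0 1)) :
    ∫⁻ ξ, ENNReal.ofReal (∏ i, f i (ξ i)) ∂noiseLaw n =
      ENNReal.ofReal (∏ i, ∫ x, f i x ∂gaussianReal 0 1) := by
  unfold noiseLaw
  rw [← integral_fintype_prod_eq_prod, ofReal_integral_eq_lintegral_ofReal]
  · exact Integrable.fintype_prod (f := f) hf
  · exact Filter.Eventually.of_forall fun ξ => Finset.prod_nonneg fun i _ => hf0 i _

theorem integral_exp_mul_gaussian (a : ℝ) :
    ∫ x, Real.exp (a * x) ∂gaussianReal 0 1 = Real.exp (a ^ 2 / 2) := by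
  have := congrFun (mgf_id_gaussianReal (μ := 0) (v := 1)) a
  simpa [mgf] using this

theorem lintegral_exp_inner (n : ℕ) (a : E n) :
    ∫⁻ ξ, ENNReal.ofReal (Real.exp (inner ℝ (WithLp.toLp 2 ξ) a)) ∂noiseLaw n =
      ENNReal.ofReal (Real.exp (‖a‖ ^ 2 / 2)) := by
  have h := lintegral_noiseLaw_prod n (f := fun i x => Real.exp (a i * x))
    (fun i x => (Real.exp_pos _).le) (fun i => integrable_exp_mul_gaussianReal (a i))
  simp only [integral_exp_mul_gaussian, ← Real.exp_sum] at h
  convert h using 4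
  · simp [PiLp.inner_apply]
  · rw [EuclideanSpace.real_norm_sq_eq, Finset.sum_div]

theorem integral_exp_sq_gaussian :
    ∫ x, Real.exp (x ^ 2 / 4) ∂gaussianReal 0 1 = √2 := by
  rw [integral_gaussianReal_eq_integral_smul (by simp)]
  have h : ∀ x : ℝ, gaussianPDFReal 0 1 x • Real.exp (x ^ 2 / 4) =
      (√(2 * Real.pi))⁻¹ * Real.exp (-(1 / 4) * x ^ 2) := by
    intro x
    simp only [gaussianPDFReal, smul_eq_mul, NNReal.coe_one, mul_one, sub_zero]
    rw [mul_assoc, ← Real.exp_add]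
    congr 2
    ring
  simp only [h]
  rw [integral_const_mul, integral_gaussian, ← Real.sqrt_inv, ← Real.sqrt_mul (by positivity)]
  congr 1
  have := Real.pi_pos
  field_simp
  norm_num

theorem lintegral_exp_norm_sq (n : ℕ) :
    ∫⁻ ξ, ENNReal.ofReal (Real.exp (‖(WithLp.toLp 2 ξ : E n)‖ ^ 2 / 4)) ∂noiseLaw n =
      ENNReal.ofReal (√2 ^ n) := by
  have h := lintegral_noiseLaw_prod n (f := fun _ x => Real.exp (x ^ 2 / 4))
    (fun i x => (Real.exp_pos _).le) (fun i => by
      -- The Bochner integral of a non-integrable function is `0` by convention, whereas this one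
      -- equals `√2`.
      by_contra hni
      have := integral_exp_sq_gaussian
      rw [integral_undef hni] at this
      exact (Real.sqrt_pos.2 zero_lt_two).ne this)
  simp only [integral_exp_sq_gaussian, ← Real.exp_sum, Finset.prod_const, Finset.card_univ,
    Fintype.card_fin] at h
  convert h using 4
  rw [EuclideanSpace.real_norm_sq_eq, Finset.sum_div]

theorem log_sqrt_two_pow (r : ℕ) : Real.log (√2 ^ r) ≤ r / 2 := by
  rw [Real.log_pow, Real.log_sqrt (by norm_num)]
  have := Real.log_two_lt_d9
  have : (0 : ℝ) ≤ r := by positivity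
  nlinarith

theorem measurable_toLp (n : ℕ) : Measurable (fun ξ : Fin n → ℝ => (WithLp.toLp 2 ξ : E n)) :=
  (PiLp.continuous_toLp 2 _).measurable

theorem noise_norm_sq_le (n : ℕ) :
    WithProbAtLeast (noiseLaw n) (1 - Real.exp (-0.1 * n)) fun ξ =>
      ‖(WithLp.toLp 2 ξ : E n)‖ ^ 2 ≤ 2 * n := by
  have hm := measurable_toLp n
  have h := withProbAtLeast_of_lintegral_le (μ := noiseLaw n)
    (F := fun ξ => Real.exp (‖(WithLp.toLp 2 ξ : E n)‖ ^ 2 / 4)) (by fun_prop)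
    (b := √2 ^ n) (δ := Real.exp (-0.1 * n)) (by positivity) (Real.exp_pos _)
    (lintegral_exp_norm_sq n).le
  refine h.mono le_rfl fun ξ hξ => ?_
  have h1 := Real.log_le_log (Real.exp_pos _) hξ
  rw [Real.log_exp, Real.log_div (by positivity) (Real.exp_pos _).ne', Real.log_exp, Real.log_pow,
    Real.log_sqrt (by norm_num)] at h1
  have := Real.log_two_lt_d9
  have h2 : (0 : ℝ) ≤ n := by positivity
  nlinarith

/-! ### The bound through the rank -/

/-- The square is linearized by an auxiliary Gaussian `g`: `exp(‖w‖²/4) = E_g exp⟨g, w/√2⟩`. After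
exchanging integrals, the `ξ`-integral at fixed `g` depends only on `‖∑ gᵢ uᵢ‖ = ‖g‖`, so rotation
invariance is not needed. -/
theorem lintegral_exp_orthonormal_sq {n r : ℕ} {u : Fin r → E n} (hu : Orthonormal ℝ u) :
    ∫⁻ ξ, ENNReal.ofReal (Real.exp ((∑ i, inner ℝ (WithLp.toLp 2 ξ) (u i) ^ 2) / 4))
      ∂noiseLaw n = ENNReal.ofReal (√2 ^ r) := by
  have h1 : ∀ ξ : Fin n → ℝ, ∀ g : Fin r → ℝ,
      inner ℝ (WithLp.toLp 2 g : E r)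
        ((√2)⁻¹ • WithLp.toLp 2 fun i => inner ℝ (WithLp.toLp 2 ξ) (u i)) =
      inner ℝ (WithLp.toLp 2 ξ) ((√2)⁻¹ • ∑ i, g i • u i) := by
    intro ξ g
    simp only [inner_smul_right, inner_sum]
    congr 1
    simp [PiLp.inner_apply, mul_comm]
  have h2 : ∀ ξ : Fin n → ℝ,
      ENNReal.ofReal (Real.exp ((∑ i, inner ℝ (WithLp.toLp 2 ξ) (u i) ^ 2) / 4)) =
      ∫⁻ g, ENNReal.ofReal (Real.exp (inner ℝ (WithLp.toLp 2 ξ) ((√2)⁻¹ • ∑ i, g i • u i)))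
        ∂noiseLaw r := by
    intro ξ
    simp only [← h1 ξ]
    rw [lintegral_exp_inner, norm_smul, mul_pow, EuclideanSpace.real_norm_sq_eq]
    congr 2
    simp
    ring
  simp only [h2]
  have hm := measurable_toLp n
  rw [lintegral_lintegral_swap (by simp only [Function.uncurry_def]; fun_prop)]
  simp only [lintegral_exp_inner]
  rw [← lintegral_exp_norm_sq]
  congr 1
  ext1 g
  congr 2
  rw [norm_smul, mul_pow, ← real_inner_self_eq_norm_sq (∑ i, g i • u i), hu.inner_sum,
    EuclideanSpace.real_norm_sq_eq, Real.norm_eq_abs, sq_abs, inv_pow, Real.sq_sqrt zero_le_two]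
  simp [sq]
  ring

theorem rank_event {n d : ℕ} (X : Matrix (Fin n) (Fin d) ℝ) {δ : ℝ} (hδ : 0 < δ) :
    WithProbAtLeast (noiseLaw n) (1 - δ) fun ξ => ∀ v : E d,
      inner ℝ (WithLp.toLp 2 ξ) (Matrix.toEuclideanLin X v) -
        ‖Matrix.toEuclideanLin X v‖ ^ 2 / 4 ≤ 2 * X.rank + 4 * Real.log (1 / δ) := by
  set V := LinearMap.range (Matrix.toEuclideanLin X) with hV
  have hr : Module.finrank ℝ V = X.rank := by
    have e : Matrix.toEuclideanLin X = Matrix.toLin (PiLp.basisFun 2 ℝ (Fin d))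
        (PiLp.basisFun 2 ℝ (Fin n)) X :=
      congrArg (fun f => f X) (Matrix.toLpLin_eq_toLin 2 2)
    rw [e] at hV
    exact (Matrix.rank_eq_finrank_range_toLin X (PiLp.basisFun 2 ℝ (Fin n))
      (PiLp.basisFun 2 ℝ (Fin d))).symm ▸ (by rw [hV])
  set b := (stdOrthonormalBasis ℝ V).reindex (finCongr hr) with hb
  have hu : Orthonormal ℝ (fun i => (b i : E n)) :=
    b.orthonormal.comp_linearIsometry V.subtypeₗᵢ
  have hm := measurable_toLp n
  have h := withProbAtLeast_of_lintegral_le (μ := noiseLaw n)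
    (F := fun ξ => Real.exp ((∑ i, inner ℝ (WithLp.toLp 2 ξ : E n) (b i : E n) ^ 2) / 4))
    (by fun_prop) (b := √2 ^ X.rank) (δ := δ) (by positivity) hδ
    (lintegral_exp_orthonormal_sq hu).le
  refine h.mono le_rfl fun ξ hξ v => ?_
  have h1 := Real.log_le_log (Real.exp_pos _) hξ
  rw [Real.log_exp, div_eq_mul_one_div (√2 ^ X.rank), Real.log_mul (by positivity) (by positivity)] at h1
  have h3 := log_sqrt_two_pow X.rank
  set w : V := ⟨Matrix.toEuclideanLin X v, v, rfl⟩ with hw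
  have hw' : Matrix.toEuclideanLin X v = ∑ i, inner ℝ (b i) w • (b i : E n) := by
    have := congrArg (Subtype.val) (b.sum_repr' w)
    rw [← show (w : E n) = Matrix.toEuclideanLin X v from rfl, ← this]
    simp
  have hnorm : ‖Matrix.toEuclideanLin X v‖ ^ 2 = ∑ i, inner ℝ (b i) w ^ 2 := by
    rw [← real_inner_self_eq_norm_sq, hw', hu.inner_sum]
    simp [sq]
  have hin : inner ℝ (WithLp.toLp 2 ξ) (Matrix.toEuclideanLin X v) =
      ∑ i, inner ℝ (b i) w * inner ℝ (WithLp.toLp 2 ξ : E n) (b i : E n) := by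
    rw [hw', inner_sum]
    simp [inner_smul_right]
  rw [hnorm, hin]
  -- Completing the square in each coordinate of an orthonormal basis of the range.
  have h4 : ∑ i, inner ℝ (b i) w * inner ℝ (WithLp.toLp 2 ξ : E n) (b i : E n) -
      (∑ i, inner ℝ (b i) w ^ 2) / 4 ≤ ∑ i, inner ℝ (WithLp.toLp 2 ξ : E n) (b i : E n) ^ 2 := by
    rw [Finset.sum_div, ← Finset.sum_sub_distrib]
    refine Finset.sum_le_sum fun i _ => ?_
    nlinarith [sq_nonneg (inner ℝ (b i) w - 2 * inner ℝ (WithLp.toLp 2 ξ : E n) (b i : E n))]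
  linarith

/-! ### Sparsification of convex combinations -/

section Sparsification

variable {H ι : Type*} [NormedAddCommGroup H] [InnerProductSpace ℝ H] [Fintype ι]

/-- The offset functional `⟨ξ, z⟩ - c ‖z‖²`. -/
def offset (ξ : H) (c : ℝ) (z : H) : ℝ := inner ℝ ξ z - c * ‖z‖ ^ 2

theorem offset_add (ξ : H) (c : ℝ) (z u : H) :
    offset ξ c (z + u) = offset ξ c z + inner ℝ (ξ - (2 * c) • z) u - c * ‖u‖ ^ 2 := by
  simp only [offset, inner_add_right, norm_add_sq_real, inner_sub_left, inner_smul_left]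
  simp only [conj_trivial]
  ring

/-- Average over `j` with weights `w`: the linear term vanishes because the `x j - μ` have mean
zero, and the quadratic term is `c t²` times a variance of at most `b`. Some `j` does at least as
well as the average. -/
theorem exists_offset_le (ξ : H) {c b : ℝ} (hc : 0 ≤ c) {x : ι → H} (hx : ∀ j, ‖x j‖ ^ 2 ≤ b)
    {w : ι → ℝ} (hw0 : ∀ j, 0 ≤ w j) (hw1 : ∑ j, w j = 1) (z : H) (t : ℝ) :
    ∃ j, offset ξ c z ≤
      offset ξ c (z + t • (x j - ∑ i, w i • x i)) + c * b * t ^ 2 := by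
  set μ := ∑ i, w i • x i with hμ
  by_contra! hlt
  have h1 : ∑ j, w j * (offset ξ c (z + t • (x j - μ)) + c * b * t ^ 2) <
      ∑ j, w j * offset ξ c z := by
    refine Finset.sum_lt_sum (fun j _ => mul_le_mul_of_nonneg_left (hlt j).le (hw0 j)) ?_
    by_contra! hno
    have : ∑ j, w j = 0 := Finset.sum_eq_zero fun j _ => by
      by_contra hne
      have := hno j (Finset.mem_univ _)
      exact absurd (mul_lt_mul_of_pos_left (hlt j) (lt_of_le_of_ne (hw0 j) (Ne.symm hne)))
        (not_lt.2 this)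
    linarith
  have h2 : ∑ j, w j • (x j - μ) = 0 := by
    simp only [smul_sub, Finset.sum_sub_distrib, ← Finset.sum_smul, hw1, one_smul, ← hμ, sub_self]
  have h3 : ∑ j, w j * inner ℝ (ξ - (2 * c) • z) (t • (x j - μ)) = 0 := by
    have : ∀ j, w j * inner ℝ (ξ - (2 * c) • z) (t • (x j - μ)) =
        t * inner ℝ (ξ - (2 * c) • z) (w j • (x j - μ)) := by
      intro j; simp only [inner_smul_right]; ring
    simp only [this]
    rw [← Finset.mul_sum, ← inner_sum, h2, inner_zero_right, mul_zero]
  have h4 : ∑ j, w j * ‖x j - μ‖ ^ 2 ≤ b := by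
    have e : ∀ j, w j * ‖x j - μ‖ ^ 2 =
        w j * ‖x j‖ ^ 2 - 2 * inner ℝ (w j • x j) μ + w j * ‖μ‖ ^ 2 := by
      intro j; rw [norm_sub_sq_real, inner_smul_left, conj_trivial]; ring
    simp only [e, Finset.sum_add_distrib, Finset.sum_sub_distrib, ← Finset.mul_sum, ← sum_inner,
      ← Finset.sum_mul, hw1, ← hμ, real_inner_self_eq_norm_sq]
    have : ∑ j, w j * ‖x j‖ ^ 2 ≤ ∑ j, w j * b :=
      Finset.sum_le_sum fun j _ => mul_le_mul_of_nonneg_left (hx j) (hw0 j)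
    rw [← Finset.sum_mul, hw1] at this
    nlinarith [sq_nonneg ‖μ‖]
  have h5 : ∀ j, w j * (offset ξ c (z + t • (x j - μ)) + c * b * t ^ 2) =
      w j * (offset ξ c z + c * b * t ^ 2) +
        w j * inner ℝ (ξ - (2 * c) • z) (t • (x j - μ)) -
        c * t ^ 2 * (w j * ‖x j - μ‖ ^ 2) := by
    intro j
    rw [offset_add, norm_smul, mul_pow, Real.norm_eq_abs, sq_abs]
    ring
  simp only [h5, Finset.sum_add_distrib, Finset.sum_sub_distrib, h3, ← Finset.mul_sum,
    ← Finset.sum_mul, hw1] at h1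
  have h6 := mul_le_mul_of_nonneg_left h4 (mul_nonneg hc (sq_nonneg t))
  nlinarith

/-- **Maurey's empirical method** for the offset functional: at a convex combination it is at most
its value at some average of `k` of the points, up to `c b / k`. -/
theorem exists_sym_offset_le (ξ : H) {c b : ℝ} (hc : 0 ≤ c) {x : ι → H}
    (hx : ∀ j, ‖x j‖ ^ 2 ≤ b) {w : ι → ℝ} (hw0 : ∀ j, 0 ≤ w j) (hw1 : ∑ j, w j = 1)
    {k : ℕ} (hk : 0 < k) :
    ∃ s : Sym ι k, offset ξ c (∑ j, w j • x j) ≤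
      offset ξ c ((k : ℝ)⁻¹ • ((s : Multiset ι).map x).sum) + c * b / k := by
  set μ := ∑ i, w i • x i with hμ
  have hk' : (k : ℝ) ≠ 0 := by positivity
  -- Greedy form of the random choice: `k` copies of `μ` are replaced by points one at a time, and
  -- each replacement costs `c b / k²`.
  have main : ∀ i : ℕ, ∃ s : Multiset ι, s.card = i ∧ offset ξ c μ ≤
      offset ξ c (μ + (k : ℝ)⁻¹ • ((s.map x).sum - (i : ℝ) • μ)) + i * (c * b * (k : ℝ)⁻¹ ^ 2) := by
    intro i
    induction i with
    | zero => exact ⟨0, by simp⟩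
    | succ i ih =>
      obtain ⟨s, hs, hle⟩ := ih
      obtain ⟨j, hj⟩ := exists_offset_le ξ hc hx hw0 hw1
        (μ + (k : ℝ)⁻¹ • ((s.map x).sum - (i : ℝ) • μ)) (k : ℝ)⁻¹
      refine ⟨j ::ₘ s, by simp [hs], ?_⟩
      have e : μ + (k : ℝ)⁻¹ • ((((j ::ₘ s).map x).sum) - ((i + 1 : ℕ) : ℝ) • μ) =
          μ + (k : ℝ)⁻¹ • ((s.map x).sum - (i : ℝ) • μ) +
            (k : ℝ)⁻¹ • (x j - ∑ i, w i • x i) := by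
        rw [Multiset.map_cons, Multiset.sum_cons, ← hμ]
        push_cast
        module
      rw [e]
      push_cast
      linarith
  obtain ⟨s, hs, hle⟩ := main k
  refine ⟨⟨s, hs⟩, ?_⟩
  have e : μ + (k : ℝ)⁻¹ • ((s.map x).sum - (k : ℝ) • μ) = (k : ℝ)⁻¹ • (s.map x).sum := by
    rw [smul_sub, smul_smul, inv_mul_cancel₀ hk', one_smul]; abel
  rw [e] at hle
  have e' : (k : ℝ) * (c * b * (k : ℝ)⁻¹ ^ 2) = c * b / k := by field_simp
  rw [e'] at hle
  exact hle

end Sparsification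

/-- `N = 2d + k - 1 ≤ 3d`, `N.choose k ≤ N^k / k!` and `k^k / k! ≤ e^k`. Dividing by `k` inside the
logarithm is the gain over counting ordered tuples. -/
theorem log_multichoose_le {d k : ℕ} (hk : 0 < k) (hkd : k ≤ d) :
    Real.log ((2 * d).multichoose k) ≤ k * (Real.log (3 * (Real.exp 1 * d / k))) := by
  have hd : 0 < d := by omega
  have h0 : 0 < (2 * d).multichoose k := by
    rw [Nat.multichoose_eq]; exact Nat.choose_pos (by omega)
  have hkR : (0 : ℝ) < k := by exact_mod_cast hk
  have hdR : (0 : ℝ) < d := by exact_mod_cast hd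
  rw [← Real.log_pow]
  apply Real.log_le_log (by exact_mod_cast h0)
  rw [Nat.multichoose_eq]
  have h1 := Nat.choose_le_pow_div (α := ℝ) k (2 * d + k - 1)
  have h2 : ((2 * d + k - 1 : ℕ) : ℝ) ≤ 3 * d := by
    have : 2 * d + k - 1 ≤ 3 * d := by omega
    exact_mod_cast this
  have h3 := Real.pow_div_factorial_le_exp (k : ℝ) hkR.le k
  have hf : (0 : ℝ) < k.factorial := by exact_mod_cast k.factorial_pos
  refine h1.trans ?_
  calc ((2 * d + k - 1 : ℕ) : ℝ) ^ k / k.factorial ≤ (3 * d) ^ k / k.factorial := by gcongr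
    _ = (3 * d / k) ^ k * ((k : ℝ) ^ k / k.factorial) := by
        rw [div_pow]; field_simp
    _ ≤ (3 * d / k) ^ k * Real.exp k := by gcongr
    _ = (3 * (Real.exp 1 * d / k)) ^ k := by
        rw [← mul_one (k : ℝ), Real.exp_nat_mul, ← mul_pow]
        simp only [mul_one]
        congr 1
        ring

/-! ### The bound through the `ℓ₁`-norm -/

/-- The column `X e_j` as a vector of `ℝⁿ`. -/
def column {n d : ℕ} (X : Matrix (Fin n) (Fin d) ℝ) (j : Fin d) : E n :=
  WithLp.toLp 2 fun i => X i j

theorem toEuclideanLin_eq_sum {n d : ℕ} (X : Matrix (Fin n) (Fin d) ℝ) (v : E d) :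
    Matrix.toEuclideanLin X v = ∑ j, v j • column X j := by
  ext i
  simp [Matrix.mulVec, dotProduct, column, mul_comm]

theorem ColumnNormalized.norm_column_sq_le {n d : ℕ} {X : Matrix (Fin n) (Fin d) ℝ}
    (h : ColumnNormalized X) (j : Fin d) : ‖column X j‖ ^ 2 ≤ n := by
  rw [EuclideanSpace.real_norm_sq_eq]
  have := (Real.sqrt_le_sqrt_iff (by positivity)).1 (h j)
  simpa [column] using this

theorem ColumnNormalized.norm_apply_sq_le {n d : ℕ} {X : Matrix (Fin n) (Fin d) ℝ}
    (h : ColumnNormalized X) {v : E d} {s : ℝ} (hs : ∑ i, |v i| ≤ s) :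
    ‖Matrix.toEuclideanLin X v‖ ^ 2 ≤ s ^ 2 * n := by
  have h1 : ‖Matrix.toEuclideanLin X v‖ ≤ s * √(n : ℝ) := by
    rw [toEuclideanLin_eq_sum]
    calc ‖∑ j, v j • column X j‖ ≤ ∑ j, ‖v j • column X j‖ := norm_sum_le _ _
      _ ≤ ∑ j, |v j| * √(n : ℝ) := by
          refine Finset.sum_le_sum fun j _ => ?_
          rw [norm_smul, Real.norm_eq_abs]
          exact mul_le_mul_of_nonneg_left (Real.le_sqrt_of_sq_le (h.norm_column_sq_le j))
            (abs_nonneg _)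
      _ = (∑ j, |v j|) * √(n : ℝ) := by rw [Finset.sum_mul]
      _ ≤ s * √(n : ℝ) := mul_le_mul_of_nonneg_right hs (Real.sqrt_nonneg _)
  have h2 := pow_le_pow_left₀ (norm_nonneg _) h1 2
  rwa [mul_pow, Real.sq_sqrt (by positivity)] at h2

theorem inner_apply_le {n d : ℕ} (X : Matrix (Fin n) (Fin d) ℝ) (ξ : E n) {v : E d} {s M : ℝ}
    (hs : ∑ i, |v i| ≤ s) (hM0 : 0 ≤ M) (hM : ∀ j, |inner ℝ ξ (column X j)| ≤ M) :
    inner ℝ ξ (Matrix.toEuclideanLin X v) ≤ s * M := by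
  rw [toEuclideanLin_eq_sum, inner_sum]
  calc ∑ j, inner ℝ ξ (v j • column X j) ≤ ∑ j, |v j| * M := by
        refine Finset.sum_le_sum fun j _ => ?_
        rw [inner_smul_right]
        refine (le_abs_self _).trans ?_
        rw [abs_mul]
        exact mul_le_mul_of_nonneg_left (hM j) (abs_nonneg _)
    _ = (∑ j, |v j|) * M := by rw [Finset.sum_mul]
    _ ≤ s * M := mul_le_mul_of_nonneg_right hs hM0

/-- The signed and rescaled columns of `X`, whose convex hull is the image of `s B₁`. -/
def signedColumn {n d : ℕ} (X : Matrix (Fin n) (Fin d) ℝ) (s : ℝ) (p : Fin d × Bool) : E n :=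
  (if p.2 then s else -s) • column X p.1

theorem exists_convex_weights {n d : ℕ} (hd : 0 < d) (X : Matrix (Fin n) (Fin d) ℝ) {s : ℝ}
    (hs : 0 < s) {v : E d} (hv : ∑ i, |v i| ≤ s) :
    ∃ w : Fin d × Bool → ℝ, (∀ p, 0 ≤ w p) ∧ ∑ p, w p = 1 ∧
      ∑ p, w p • signedColumn X s p = Matrix.toEuclideanLin X v := by
  -- The mass missing when `‖v‖₁ < s` is spread evenly over all signed columns, where opposite signs
  -- cancel.
  set q := (1 - (∑ i, |v i|) / s) / (2 * d) with hq
  have hdR : (0 : ℝ) < d := by exact_mod_cast hd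
  have hq0 : 0 ≤ q := by
    have : (∑ i, |v i|) / s ≤ 1 := (div_le_one hs).2 hv
    exact div_nonneg (by linarith) (by positivity)
  refine ⟨fun p => (|v p.1| + if p.2 then v p.1 else -v p.1) / (2 * s) + q, ?_, ?_, ?_⟩
  · rintro ⟨j, b⟩
    refine add_nonneg (div_nonneg ?_ (by positivity)) hq0
    cases b
    · simpa using le_abs_self _
    · simpa [add_comm] using neg_le_iff_add_nonneg.1 (neg_abs_le (v j))
  · rw [Fintype.sum_prod_type]
    have : ∀ j, ∑ b : Bool, ((|v j| + if b then v j else -v j) / (2 * s) + q) =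
        |v j| / s + 2 * q := by
      intro j; simp; field_simp; ring
    simp only [this, Finset.sum_add_distrib, ← Finset.sum_div]
    simp
    rw [hq]
    field_simp
    ring
  · rw [Fintype.sum_prod_type, toEuclideanLin_eq_sum]
    refine Finset.sum_congr rfl fun j _ => ?_
    simp only [Fintype.sum_bool, signedColumn, smul_smul, ← add_smul]
    congr 1
    simp
    field_simp
    ring

/-- At the exponent `2c` the Gaussian moment generating function cancels the quadratic offset
exactly, whatever the size of `z`. A union bound then costs only the logarithm of the number of
points. -/
theorem lintegral_exp_offset {n : ℕ} {c : ℝ} (z : E n) :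
    ∫⁻ ξ, ENNReal.ofReal (Real.exp (2 * c * offset (WithLp.toLp 2 ξ) c z)) ∂noiseLaw n = 1 := by
  have h : ∀ ξ : Fin n → ℝ, ENNReal.ofReal (Real.exp (2 * c * offset (WithLp.toLp 2 ξ) c z)) =
      ENNReal.ofReal (Real.exp (inner ℝ (WithLp.toLp 2 ξ) ((2 * c) • z))) *
        ENNReal.ofReal (Real.exp (-(2 * c ^ 2 * ‖z‖ ^ 2))) := by
    intro ξ
    rw [← ENNReal.ofReal_mul (Real.exp_pos _).le, ← Real.exp_add, inner_smul_right, offset]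
    congr 2
    ring
  simp only [h]
  have hm := measurable_toLp n
  rw [lintegral_mul_const _ (by fun_prop), lintegral_exp_inner,
    ← ENNReal.ofReal_mul (Real.exp_pos _).le, ← Real.exp_add, norm_smul, mul_pow,
    Real.norm_eq_abs, sq_abs, ← ENNReal.ofReal_one, ← Real.exp_zero]
  congr 2
  ring

/-- Markov's inequality for the sum of exponentials over all multisets of `k` signed columns gives
the first term; the second is the sparsification error. -/
theorem offset_event {n d : ℕ} (hd : 0 < d) {X : Matrix (Fin n) (Fin d) ℝ}
    (hX : ColumnNormalized X) {s c δ : ℝ} (hs : 0 < s) (hc : 0 < c) (hδ : 0 < δ) {k : ℕ}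
    (hk : 0 < k) :
    WithProbAtLeast (noiseLaw n) (1 - δ) fun ξ => ∀ v : E d, ∑ i, |v i| ≤ s →
      offset (WithLp.toLp 2 ξ) c (Matrix.toEuclideanLin X v) ≤
        (Real.log ((2 * d).multichoose k) + Real.log (1 / δ)) / (2 * c) + c * (s ^ 2 * n) / k := by
  set z : Sym (Fin d × Bool) k → E n := fun m =>
    (k : ℝ)⁻¹ • ((m : Multiset (Fin d × Bool)).map (signedColumn X s)).sum with hz
  have hm := measurable_toLp n
  have hcard : (Fintype.card (Sym (Fin d × Bool) k)) = (2 * d).multichoose k := by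
    rw [Sym.card_sym_eq_multichoose]; simp [mul_comm]
  have hN : (0 : ℝ) < ((2 * d).multichoose k : ℕ) := by
    have : 0 < (2 * d).multichoose k := by
      rw [Nat.multichoose_eq]; exact Nat.choose_pos (by omega)
    exact_mod_cast this
  have h := withProbAtLeast_of_lintegral_le (μ := noiseLaw n)
    (F := fun ξ => ∑ m, Real.exp (2 * c * offset (WithLp.toLp 2 ξ) c (z m)))
    (by unfold offset; fun_prop) (b := (2 * d).multichoose k) hN hδ (by
      simp only [ENNReal.ofReal_sum_of_nonneg (fun m _ => (Real.exp_pos _).le)]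
      rw [lintegral_finsetSum _ (fun m _ => by unfold offset; fun_prop)]
      simp only [lintegral_exp_offset]
      simp [hcard])
  refine h.mono le_rfl fun ξ hξ v hv => ?_
  obtain ⟨w, hw0, hw1, hw⟩ := exists_convex_weights hd X hs hv
  obtain ⟨m, hle⟩ := exists_sym_offset_le (WithLp.toLp 2 ξ : E n) hc.le
    (x := signedColumn X s) (b := s ^ 2 * n) (by
      rintro ⟨j, b⟩
      rw [signedColumn, norm_smul, mul_pow, Real.norm_eq_abs, sq_abs]
      have : (if b then s else -s) ^ 2 = s ^ 2 := by cases b <;> simp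
      rw [this]
      exact mul_le_mul_of_nonneg_left (hX.norm_column_sq_le j) (sq_nonneg s)) hw0 hw1 hk
  rw [hw] at hle
  refine hle.trans (add_le_add ?_ le_rfl)
  have h1 : Real.exp (2 * c * offset (WithLp.toLp 2 ξ) c (z m)) ≤
      (2 * d).multichoose k / δ :=
    (Finset.single_le_sum (f := fun m => Real.exp (2 * c * offset (WithLp.toLp 2 ξ) c (z m)))
      (fun m _ => (Real.exp_pos _).le) (Finset.mem_univ m)).trans hξ
  have h2 := Real.log_le_log (Real.exp_pos _) h1
  rw [Real.log_exp, div_eq_mul_one_div, Real.log_mul hN.ne' (by positivity)] at h2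
  rw [le_div_iff₀ (by positivity)]
  linarith

/-- With `m = τ√n`, the counting cost is of order `k L` and the sparsification error of order
`m²/k`, where `L` is the logarithm. The choice `k ≈ m/√L` balances them at `m√L`, provided it is at
least 1; otherwise the offset parameter is tuned instead. -/
theorem l1_event {n d : ℕ} {τ δ : ℝ} (hn : 0 < n) (hτ : 0 < τ) (hnd : τ * √(n : ℝ) ≤ d)
    {X : Matrix (Fin n) (Fin d) ℝ} (hX : ColumnNormalized X) (hδ : 0 < δ) (hδ1 : δ < 1) :
    WithProbAtLeast (noiseLaw n) (1 - δ) fun ξ => ∀ v : E d, ∑ i, |v i| ≤ 10 * τ →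
      inner ℝ (WithLp.toLp 2 ξ) (Matrix.toEuclideanLin X v) -
        ‖Matrix.toEuclideanLin X v‖ ^ 2 / 4 ≤
      202 * (τ * √(n : ℝ) * √(Real.log (Real.exp 1 * d / (τ * √(n : ℝ)))) +
        Real.log (1 / δ)) := by
  have hnR : (0 : ℝ) < n := by exact_mod_cast hn
  set m := τ * √(n : ℝ) with hm
  have hm0 : 0 < m := by positivity
  have hdR : (0 : ℝ) < d := hm0.trans_le hnd
  have hd : 0 < d := by exact_mod_cast hdR
  set L := Real.log (Real.exp 1 * d / m) with hL
  have hLeq : L = 1 + Real.log d - Real.log m := by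
    rw [hL, Real.log_div (by positivity) hm0.ne', Real.log_mul (by positivity) hdR.ne',
      Real.log_exp]
  have hL1 : 1 ≤ L := by
    have := Real.log_le_log hm0 hnd
    linarith
  have hsm : (10 * τ) ^ 2 * n = 100 * m ^ 2 := by
    rw [hm, mul_pow, mul_pow, Real.sq_sqrt hnR.le]; ring
  have hδL : 0 ≤ Real.log (1 / δ) := Real.log_nonneg (by rw [le_div_iff₀ hδ]; linarith)
  set r := √L with hr
  have hr2 : r ^ 2 = L := Real.sq_sqrt (by linarith)
  have hr1 : 1 ≤ r := Real.one_le_sqrt.2 hL1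
  have hr0 : 0 < r := by linarith
  have hlogr : Real.log r ≤ L / 2 := by
    have : Real.log L = 2 * Real.log r := by rw [← hr2, Real.log_pow]; norm_num
    have h2 := Real.log_le_sub_one_of_pos (show 0 < L by linarith)
    linarith
  rcases le_or_gt r m with hrm | hrm
  -- Rounding up at most doubles `m / r ≥ 1`.
  · set k := ⌈m / r⌉₊ with hk
    have hk0 : 0 < k := Nat.ceil_pos.2 (by positivity)
    have hkR : (0 : ℝ) < k := by exact_mod_cast hk0
    have hk1 : m / r ≤ k := Nat.le_ceil _
    have hk2 : (k : ℝ) ≤ 2 * (m / r) := by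
      have h1 := Nat.ceil_lt_add_one (show 0 ≤ m / r by positivity)
      have h2 : 1 ≤ m / r := (one_le_div hr0).2 hrm
      rw [← hk] at h1
      linarith
    have hkd : k ≤ d := by
      refine Nat.ceil_le.2 (le_trans ?_ hnd)
      exact div_le_self hm0.le hr1
    have hlog : Real.log ((2 * d).multichoose k) ≤ k * (3.5 * L) := by
      refine (log_multichoose_le hk0 hkd).trans ?_
      refine mul_le_mul_of_nonneg_left ?_ hkR.le
      rw [Real.log_mul (by norm_num) (by positivity), Real.log_div (by positivity) hkR.ne',
        Real.log_mul (by positivity) hdR.ne', Real.log_exp]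
      have h1 := Real.log_le_log (by positivity) hk1
      rw [Real.log_div hm0.ne' hr0.ne'] at h1
      have h3 := Real.log_le_sub_one_of_pos (show (0 : ℝ) < 3 by norm_num)
      linarith
    have hkL : (k : ℝ) * L ≤ 2 * (m * r) := by
      calc (k : ℝ) * L ≤ 2 * (m / r) * L := mul_le_mul_of_nonneg_right hk2 (by linarith)
        _ = 2 * (m * r) := by rw [← hr2]; field_simp
    have hmk : m ^ 2 / k ≤ m * r := by
      rw [div_le_iff₀ hkR]
      rw [div_le_iff₀ hr0] at hk1
      nlinarith
    refine (offset_event hd hX (s := 10 * τ) (c := 1 / 4) (by positivity) (by norm_num) hδ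
      hk0).mono le_rfl fun ξ h v hv => ?_
    have h1 := h v hv
    rw [offset, hsm] at h1
    have h2 : (1 / 4 : ℝ) * (100 * m ^ 2) / k = 25 * (m ^ 2 / k) := by ring
    have h3 : (Real.log ((2 * d).multichoose k) + Real.log (1 / δ)) / (2 * (1 / 4)) =
        2 * (Real.log ((2 * d).multichoose k) + Real.log (1 / δ)) := by ring
    rw [h2, h3] at h1
    have hmr : 0 ≤ m * r := by positivity
    linarith
  -- Here `k = 1` and the offset parameter is `r / m`. Replacing `1/4` by `r / m` costs `(r /
  -- m)‖Xv‖² ≤ 100 m r`, the sparsification error is another `100 m r`, and `log (2d)` is of order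
  -- `L` because `m < √L`.
  · have hc : 1 ≤ r / m := (one_le_div hm0).2 hrm.le
    refine (offset_event hd hX (s := 10 * τ) (c := r / m) (by positivity) (by positivity) hδ
      (k := 1) one_pos).mono le_rfl fun ξ h v hv => ?_
    have h1 := h v hv
    have h2 := hX.norm_apply_sq_le hv
    rw [offset, hsm] at h1
    rw [hsm] at h2
    have h3 : r / m * m ^ 2 = m * r := by field_simp
    have h4 := mul_le_mul_of_nonneg_left h2 (show 0 ≤ r / m by positivity)
    rw [Nat.multichoose_one_right] at h1
    have h5 : Real.log ((2 * d : ℕ) : ℝ) ≤ 2.5 * L := by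
      push_cast
      rw [Real.log_mul (by norm_num) hdR.ne']
      have h6 := Real.log_le_log hm0 hrm.le
      have := Real.log_two_lt_d9
      linarith
    have h7 : (Real.log ((2 * d : ℕ) : ℝ) + Real.log (1 / δ)) / (2 * (r / m)) ≤
        1.25 * (m * r) + Real.log (1 / δ) / 2 := by
      rw [div_le_iff₀ (by positivity)]
      have h8 : 1.25 * (m * r) * (2 * (r / m)) = 2.5 * L := by rw [← hr2]; field_simp; norm_num
      nlinarith
    have hn0 : 0 ≤ ‖Matrix.toEuclideanLin X v‖ ^ 2 := by positivity
    have h9 : r / m * (100 * m ^ 2) = 100 * (m * r) := by rw [← h3]; ring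
    simp only [Nat.cast_one, div_one] at h1
    have hmr : 0 ≤ m * r := by positivity
    have h10 : ‖Matrix.toEuclideanLin X v‖ ^ 2 ≤ r / m * ‖Matrix.toEuclideanLin X v‖ ^ 2 :=
      le_mul_of_one_le_left hn0 hc
    linarith

/-- Only the event for the smaller term of the minimum is used, so `δ` is paid once. The constant
1000 absorbs `4 · 202` and the rank constants 8 and 16. -/
theorem fixed_design_event {n d : ℕ} {τ δ ca : ℝ} (hn : 0 < n) (hτ : 0 < τ)
    (hnd : τ * √(n : ℝ) ≤ d) {X : Matrix (Fin n) (Fin d) ℝ} (hX : ColumnNormalized X)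
    (hδ : 0 < δ) (hδ1 : δ < 1) (hca : 1 ≤ ca) :
    WithProbAtLeast (noiseLaw n) (1 - Real.exp (-0.1 * n) - δ)
      (GoodNoise X τ (1000 * fixedRate X ca τ δ)) := by
  have hnR : (0 : ℝ) < n := by exact_mod_cast hn
  have hδL : 0 ≤ Real.log (1 / δ) / n :=
    div_nonneg (Real.log_nonneg (by rw [le_div_iff₀ hδ]; linarith)) hnR.le
  have key : WithProbAtLeast (noiseLaw n) (1 - δ) fun ξ => ∀ v : E d, ∑ i, |v i| ≤ 10 * τ →
      4 / n * (inner ℝ (WithLp.toLp 2 ξ) (Matrix.toEuclideanLin X v) -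
        ‖Matrix.toEuclideanLin X v‖ ^ 2 / 4) ≤ 1000 * fixedRate X ca τ δ := by
    rcases min_choice ((X.rank : ℝ) / n)
      (ca * τ * √(Real.log (Real.exp 1 * d / (τ * √(n : ℝ))) / n)) with h | h
    · refine (rank_event X hδ).mono le_rfl fun ξ hξ v _ => ?_
      rw [fixedRate, h]
      have h1 := mul_le_mul_of_nonneg_left (hξ v) (show 0 ≤ 4 / (n : ℝ) by positivity)
      have h2 : 4 / (n : ℝ) * (2 * X.rank + 4 * Real.log (1 / δ)) =
        8 * ((X.rank : ℝ) / n) + 16 * (Real.log (1 / δ) / n) := by ring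
      have h3 : (0 : ℝ) ≤ (X.rank : ℝ) / n := by positivity
      linarith
    · refine (l1_event hn hτ hnd hX hδ hδ1).mono le_rfl fun ξ hξ v hv => ?_
      rw [fixedRate, h]
      set L := Real.log (Real.exp 1 * d / (τ * √(n : ℝ)))
      have h1 := mul_le_mul_of_nonneg_left (hξ v hv) (show 0 ≤ 4 / (n : ℝ) by positivity)
      have h4 : √(n : ℝ) / n = 1 / √(n : ℝ) := by
        rw [div_eq_div_iff hnR.ne' (by positivity), one_mul, Real.mul_self_sqrt hnR.le]
      have h2 : 4 / (n : ℝ) * (202 * (τ * √(n : ℝ) * √L + Real.log (1 / δ))) =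
          808 * (τ * √(L / n)) + 808 * (Real.log (1 / δ) / n) := by
        rw [Real.sqrt_div' _ hnR.le]
        calc _ = 808 * (τ * √L * (√(n : ℝ) / n)) + 808 * (Real.log (1 / δ) / n) := by ring
          _ = _ := by rw [h4]; ring
      have h3 : τ * √(L / n) ≤ ca * τ * √(L / n) := by
        have : 0 ≤ τ * √(L / n) := by positivity
        nlinarith
      have h5 : 0 ≤ τ * √(L / n) := by positivity
      linarith
  refine ((noise_norm_sq_le n).and (Real.exp_pos _).le hδ.le key).mono (by linarith)
    fun ξ hξ => hξ

/-! ### Gaussian designs -/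

theorem lintegral_design_exp {n d : ℕ} (ξ : E n) (j : Fin d) :
    ∫⁻ X, ENNReal.ofReal (Real.exp (inner ℝ ξ (column (Matrix.of X) j))) ∂designLaw n d =
      ENNReal.ofReal (Real.exp (‖ξ‖ ^ 2 / 2)) := by
  set ν : Measure (Fin d → ℝ) := Measure.pi fun _ => gaussianReal 0 1 with hν
  have hmp : MeasurePreserving (Function.eval j) ν (gaussianReal 0 1) :=
    measurePreserving_eval _ j
  have hint : ∀ a : ℝ, Integrable (fun x : Fin d → ℝ => Real.exp (a * x j)) ν := fun a =>
    (hmp.integrable_comp_of_integrable (integrable_exp_mul_gaussianReal a))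
  have hval : ∀ a : ℝ, ∫ x : Fin d → ℝ, Real.exp (a * x j) ∂ν = Real.exp (a ^ 2 / 2) := by
    intro a
    rw [← integral_exp_mul_gaussian a, ← hmp.map_eq,
      integral_map (measurable_pi_apply j).aemeasurable (by fun_prop)]
  have h : ∀ X : Fin n → Fin d → ℝ,
      Real.exp (inner ℝ ξ (column (Matrix.of X) j)) = ∏ i, Real.exp (ξ i * X i j) := by
    intro X
    rw [← Real.exp_sum]
    simp [PiLp.inner_apply, column, mul_comm]
  simp only [h]
  unfold designLaw
  rw [← ofReal_integral_eq_lintegral_ofReal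
    (Integrable.fintype_prod (f := fun (i : Fin n) (x : Fin d → ℝ) => Real.exp (ξ i * x j))
      fun i => hint (ξ i))
    (Filter.Eventually.of_forall fun X => Finset.prod_nonneg fun i _ => (Real.exp_pos _).le),
    integral_fintype_prod_eq_prod (f := fun (i : Fin n) (x : Fin d → ℝ) => Real.exp (ξ i * x j))]
  simp only [hval, ← Real.exp_sum]
  rw [EuclideanSpace.real_norm_sq_eq, Finset.sum_div]

/-- Subtracting `l²‖ξ‖²/2` gives every signed exponential mean 1 for each fixed `ξ`, so the size of
the noise can be inserted afterwards. The `2d` signed columns and failure probability `0.01` produce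
`200 d`. -/
theorem gaussian_column_event {n d : ℕ} (hd : 0 < d) (l : ℝ) :
    WithProbAtLeast ((designLaw n d).prod (noiseLaw n)) (1 - 0.01) fun ω => ∀ j,
      l * |inner ℝ (WithLp.toLp 2 ω.2) (column (Matrix.of ω.1) j)| ≤
        Real.log (200 * d) + l ^ 2 * ‖(WithLp.toLp 2 ω.2 : E n)‖ ^ 2 / 2 := by
  have hdR : (0 : ℝ) < d := by exact_mod_cast hd
  have hm := measurable_toLp n
  have hmi : ∀ j, Measurable fun ω : (Fin n → Fin d → ℝ) × (Fin n → ℝ) =>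
      inner ℝ (WithLp.toLp 2 ω.2 : E n) (column (Matrix.of ω.1) j) := by
    intro j
    simp only [PiLp.inner_apply, column, Matrix.of_apply]
    fun_prop
  set sgn : Bool → ℝ := fun b => if b then l else -l with hsgn
  have hsq : ∀ b, sgn b ^ 2 = l ^ 2 := by intro b; cases b <;> simp [hsgn]
  set F : Fin d × Bool → (Fin n → Fin d → ℝ) × (Fin n → ℝ) → ℝ := fun p ω =>
    Real.exp (sgn p.2 * inner ℝ (WithLp.toLp 2 ω.2 : E n) (column (Matrix.of ω.1) p.1) -
      l ^ 2 * ‖(WithLp.toLp 2 ω.2 : E n)‖ ^ 2 / 2) with hF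
  have hFm : ∀ p, Measurable (F p) := by
    intro p
    have := hmi p.1
    fun_prop
  have hint : ∀ p, ∫⁻ ω, ENNReal.ofReal (F p ω) ∂((designLaw n d).prod (noiseLaw n)) = 1 := by
    intro p
    rw [lintegral_prod_symm' _ (hFm p).ennreal_ofReal]
    have h1 : ∀ ξ : Fin n → ℝ, ∫⁻ X, ENNReal.ofReal (F p (X, ξ)) ∂designLaw n d = 1 := by
      intro ξ
      have h2 : ∀ X, ENNReal.ofReal (F p (X, ξ)) =
          ENNReal.ofReal (Real.exp
            (inner ℝ (sgn p.2 • WithLp.toLp 2 ξ : E n) (column (Matrix.of X) p.1))) *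
          ENNReal.ofReal (Real.exp (-(l ^ 2 * ‖(WithLp.toLp 2 ξ : E n)‖ ^ 2 / 2))) := by
        intro X
        rw [← ENNReal.ofReal_mul (Real.exp_pos _).le, ← Real.exp_add, inner_smul_left]
        rfl
      simp only [h2]
      rw [lintegral_mul_const' _ _ ENNReal.ofReal_ne_top, lintegral_design_exp,
        ← ENNReal.ofReal_mul (Real.exp_pos _).le, ← Real.exp_add, norm_smul, mul_pow,
        Real.norm_eq_abs, sq_abs, hsq, add_neg_cancel, Real.exp_zero, ENNReal.ofReal_one]
    simp [h1]
  have h := withProbAtLeast_of_lintegral_le (μ := (designLaw n d).prod (noiseLaw n))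
    (F := fun ω => ∑ p, F p ω) (by fun_prop) (b := 2 * d) (δ := 0.01) (by positivity)
    (by norm_num) (by
      have hsum : ∀ ω, ENNReal.ofReal (∑ p, F p ω) = ∑ p, ENNReal.ofReal (F p ω) := fun ω =>
        ENNReal.ofReal_sum_of_nonneg fun p _ => (Real.exp_pos _).le
      simp only [hsum]
      rw [lintegral_finsetSum _ (fun p _ => (hFm p).ennreal_ofReal)]
      simp only [hint]
      simp
      rw [mul_comm])
  refine h.mono le_rfl fun ω hω j => ?_
  have h1 : ∀ b, sgn b * inner ℝ (WithLp.toLp 2 ω.2 : E n) (column (Matrix.of ω.1) j) ≤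
      Real.log (200 * d) + l ^ 2 * ‖(WithLp.toLp 2 ω.2 : E n)‖ ^ 2 / 2 := by
    intro b
    have h2 : F (j, b) ω ≤ 2 * d / 0.01 :=
      (Finset.single_le_sum (f := fun p => F p ω) (fun p _ => (Real.exp_pos _).le)
        (Finset.mem_univ (j, b))).trans hω
    have h3 := Real.log_le_log (Real.exp_pos _) h2
    rw [Real.log_exp] at h3
    have e : 2 * (d : ℝ) / 0.01 = 200 * d := by norm_num; ring
    rw [e] at h3
    linarith
  rcases abs_choice (inner ℝ (WithLp.toLp 2 ω.2 : E n) (column (Matrix.of ω.1) j)) with h2 | h2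
  · rw [h2]; simpa [hsgn] using h1 true
  · rw [h2]; simpa [hsgn] using h1 false

theorem WithProbAtLeast.snd {Ω Ω' : Type*} [MeasurableSpace Ω] [MeasurableSpace Ω']
    {μ : Measure Ω} {ν : Measure Ω'} [IsProbabilityMeasure μ] [SFinite ν] {q : ℝ}
    {P : Ω' → Prop} (h : WithProbAtLeast ν q P) :
    WithProbAtLeast (μ.prod ν) q fun ω => P ω.2 := by
  obtain ⟨A, hA, hq, hP⟩ := h
  refine ⟨Set.univ ×ˢ A, MeasurableSet.univ.prod hA, ?_, fun ω hω => hP _ hω.2⟩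
  rwa [Measure.prod_prod, measure_univ, one_mul]

theorem gaussian_design_event {n d : ℕ} {τ ca : ℝ} (hn : 0 < n) (hd : 2 ≤ d) (hτ : 0 < τ)
    (hca : 1 ≤ ca) :
    WithProbAtLeast ((designLaw n d).prod (noiseLaw n)) (0.99 - 2 * Real.exp (-0.1 * n))
      fun ω => GoodNoise (Matrix.of ω.1) τ (1000 * gaussianRate n d ca τ) ω.2 := by
  have hnR : (0 : ℝ) < n := by exact_mod_cast hn
  have hd2 : (2 : ℝ) ≤ d := by exact_mod_cast hd
  have hlog2 : Real.log 2 ≤ Real.log d := Real.log_le_log (by norm_num) hd2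
  have hlogd : 0 < Real.log d := Real.log_pos (by linarith)
  have h200 : Real.log (200 * d) ≤ 9 * Real.log d := by
    rw [Real.log_mul (by norm_num) (by linarith)]
    have h1 : Real.log 200 ≤ Real.log (2 ^ 8) := Real.log_le_log (by norm_num) (by norm_num)
    rw [Real.log_pow] at h1
    push_cast at h1
    linarith
  -- This tilt balances `log (200 d)` against `l²‖ξ‖²/2 ≤ l² n = log d`.
  set l := √(Real.log d / n) with hl
  have hl0 : 0 < l := Real.sqrt_pos.2 (by positivity)
  have hl2 : l ^ 2 = Real.log d / n := Real.sq_sqrt (by positivity)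
  have he := Real.exp_pos (-0.1 * (n : ℝ))
  have h := ((noise_norm_sq_le n).snd (μ := designLaw n d)).and he.le (by norm_num)
    (gaussian_column_event (n := n) (d := d) (by omega) l)
  refine h.mono (by linarith) fun ω hω => ⟨hω.1, fun v hv => ?_⟩
  set ξ : E n := WithLp.toLp 2 ω.2 with hξ
  set u := Matrix.toEuclideanLin (Matrix.of ω.1) v with hu
  rcases min_choice 1 (ca * τ * √(Real.log d / n)) with hmin | hmin
  · rw [gaussianRate, hmin]
    have h1 : inner ℝ ξ u - ‖u‖ ^ 2 / 4 ≤ ‖ξ‖ ^ 2 := by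
      have := real_inner_le_norm ξ u
      nlinarith [sq_nonneg (‖u‖ - 2 * ‖ξ‖)]
    have h2 : 4 / (n : ℝ) * (inner ℝ ξ u - ‖u‖ ^ 2 / 4) ≤ 4 / n * (2 * n) :=
      mul_le_mul_of_nonneg_left (h1.trans hω.1) (by positivity)
    have h3 : 4 / (n : ℝ) * (2 * n) = 8 := by field_simp; norm_num
    linarith
  · rw [gaussianRate, hmin, ← hl]
    have h1 : ∀ j, |inner ℝ ξ (column (Matrix.of ω.1) j)| ≤ 10 * (n * l) := by
      intro j
      have h2 := hω.2 j
      have h3 : l ^ 2 * ‖ξ‖ ^ 2 / 2 ≤ l ^ 2 * n := by nlinarith [hω.1, sq_nonneg l]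
      have h4 : l ^ 2 * n = Real.log d := by rw [hl2]; field_simp
      have h5 : l * |inner ℝ ξ (column (Matrix.of ω.1) j)| ≤ l * (10 * (n * l)) := by
        have : l * (10 * (n * l)) = 10 * (l ^ 2 * n) := by ring
        rw [this, h4]
        linarith
      exact le_of_mul_le_mul_left h5 hl0
    have h2 := inner_apply_le (Matrix.of ω.1) ξ hv (by positivity) h1
    have h3 : 4 / (n : ℝ) * (inner ℝ ξ u - ‖u‖ ^ 2 / 4) ≤ 4 / n * (10 * τ * (10 * (n * l))) := by
      refine mul_le_mul_of_nonneg_left ?_ (by positivity)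
      have : 0 ≤ ‖u‖ ^ 2 / 4 := by positivity
      linarith
    have h4 : 4 / (n : ℝ) * (10 * τ * (10 * (n * l))) = 400 * (τ * l) := by field_simp; norm_num
    have h5 : 0 < τ * l := by positivity
    have h6 : τ * l ≤ ca * (τ * l) := le_mul_of_one_le_left h5.le hca
    linarith

end Probability

/-! ### Convexity criteria -/

theorem norm_le_sum_abs {d : ℕ} (α : E d) : ‖α‖ ≤ ∑ i, |α i| := by
  have h0 : 0 ≤ ∑ i, |α i| := Finset.sum_nonneg fun i _ => abs_nonneg _
  refine abs_le_of_sq_le_sq' ?_ h0 |>.2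
  rw [EuclideanSpace.real_norm_sq_eq]
  simpa using Finset.sum_sq_le_sq_sum_of_nonneg (s := Finset.univ) (f := fun i => |α i|)
    (fun i _ => abs_nonneg _)

theorem isNorm_norm (d : ℕ) : IsNorm (fun α : E d => ‖α‖) where
  triangle := norm_add_le
  homogeneous c x := by rw [norm_smul, Real.norm_eq_abs]
  nonneg := norm_nonneg
  definite x := norm_eq_zero.1

/-- A preimage of `θ` is a minimizer of `ψ - ⟨θ, ·⟩`, which exists because `ψ` grows at least like
`‖α‖²/c_l²`. -/
theorem gradient_surjective_of_coercive {d : ℕ} {ψ : E d → ℝ} (hψ : Differentiable ℝ ψ)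
    (h0 : ∀ α, 0 ≤ ψ α) {cl : ℝ} (hcl : 0 < cl) (hlow : ∀ α, ∑ i, |α i| ≤ cl * √(ψ α)) :
    Function.Surjective (gradient ψ) := by
  intro θ
  have hdiff : Differentiable ℝ fun α => ψ α - inner ℝ θ α :=
    hψ.sub ((innerSL ℝ θ).differentiable)
  have hlim : Filter.Tendsto (fun α => ψ α - inner ℝ θ α) (Filter.cocompact (E d))
      Filter.atTop := by
    have h1 : Filter.Tendsto (fun r : ℝ => r * (r / cl ^ 2 - ‖θ‖)) Filter.atTop Filter.atTop := by
      refine Filter.tendsto_id.atTop_mul_atTop₀ ?_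
      exact Filter.tendsto_atTop_add_const_right _ _
        (Filter.tendsto_id.atTop_div_const (by positivity))
    refine Filter.tendsto_atTop_mono (fun α => ?_) (h1.comp tendsto_norm_cocompact_atTop)
    have h2 := (norm_le_sum_abs α).trans (hlow α)
    have h3 := pow_le_pow_left₀ (norm_nonneg α) h2 2
    rw [mul_pow, Real.sq_sqrt (h0 α)] at h3
    have h4 : ‖α‖ ^ 2 / cl ^ 2 ≤ ψ α := by
      rw [div_le_iff₀ (by positivity)]; linarith
    have h5 := real_inner_le_norm θ α
    have h6 : ‖α‖ * (‖α‖ / cl ^ 2 - ‖θ‖) = ‖α‖ ^ 2 / cl ^ 2 - ‖θ‖ * ‖α‖ := by ring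
    simp only [Function.comp]
    linarith
  obtain ⟨α, hα⟩ := hdiff.continuous.exists_forall_le hlim
  refine ⟨α, ?_⟩
  have hmin : IsLocalMin (fun α => ψ α - inner ℝ θ α) α := Filter.Eventually.of_forall hα
  have h1 := hmin.hasFDerivAt_eq_zero ((hψ α).hasFDerivAt.sub (innerSL ℝ θ).hasFDerivAt)
  refine ext_inner_right ℝ fun v => ?_
  rw [inner_gradient_left]
  have := congrArg (fun f : E d →L[ℝ] ℝ => f v) h1
  simpa [sub_eq_zero] using this

theorem hasDerivAt_line_sub_sq {d : ℕ} {ψ : E d → ℝ} (hψ : Differentiable ℝ ψ) (b v : E d)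
    (c t : ℝ) : HasDerivAt (fun s : ℝ => ψ (b + s • v) - c * s ^ 2)
      (inner ℝ (gradient ψ (b + t • v)) v - c * (2 * t)) t := by
  convert! (hasDerivAt_line hψ b v t).sub (((hasDerivAt_id t).pow 2).const_mul c) using 1
  simp

/-- The tangent at `0` lies below the chord over `[0, 1]`. Working on lines lets strong convexity be
shown without a second derivative of `ψ`. -/
theorem le_bregman_of_convexOn_line {d : ℕ} {ψ : E d → ℝ} (hψ : Differentiable ℝ ψ) {c : ℝ}
    {a b : E d} (h : ConvexOn ℝ Set.univ fun t : ℝ => ψ (b + t • (a - b)) - c * t ^ 2) :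
    c ≤ bregman ψ a b := by
  have h1 := h.le_slope_of_hasDerivAt (Set.mem_univ 0) (Set.mem_univ 1) zero_lt_one
    (hasDerivAt_line_sub_sq hψ b (a - b) c 0)
  simp [slope_def_field, -inner_gradient_left] at h1
  unfold bregman
  linarith

theorem bregman_pos_of_strictConvexOn_line {d : ℕ} {ψ : E d → ℝ} (hψ : Differentiable ℝ ψ)
    {a b : E d} (h : StrictConvexOn ℝ Set.univ fun t : ℝ => ψ (b + t • (a - b))) :
    0 < bregman ψ a b := by
  have h1 := h.lt_slope_of_hasDerivAt (Set.mem_univ 0) (Set.mem_univ 1) zero_lt_one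
    (hasDerivAt_line hψ b (a - b) 0)
  simp [slope_def_field, -inner_gradient_left] at h1
  unfold bregman
  linarith

theorem strictConvexOn_of_bregman_pos {d : ℕ} {ψ : E d → ℝ}
    (h : ∀ a b, a ≠ b → 0 < bregman ψ a b) : StrictConvexOn ℝ Set.univ ψ := by
  refine ⟨convex_univ, fun a _ b _ hab s t hs ht hst => ?_⟩
  set z := s • a + t • b with hz
  have hza : a - z = t • (a - b) := by
    rw [hz, ← sub_eq_zero]
    have : s = 1 - t := by linarith
    rw [this]; module
  have hzb : b - z = (-s) • (a - b) := by
    rw [hz, ← sub_eq_zero]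
    have : t = 1 - s := by linarith
    rw [this]; module
  have hne : a - b ≠ 0 := sub_ne_zero.2 hab
  have h1 := h a z (by
    rw [← sub_ne_zero, hza]; exact smul_ne_zero ht.ne' hne)
  have h2 := h b z (by
    rw [← sub_ne_zero, hzb]; exact smul_ne_zero (neg_ne_zero.2 hs.ne') hne)
  simp only [bregman, hza, hzb, inner_smul_right] at h1 h2
  simp only [smul_eq_mul]
  have : ψ z = s * ψ z + t * ψ z := by rw [← add_mul, hst, one_mul]
  rw [this]
  nlinarith [mul_pos hs h1, mul_pos ht h2]

theorem StronglyConvexWrt.strictConvexOn {d : ℕ} {ψ N : E d → ℝ} {ρ : ℝ}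
    (h : StronglyConvexWrt ψ ρ N) (hN : IsNorm N) (hρ : 0 < ρ) :
    StrictConvexOn ℝ Set.univ ψ := by
  refine strictConvexOn_of_bregman_pos fun a b hab => lt_of_lt_of_le ?_ (h a b)
  have : 0 < N (a - b) := lt_of_le_of_ne (hN.nonneg _)
    fun h0 => hab (sub_eq_zero.1 (hN.definite _ h0.symm))
  positivity

theorem hasDerivAt_inner_gradient_line {d : ℕ} {ψ : E d → ℝ}
    (hψ : Differentiable ℝ (gradient ψ)) (b v : E d) (t : ℝ) :
    HasDerivAt (fun s : ℝ => inner ℝ (gradient ψ (b + s • v)) v)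
      (inner ℝ (hessian ψ (b + t • v) v) v) t := by
  have h1 : HasDerivAt (fun s : ℝ => b + s • v) v t := by
    simpa using ((hasDerivAt_id t).smul_const v).const_add b
  have h2 := (hψ (b + t • v)).hasFDerivAt.comp_hasDerivAt t h1
  convert! h2.inner ℝ (hasDerivAt_const t v) using 1
  simp [hessian]

theorem stronglyConvexWrt_norm_of_hessian {d : ℕ} {ψ : E d → ℝ} (h1 : Differentiable ℝ ψ)
    (h2 : Differentiable ℝ (gradient ψ)) {ρ : ℝ}
    (h : ∀ α v, ρ * ‖v‖ ^ 2 ≤ inner ℝ (hessian ψ α v) v) :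
    StronglyConvexWrt ψ ρ fun α => ‖α‖ := by
  intro a b
  refine le_bregman_of_convexOn_line h1 ?_
  refine convexOn_of_hasDerivWithinAt2_nonneg (D := Set.univ) convex_univ
    (f' := fun t => inner ℝ (gradient ψ (b + t • (a - b))) (a - b) -
      ρ / 2 * ‖a - b‖ ^ 2 * (2 * t))
    (f'' := fun t => inner ℝ (hessian ψ (b + t • (a - b)) (a - b)) (a - b) -
      ρ / 2 * ‖a - b‖ ^ 2 * 2)
    (fun t _ => (hasDerivAt_line_sub_sq h1 b (a - b) _ t).continuousAt.continuousWithinAt)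
    (fun t _ => (hasDerivAt_line_sub_sq h1 b (a - b) _ t).hasDerivWithinAt)
    (fun t _ => ?_) (fun t _ => by linarith [h (b + t • (a - b)) (a - b)])
  have := (hasDerivAt_inner_gradient_line h2 b (a - b) t).sub
    (((hasDerivAt_id t).const_mul 2).const_mul (ρ / 2 * ‖a - b‖ ^ 2))
  convert! this.hasDerivWithinAt using 1
  simp

theorem IsContinuousMirrorMap.strictConvexOn {d : ℕ} {ψ : E d → ℝ}
    (h : IsContinuousMirrorMap ψ) : StrictConvexOn ℝ Set.univ ψ := by
  refine strictConvexOn_of_bregman_pos fun a b hab => ?_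
  refine bregman_pos_of_strictConvexOn_line h.differentiable ?_
  have hline := fun t => hasDerivAt_line h.differentiable b (a - b) t
  have hd : deriv (fun t : ℝ => ψ (b + t • (a - b))) =
      fun t => inner ℝ (gradient ψ (b + t • (a - b))) (a - b) := funext fun t => (hline t).deriv
  refine strictConvexOn_of_deriv2_pos' convex_univ
    (fun t _ => (hline t).continuousAt.continuousWithinAt) fun t _ => ?_
  rw [Function.iterate_succ, Function.iterate_one, Function.comp_apply, hd,
    (hasDerivAt_inner_gradient_line h.gradient_differentiable b (a - b) t).deriv]
  exact h.hessian_pos _ _ (sub_ne_zero.2 hab)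

/-- Minimality from the sign of the derivative. -/
theorem le_of_deriv_sign {f f' : ℝ → ℝ} (hf : ∀ x, HasDerivAt f (f' x) x) {x₀ : ℝ}
    (h : ∀ x, 0 ≤ (x - x₀) * f' x) (x : ℝ) : f x₀ ≤ f x := by
  have hc : Continuous f := continuous_iff_continuousAt.2 fun x => (hf x).continuousAt
  rcases le_total x₀ x with hx | hx
  · have : MonotoneOn f (Set.Ici x₀) := by
      refine monotoneOn_of_deriv_nonneg (convex_Ici _) hc.continuousOn
        (fun x _ => (hf x).differentiableAt.differentiableWithinAt) fun x hx => ?_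
      rw [interior_Ici, Set.mem_Ioi] at hx
      rw [(hf x).deriv]
      exact nonneg_of_mul_nonneg_right (h x) (sub_pos.2 hx)
    exact this Set.self_mem_Ici hx hx
  · have : AntitoneOn f (Set.Iic x₀) := by
      refine antitoneOn_of_deriv_nonpos (convex_Iic _) hc.continuousOn
        (fun x _ => (hf x).differentiableAt.differentiableWithinAt) fun x hx => ?_
      rw [interior_Iic, Set.mem_Iio] at hx
      rw [(hf x).deriv]
      have := h x
      by_contra! hpos
      nlinarith
    exact this hx Set.self_mem_Iic hx

/-! ### Squared separable potentials -/

/-- The potential `(∑ u(αᵢ))²`. -/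
def sqSum (d : ℕ) (u : ℝ → ℝ) (α : E d) : ℝ := (∑ i, u (α i)) ^ 2

/-- The requirements on `u` that make `(∑ u(αᵢ))²` a smooth mirror map. -/
structure IsProfile (u u' u'' : ℝ → ℝ) : Prop where
  hasDerivAt : ∀ x, HasDerivAt u (u' x) x
  hasDerivAt' : ∀ x, HasDerivAt u' (u'' x) x
  contDiff : ContDiff ℝ 2 u'
  pos : ∀ x, 0 < u x
  second_pos : ∀ x, 0 < u'' x
  zero : u' 0 = 0

namespace IsProfile

variable {u u' u'' : ℝ → ℝ} {d : ℕ}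

theorem contDiff_self (h : IsProfile u u' u'') : ContDiff ℝ 2 u := by
  have : deriv u = u' := funext fun x => (h.hasDerivAt x).deriv
  rw [show (2 : WithTop ℕ∞) = 1 + 1 by norm_num, contDiff_succ_iff_deriv, this]
  exact ⟨fun x => (h.hasDerivAt x).differentiableAt, by simp, h.contDiff.of_le (by norm_num)⟩

theorem convexOn (h : IsProfile u u' u'') : ConvexOn ℝ Set.univ u :=
  convexOn_of_hasDerivWithinAt2_nonneg convex_univ
    (fun x _ => (h.hasDerivAt x).continuousAt.continuousWithinAt)
    (fun x _ => (h.hasDerivAt x).hasDerivWithinAt)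
    (fun x _ => (h.hasDerivAt' x).hasDerivWithinAt) (fun x _ => (h.second_pos x).le)

theorem sqrt_sqSum (h : IsProfile u u' u'') (α : E d) : √(sqSum d u α) = ∑ i, u (α i) :=
  Real.sqrt_sq (Finset.sum_nonneg fun _ _ => (h.pos _).le)

theorem sqrt_convex (h : IsProfile u u' u'') : ConvexOn ℝ Set.univ fun α : E d => √(sqSum d u α) := by
  simp only [h.sqrt_sqSum]
  refine ⟨convex_univ, fun a _ b _ s t hs ht hst => ?_⟩
  simp only [smul_eq_mul, Finset.mul_sum, ← Finset.sum_add_distrib]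
  exact Finset.sum_le_sum fun i _ => h.convexOn.2 (Set.mem_univ _) (Set.mem_univ _) hs ht hst

theorem hasGradientAt_sqSum (h : IsProfile u u' u'') (α : E d) : HasGradientAt (sqSum d u)
    ((2 * ∑ i, u (α i)) • WithLp.toLp 2 fun i => u' (α i)) α := by
  rw [hasGradientAt_iff_hasFDerivAt]
  have h1 : HasFDerivAt (fun α : E d => ∑ i, u (α i))
      (∑ i, u' (α i) • (EuclideanSpace.proj i : E d →L[ℝ] ℝ)) α := by
    refine HasFDerivAt.fun_sum fun i _ => ?_
    exact (h.hasDerivAt (α i)).comp_hasFDerivAt α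
      (EuclideanSpace.proj i : E d →L[ℝ] ℝ).hasFDerivAt
  have h2 := h1.pow 2
  convert! h2 using 1
  ext v
  simp [PiLp.inner_apply, mul_comm, mul_assoc]

theorem gradient_sqSum (h : IsProfile u u' u'') : gradient (sqSum d u) =
    fun α => (2 * ∑ i, u (α i)) • WithLp.toLp 2 fun i => u' (α i) :=
  funext fun α => (h.hasGradientAt_sqSum α).gradient

theorem contDiff_gradient (h : IsProfile u u' u'') : ContDiff ℝ 2 (gradient (sqSum d u)) := by
  rw [h.gradient_sqSum]
  have hp : ∀ i, ContDiff ℝ 2 fun α : E d => α i := fun i =>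
    (EuclideanSpace.proj i : E d →L[ℝ] ℝ).contDiff
  refine ContDiff.smul (contDiff_const.mul (ContDiff.sum fun i _ => h.contDiff_self.comp (hp i)))
    ?_
  rw [contDiff_euclidean]
  exact fun i => h.contDiff.comp (hp i)

theorem differentiable (h : IsProfile u u' u'') : Differentiable ℝ (sqSum d u) := fun α =>
  (h.hasGradientAt_sqSum α).differentiableAt

theorem gradient_differentiable (h : IsProfile u u' u'') : Differentiable ℝ (gradient (sqSum d u)) :=
  h.contDiff_gradient.differentiable (by norm_num)

theorem gradient_zero (h : IsProfile u u' u'') : gradient (sqSum d u) 0 = 0 := by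
  rw [h.gradient_sqSum]
  ext i
  simp [h.zero]

/-- Obtained by differentiating `s ↦ ⟨∇ψ(α + s v), v⟩`. Both terms are nonnegative; the second alone
is definite. -/
theorem inner_hessian (h : IsProfile u u' u'') (α v : E d) : inner ℝ (hessian (sqSum d u) α v) v =
    2 * (∑ i, u' (α i) * v i) ^ 2 + 2 * (∑ i, u (α i)) * ∑ i, u'' (α i) * v i ^ 2 := by
  have h1 := hasDerivAt_inner_gradient_line h.gradient_differentiable α v 0
  simp only [zero_smul, add_zero] at h1
  refine h1.unique ?_
  have e : (fun s : ℝ => inner ℝ (gradient (sqSum d u) (α + s • v)) v) =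
      fun s => 2 * (∑ i, u (α i + s * v i)) * ∑ i, u' (α i + s * v i) * v i := by
    funext s
    rw [h.gradient_sqSum]
    simp [PiLp.inner_apply, inner_smul_left, mul_comm]
  rw [e]
  have hl : ∀ i, HasDerivAt (fun s : ℝ => α i + s * v i) (v i) 0 := fun i => by
    simpa using ((hasDerivAt_id (0 : ℝ)).mul_const (v i)).const_add (α i)
  have h2 : HasDerivAt (fun s : ℝ => ∑ i, u (α i + s * v i)) (∑ i, u' (α i) * v i) 0 := by
    refine HasDerivAt.fun_sum fun i _ => ?_
    exact (by simpa using h.hasDerivAt (α i) : HasDerivAt u (u' (α i)) (α i + 0 * v i)).comp 0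
      (hl i)
  have h3 : HasDerivAt (fun s : ℝ => ∑ i, u' (α i + s * v i) * v i)
      (∑ i, u'' (α i) * v i * v i) 0 := by
    refine HasDerivAt.fun_sum fun i _ => ?_
    exact ((by simpa using h.hasDerivAt' (α i) :
      HasDerivAt u' (u'' (α i)) (α i + 0 * v i)).comp 0 (hl i)).mul_const (v i)
  have h4 := (h2.const_mul 2).mul h3
  convert! h4 using 1
  simp only [zero_mul, add_zero]
  have : ∀ i, u'' (α i) * v i * v i = u'' (α i) * v i ^ 2 := fun i => by ring
  simp only [this]
  ring

theorem isContinuousMirrorMap (h : IsProfile u u' u'') : IsContinuousMirrorMap (sqSum d u) where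
  differentiable := h.differentiable
  gradient_differentiable := h.gradient_differentiable
  hessian_pos α v hv := by
    rw [h.inner_hessian]
    obtain ⟨i, hi⟩ : ∃ i, v i ≠ 0 := by
      by_contra! hno
      exact hv (by ext i; simpa using hno i)
    have h1 : 0 < ∑ i, u (α i) := Finset.sum_pos (fun i _ => h.pos _) ⟨i, Finset.mem_univ i⟩
    have h2 : 0 < ∑ i, u'' (α i) * v i ^ 2 := by
      refine Finset.sum_pos' (fun j _ => mul_nonneg (h.second_pos _).le (sq_nonneg _))
        ⟨i, Finset.mem_univ i, ?_⟩
      have := h.second_pos (α i)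
      positivity
    positivity

/-- Each `u (α i)` is at most the full sum, as all summands are positive, so a bound on `2 u u''` in
one variable suffices. -/
theorem stronglyConvexWrt (h : IsProfile u u' u'') {ρ : ℝ} (hρ : ∀ x, ρ ≤ 2 * u x * u'' x) :
    StronglyConvexWrt (sqSum d u) ρ fun α => ‖α‖ := by
  refine stronglyConvexWrt_norm_of_hessian h.differentiable h.gradient_differentiable
    fun α v => ?_
  rw [h.inner_hessian, EuclideanSpace.real_norm_sq_eq, Finset.mul_sum]
  have : ∑ i, ρ * v i ^ 2 ≤ 2 * (∑ i, u (α i)) * ∑ i, u'' (α i) * v i ^ 2 := by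
    rw [Finset.mul_sum]
    refine Finset.sum_le_sum fun i _ => ?_
    have h1 : u (α i) ≤ ∑ i, u (α i) :=
      Finset.single_le_sum (f := fun i => u (α i)) (fun j _ => (h.pos _).le) (Finset.mem_univ i)
    have h2 := h.second_pos (α i)
    calc ρ * v i ^ 2 ≤ 2 * u (α i) * u'' (α i) * v i ^ 2 :=
          mul_le_mul_of_nonneg_right (hρ _) (sq_nonneg _)
      _ ≤ 2 * (∑ i, u (α i)) * u'' (α i) * v i ^ 2 := by gcongr
      _ = _ := by ring
  nlinarith [sq_nonneg (∑ i, u' (α i) * v i)]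

theorem commonAssumption (h : IsProfile u u' u'') {τ cu : ℝ} (hτ : 0 < τ) (hcu : 0 < cu) (hlow : ∀ x, |x| ≤ u x)
    (hup : ∀ α : E d, ∑ i, |α i| ≤ τ → ∑ i, u (α i) ≤ cu * τ) :
    CommonAssumption (l1Ball d) τ (sqSum d u) 1 cu where
  nonneg α := sq_nonneg _
  differentiable := h.differentiable
  gradient_zero := h.gradient_zero
  sqrt_convex := h.sqrt_convex
  cl_pos := one_pos
  cu_pos := hcu
  lower α := by
    rw [gauge_l1Ball, h.sqrt_sqSum, one_mul]
    exact Finset.sum_le_sum fun i _ => hlow _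
  upper α hα := by
    rw [h.sqrt_sqSum]
    exact hup α ((mem_smul_l1Ball hτ α).1 hα)

end IsProfile

theorem DiscreteAssumption.isDiscreteMirrorMap {d : ℕ} {τ : ℝ} {ψ N : E d → ℝ} {ρ cl cu : ℝ}
    (h : DiscreteAssumption (l1Ball d) τ ψ N ρ cl cu) : IsDiscreteMirrorMap ψ where
  differentiable := h.differentiable
  strictConvex := h.stronglyConvex.strictConvexOn h.isNorm h.rho_pos
  gradient_surjective := gradient_surjective_of_coercive h.differentiable h.nonneg h.cl_pos
    fun α => by rw [← gauge_l1Ball]; exact h.lower α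

/-! ### The hypentropy potential -/

theorem sqrt_sq_add_sq_pos {γ : ℝ} (hγ : 0 < γ) (x : ℝ) : 0 < √(x ^ 2 + γ ^ 2) :=
  Real.sqrt_pos.2 (by positivity)

theorem hasDerivAt_arsinh_div {γ : ℝ} (hγ : 0 < γ) (x : ℝ) :
    HasDerivAt (fun x => Real.arsinh (x / γ)) (√(x ^ 2 + γ ^ 2))⁻¹ x := by
  have h := (Real.hasDerivAt_arsinh (x / γ)).comp x ((hasDerivAt_id x).div_const γ)
  convert! h using 1
  have e : x ^ 2 + γ ^ 2 = (1 + (x / γ) ^ 2) * γ ^ 2 := by field_simp; ring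
  rw [e, Real.sqrt_mul (by positivity), Real.sqrt_sq hγ.le, mul_inv, one_div]

theorem hasDerivAt_sqrt_sq_add_sq {γ : ℝ} (hγ : 0 < γ) (x : ℝ) :
    HasDerivAt (fun x => √(x ^ 2 + γ ^ 2)) (x / √(x ^ 2 + γ ^ 2)) x := by
  have h := (((hasDerivAt_id x).pow 2).add_const (γ ^ 2)).sqrt (by simp; positivity)
  convert! h using 1
  simp
  field_simp

/-- The unnormalized hypentropy function `x arsinh(x / γ) - √(x² + γ²)`. -/
def hypent (γ x : ℝ) : ℝ := x * Real.arsinh (x / γ) - √(x ^ 2 + γ ^ 2)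

theorem hasDerivAt_hypent {γ : ℝ} (hγ : 0 < γ) (x : ℝ) :
    HasDerivAt (hypent γ) (Real.arsinh (x / γ)) x := by
  have h := ((hasDerivAt_id x).mul (hasDerivAt_arsinh_div hγ x)).sub
    (hasDerivAt_sqrt_sq_add_sq hγ x)
  convert! h using 1
  simp only [id]
  ring

theorem mul_arsinh_div_nonneg {γ : ℝ} (hγ : 0 < γ) (x : ℝ) : 0 ≤ x * Real.arsinh (x / γ) := by
  rcases le_total 0 x with hx | hx
  · exact mul_nonneg hx (Real.arsinh_nonneg_iff.2 (by positivity))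
  · exact mul_nonneg_of_nonpos_of_nonpos hx
      (Real.arsinh_nonpos_iff.2 (div_nonpos_of_nonpos_of_nonneg hx hγ.le))

theorem neg_le_hypent {γ : ℝ} (hγ : 0 < γ) (x : ℝ) : -γ ≤ hypent γ x := by
  have h := le_of_deriv_sign (hasDerivAt_hypent hγ) (x₀ := 0)
    (fun x => by simpa using mul_arsinh_div_nonneg hγ x) x
  simpa [hypent, Real.sqrt_sq hγ.le] using h

theorem hypent_neg (γ x : ℝ) : hypent γ (-x) = hypent γ x := by
  simp [hypent, neg_div, Real.arsinh_neg]

/-- The difference of `hypent γ x` and the linear term is minimal at `x = 1`, with value `-√(1 + γ²)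
≥ -(1 + γ)`. This accounts for the additive `γ + 1` in the potential. -/
theorem mul_arsinh_inv_le {γ : ℝ} (hγ : 0 < γ) (x : ℝ) :
    x * Real.arsinh γ⁻¹ ≤ hypent γ x + γ + 1 := by
  have h := le_of_deriv_sign (f := fun x => hypent γ x - x * Real.arsinh γ⁻¹)
    (fun x => (hasDerivAt_hypent hγ x).sub ((hasDerivAt_id x).mul_const _)) (x₀ := 1) (by
      intro x
      rw [one_mul]
      rcases le_total 1 x with hx | hx
      · refine mul_nonneg (sub_nonneg.2 hx) (sub_nonneg.2 (Real.arsinh_le_arsinh.2 ?_))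
        rw [inv_eq_one_div]
        gcongr
      · refine mul_nonneg_of_nonpos_of_nonpos (sub_nonpos.2 hx)
          (sub_nonpos.2 (Real.arsinh_le_arsinh.2 ?_))
        rw [inv_eq_one_div]
        gcongr) x
  have h1 : √(1 ^ 2 + γ ^ 2) ≤ 1 + γ := by
    rw [Real.sqrt_le_left (by positivity)]
    nlinarith
  simp only [hypent, one_mul, one_div] at h ⊢
  generalize √(x ^ 2 + γ ^ 2) = R at *
  generalize √(1 ^ 2 + γ ^ 2) = R' at *
  generalize x * Real.arsinh (x / γ) = S at *
  generalize x * Real.arsinh γ⁻¹ = S' at *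
  linarith

theorem abs_mul_arsinh_inv_le {γ : ℝ} (hγ : 0 < γ) (x : ℝ) :
    |x| * Real.arsinh γ⁻¹ ≤ hypent γ x + γ + 1 := by
  rcases abs_choice x with h | h
  · rw [h]; exact mul_arsinh_inv_le hγ x
  · rw [h, ← hypent_neg]; exact mul_arsinh_inv_le hγ (-x)

/-- Needed for `1 ≤ 2 u u''` up to normalization, where `u''` decays like `1/√(x² + γ²)`. With `R`
that root, the derivative sign reduces to `x²/R ≤ 2(R - γ)`, and `neg_le_hypent` supplies `R - γ ≤ x
arsinh(x/γ)`. -/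
theorem three_mul_sqrt_le {γ : ℝ} (hγ : 0 < γ) (x : ℝ) :
    3 * √(x ^ 2 + γ ^ 2) ≤ 2 * (x * Real.arsinh (x / γ)) + 3 * γ := by
  have h := le_of_deriv_sign
    (f := fun x => 2 * hypent γ x - √(x ^ 2 + γ ^ 2))
    (fun x => ((hasDerivAt_hypent hγ x).const_mul 2).sub (hasDerivAt_sqrt_sq_add_sq hγ x))
    (x₀ := 0) (by
      intro x
      have h1 := neg_le_hypent hγ x
      have hR := sqrt_sq_add_sq_pos hγ x
      have hR2 : √(x ^ 2 + γ ^ 2) ^ 2 = x ^ 2 + γ ^ 2 := Real.sq_sqrt (by positivity)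
      have hRγ : γ ≤ √(x ^ 2 + γ ^ 2) := Real.le_sqrt_of_sq_le (by nlinarith [sq_nonneg x])
      unfold hypent at h1
      set R := √(x ^ 2 + γ ^ 2)
      have h2 : x * (x / R) ≤ 2 * (R - γ) := by
        rw [← mul_div_assoc, div_le_iff₀ hR]
        nlinarith
      have : (x - 0) * (2 * Real.arsinh (x / γ) - x / R) =
        2 * (x * Real.arsinh (x / γ)) - x * (x / R) := by ring
      rw [this]
      linarith) x
  simp only [hypent] at h
  simp [Real.sqrt_sq hγ.le] at h
  linarith

theorem arsinh_inv_pos {γ : ℝ} (hγ : 0 < γ) : 0 < Real.arsinh γ⁻¹ :=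
  Real.arsinh_pos_iff.2 (inv_pos.2 hγ)

theorem isProfile_hypentropy {γ : ℝ} (hγ : 0 < γ) :
    IsProfile (fun x => (hypent γ x + γ + 1) / Real.arsinh γ⁻¹)
      (fun x => Real.arsinh (x / γ) / Real.arsinh γ⁻¹)
      (fun x => (√(x ^ 2 + γ ^ 2))⁻¹ / Real.arsinh γ⁻¹) where
  hasDerivAt x := (((hasDerivAt_hypent hγ x).add_const γ).add_const 1).div_const _
  hasDerivAt' x := (hasDerivAt_arsinh_div hγ x).div_const _
  contDiff := (Real.contDiff_arsinh.comp (contDiff_id.div_const γ)).div_const _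
  pos x := div_pos (by linarith [neg_le_hypent hγ x]) (arsinh_inv_pos hγ)
  second_pos x := div_pos (inv_pos.2 (sqrt_sq_add_sq_pos hγ x)) (arsinh_inv_pos hγ)
  zero := by simp

theorem HypentropyParam.div_le_arsinh {d : ℕ} {τ γ : ℝ} (hd : 0 < d) (hτ : 0 < τ)
    (h : HypentropyParam d τ γ) : d / τ ≤ Real.arsinh γ⁻¹ := by
  have hd' : (0 : ℝ) < d := by exact_mod_cast hd
  have h1 : 0 < Real.sinh (d / τ) := Real.sinh_pos_iff.2 (by positivity)
  have h2 := (le_inv_comm₀ h.pos h1).1 h.le_sinh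
  have h3 := Real.arsinh_le_arsinh.2 h2
  rwa [Real.arsinh_sinh] at h3

/-- After applying `sinh`, the right side is at least `2γ⁻²`, which exceeds `τ/γ` because `γ ≤
1/(4τ)`. -/
theorem HypentropyParam.arsinh_le {d : ℕ} {τ γ : ℝ} (hτ : 0 < τ) (h : HypentropyParam d τ γ) :
    Real.arsinh (τ / γ) ≤ 2 * Real.arsinh γ⁻¹ := by
  have hγ := h.pos
  rw [← Real.arsinh_sinh (2 * Real.arsinh γ⁻¹), Real.arsinh_le_arsinh, Real.sinh_two_mul,
    Real.sinh_arsinh, Real.cosh_arsinh]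
  have h1 : 4 * τ ≤ γ⁻¹ := (le_inv_comm₀ hγ (by positivity)).1 h.le_tau
  have h2 : γ⁻¹ ≤ √(1 + γ⁻¹ ^ 2) := Real.le_sqrt_of_sq_le (by linarith)
  have h3 : 0 < γ⁻¹ := inv_pos.2 hγ
  rw [div_eq_mul_inv]
  nlinarith

theorem HypentropyParam.commonAssumption {d : ℕ} {τ γ : ℝ} (hd : 0 < d) (hτ : 0 < τ)
    (h : HypentropyParam d τ γ) :
    CommonAssumption (l1Ball d) τ (hypentropyPotential d γ) 1 3 := by
  have hγ := h.pos
  have hA := arsinh_inv_pos hγ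
  refine (isProfile_hypentropy hγ).commonAssumption hτ (by norm_num)
    (fun x => (le_div_iff₀ hA).2 (abs_mul_arsinh_inv_le hγ x)) fun α hα => ?_
  -- Summation gives `2τ` from the slopes and `d / arsinh(1/γ) ≤ τ` from the constants, hence `c_u =
  -- 3`.
  have h1 : ∀ i, (hypent γ (α i) + γ + 1) / Real.arsinh γ⁻¹ ≤
      2 * |α i| + 1 / Real.arsinh γ⁻¹ := by
    intro i
    have hi : |α i| ≤ τ := le_trans
      (Finset.single_le_sum (f := fun i => |α i|) (fun j _ => abs_nonneg _) (Finset.mem_univ i)) hα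
    have h2 : |Real.arsinh (α i / γ)| ≤ 2 * Real.arsinh γ⁻¹ := by
      obtain ⟨h3, h4⟩ := abs_le.1 hi
      refine abs_le.2 ⟨?_, ?_⟩
      · rw [neg_le, ← Real.arsinh_neg, ← neg_div]
        refine le_trans (Real.arsinh_le_arsinh.2 ?_) (h.arsinh_le hτ)
        gcongr
        linarith
      · refine le_trans (Real.arsinh_le_arsinh.2 ?_) (h.arsinh_le hτ)
        gcongr
    have hR : γ ≤ √(α i ^ 2 + γ ^ 2) := Real.le_sqrt_of_sq_le (by nlinarith [sq_nonneg (α i)])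
    have h5 : α i * Real.arsinh (α i / γ) ≤ |α i| * (2 * Real.arsinh γ⁻¹) := by
      refine (le_abs_self _).trans ?_
      rw [abs_mul]
      exact mul_le_mul_of_nonneg_left h2 (abs_nonneg _)
    rw [div_le_iff₀ hA, add_mul, one_div, inv_mul_cancel₀ hA.ne']
    unfold hypent
    linarith
  refine (Finset.sum_le_sum fun i _ => h1 i).trans ?_
  rw [Finset.sum_add_distrib, ← Finset.mul_sum]
  have h6 : (d : ℝ) * (1 / Real.arsinh γ⁻¹) ≤ τ := by
    rw [mul_one_div, div_le_iff₀ hA, mul_comm, ← div_le_iff₀ hτ]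
    exact h.div_le_arsinh hd hτ
  simp only [Finset.sum_const, Finset.card_univ, Fintype.card_fin, nsmul_eq_mul]
  linarith

theorem HypentropyParam.discreteAssumption {d : ℕ} {τ γ : ℝ} (hd : 0 < d) (hτ : 0 < τ)
    (h : HypentropyParam d τ γ) :
    DiscreteAssumption (l1Ball d) τ (hypentropyPotential d γ) (fun α => ‖α‖)
      ((Real.arsinh γ⁻¹) ^ 2)⁻¹ 1 3 where
  toCommonAssumption := h.commonAssumption hd hτ
  isNorm := isNorm_norm d
  rho_pos := by have := arsinh_inv_pos h.pos; positivity
  stronglyConvex := by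
    have hγ := h.pos
    have hA := arsinh_inv_pos hγ
    refine (isProfile_hypentropy hγ).stronglyConvexWrt fun x => ?_
    have hR := sqrt_sq_add_sq_pos hγ x
    have h1 := three_mul_sqrt_le hγ x
    have h2 : γ ≤ 1 := h.le_sqrt.trans (inv_le_one_of_one_le₀ (Real.one_le_sqrt.2 (by norm_num)))
    have h3 : √(x ^ 2 + γ ^ 2) ≤ 2 * (hypent γ x + γ + 1) := by
      unfold hypent
      linarith
    have h4 : 1 ≤ 2 * (hypent γ x + γ + 1) * (√(x ^ 2 + γ ^ 2))⁻¹ := by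
      rw [← div_eq_mul_inv, one_le_div hR]; exact h3
    calc ((Real.arsinh γ⁻¹) ^ 2)⁻¹ = 1 / (Real.arsinh γ⁻¹) ^ 2 := by rw [one_div]
      _ ≤ 2 * (hypent γ x + γ + 1) * (√(x ^ 2 + γ ^ 2))⁻¹ / (Real.arsinh γ⁻¹) ^ 2 := by gcongr
      _ = _ := by field_simp

/-! ### The sigmoidal potential -/

theorem isProfile_sigmoidal {γ : ℝ} (hγ : 0 < γ) :
    IsProfile
      (fun x => (Real.log (1 + Real.exp (-(γ * x))) + Real.log (1 + Real.exp (γ * x))) / γ)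
      (fun x => 1 - 2 / (1 + Real.exp (γ * x)))
      (fun x => 2 * (γ * Real.exp (γ * x)) / (1 + Real.exp (γ * x)) ^ 2) where
  hasDerivAt x := by
    have h0 : HasDerivAt (fun x => γ * x) γ x := by simpa using (hasDerivAt_id x).const_mul γ
    have h1 := (h0.neg.exp.const_add 1).log (by positivity)
    have h2 := (h0.exp.const_add 1).log (by positivity)
    convert! (h1.add h2).div_const γ using 1
    simp only [Pi.neg_apply, Real.exp_neg]
    have := Real.exp_pos (γ * x)
    field_simp
    ring
  hasDerivAt' x := by
    have h0 : HasDerivAt (fun x => γ * x) γ x := by simpa using (hasDerivAt_id x).const_mul γ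
    have h1 := (((h0.exp.const_add 1).inv (by positivity)).const_mul 2).const_sub 1
    convert! h1 using 1
    ring
  contDiff := by
    refine contDiff_const.sub (contDiff_const.div ?_ fun x => by positivity)
    fun_prop
  pos x := by
    have h1 := Real.exp_pos (-(γ * x))
    have h2 := Real.exp_pos (γ * x)
    exact div_pos (add_pos (Real.log_pos (by linarith)) (Real.log_pos (by linarith))) hγ
  second_pos x := by positivity
  zero := by norm_num

/-- The profile thus lies between `|x|` and `|x| + log 4 / γ`; over `d` coordinates the error is at
most `τ` by the choice of `γ`. -/
theorem sigmoidal_log_eq (z : ℝ) :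
    Real.log (1 + Real.exp (-z)) + Real.log (1 + Real.exp z) =
      |z| + 2 * Real.log (1 + Real.exp (-|z|)) := by
  have h : ∀ w : ℝ, Real.log (1 + Real.exp (-w)) + Real.log (1 + Real.exp w) =
      w + 2 * Real.log (1 + Real.exp (-w)) := by
    intro w
    have : 1 + Real.exp w = Real.exp w * (1 + Real.exp (-w)) := by
      rw [mul_add, ← Real.exp_add]; simp [add_comm]
    rw [this, Real.log_mul (Real.exp_pos _).ne' (by positivity), Real.log_exp]
    ring
  rcases abs_choice z with hz | hz
  · rw [hz]; exact h z
  · rw [hz, ← h (-z), neg_neg, add_comm]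

theorem sigmoidal_commonAssumption {d : ℕ} {τ γ : ℝ} (hd : 0 < d) (hτ : 0 < τ)
    (hγ : d * Real.log 4 / τ ≤ γ) :
    0 < γ ∧ CommonAssumption (l1Ball d) τ (sigmoidalPotential d γ) 1 2 := by
  have hd' : (0 : ℝ) < d := by exact_mod_cast hd
  have hl4 : 0 < Real.log 4 := Real.log_pos (by norm_num)
  have hγ0 : 0 < γ := lt_of_lt_of_le (by positivity) hγ
  refine ⟨hγ0, (isProfile_sigmoidal hγ0).commonAssumption hτ (by norm_num) (fun x => ?_)
    fun α hα => ?_⟩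
  · rw [sigmoidal_log_eq, le_div_iff₀ hγ0, abs_mul, abs_of_pos hγ0]
    have : 0 ≤ Real.log (1 + Real.exp (-(γ * |x|))) :=
      Real.log_nonneg (by linarith [Real.exp_pos (-(γ * |x|))])
    linarith
  · have h1 : ∀ x : ℝ, (Real.log (1 + Real.exp (-(γ * x))) + Real.log (1 + Real.exp (γ * x))) / γ
        ≤ |x| + Real.log 4 / γ := by
      intro x
      rw [sigmoidal_log_eq, div_le_iff₀ hγ0, abs_mul, abs_of_pos hγ0, add_mul,
        div_mul_cancel₀ _ hγ0.ne']
      have h2 : Real.exp (-(γ * |x|)) ≤ 1 := Real.exp_le_one_iff.2 (by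
        have := abs_nonneg x
        have := mul_nonneg hγ0.le this
        linarith)
      have h3 : Real.log (1 + Real.exp (-(γ * |x|))) ≤ Real.log 2 :=
        Real.log_le_log (by positivity) (by linarith)
      have h4 : Real.log 4 = 2 * Real.log 2 := by
        rw [show (4 : ℝ) = 2 ^ 2 by norm_num, Real.log_pow]; norm_num
      linarith
    refine (Finset.sum_le_sum fun i _ => h1 (α i)).trans ?_
    rw [Finset.sum_add_distrib]
    simp only [Finset.sum_const, Finset.card_univ, Fintype.card_fin, nsmul_eq_mul]
    have h5 : (d : ℝ) * (Real.log 4 / γ) ≤ τ := by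
      rw [← mul_div_assoc, div_le_iff₀ hγ0]
      rw [div_le_iff₀ hτ] at hγ
      linarith
    linarith

/-! ### The Moreau potential -/

theorem hasDerivAt_sq_posPart (y : ℝ) : HasDerivAt (fun y : ℝ => (max y 0) ^ 2) (2 * max y 0) y := by
  rcases lt_trichotomy y 0 with hy | rfl | hy
  · have h : (fun y : ℝ => (max y 0) ^ 2) =ᶠ[nhds y] fun _ => 0 := by
      filter_upwards [gt_mem_nhds hy] with z hz
      rw [max_eq_right (le_of_lt hz)]
      norm_num
    rw [max_eq_right hy.le, mul_zero]
    exact (hasDerivAt_const y (0 : ℝ)).congr_of_eventuallyEq h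
  · rw [max_self, mul_zero, hasDerivAt_iff_hasFDerivAt]
    have h : (fun y : ℝ => (max y 0) ^ 2) =O[nhds 0] fun y : ℝ => ‖y - 0‖ ^ 2 := by
      refine Asymptotics.IsBigO.of_bound 1 (Filter.Eventually.of_forall fun y => ?_)
      rw [sub_zero, one_mul, norm_pow, norm_pow, norm_norm]
      refine pow_le_pow_left₀ (norm_nonneg _) ?_ 2
      rw [Real.norm_eq_abs, Real.norm_eq_abs, abs_of_nonneg (le_max_right _ _)]
      exact max_le (le_abs_self y) (abs_nonneg y)
    have h2 : HasFDerivAt (fun y : ℝ => (max y 0) ^ 2) (0 : ℝ →L[ℝ] ℝ) 0 :=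
      h.hasFDerivAt (by norm_num)
    convert! h2 using 1
    ext
    simp
  · have h : (fun y : ℝ => (max y 0) ^ 2) =ᶠ[nhds y] fun y => y ^ 2 := by
      filter_upwards [lt_mem_nhds hy] with z hz
      rw [max_eq_left (le_of_lt hz)]
    rw [max_eq_left hy.le]
    simpa using (hasDerivAt_pow 2 y).congr_of_eventuallyEq h

/-- Squares of positive parts are differentiable everywhere, so this form gives the derivative at
`±lam` without gluing. -/
theorem huber_eq {lam : ℝ} (hl : 0 < lam) (x : ℝ) :
    huber lam x = (x ^ 2 - (max (x - lam) 0) ^ 2 - (max (-x - lam) 0) ^ 2) / (2 * lam) := by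
  unfold huber
  split_ifs with h
  · obtain ⟨h1, h2⟩ := abs_le.1 h
    rw [max_eq_right (by linarith), max_eq_right (by linarith)]
    ring
  · rcases lt_abs.1 (not_le.1 h) with h1 | h1
    · rw [max_eq_left (by linarith), max_eq_right (by linarith), abs_of_pos (by linarith)]
      field_simp
      ring
    · rw [max_eq_right (by linarith), max_eq_left (by linarith), abs_of_neg (by linarith)]
      field_simp
      ring

theorem hasDerivAt_huber {lam : ℝ} (hl : 0 < lam) (x : ℝ) :
    HasDerivAt (huber lam) (max (-lam) (min x lam) / lam) x := by
  have h1 := (hasDerivAt_sq_posPart (x - lam)).comp x ((hasDerivAt_id x).sub_const lam)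
  have h2 := (hasDerivAt_sq_posPart (-x - lam)).comp x ((hasDerivAt_id x).neg.sub_const lam)
  have h3 := ((((hasDerivAt_id x).pow 2).sub h1).sub h2).div_const (2 * lam)
  convert! h3 using 1
  · funext y; simpa using huber_eq hl y
  · simp only [id, Nat.cast_ofNat, Nat.add_one_sub_one, pow_one, mul_one]
    rcases le_total x lam with h | h
    · rw [min_eq_left h, max_eq_right (show x - lam ≤ 0 by linarith)]
      rcases le_total (-lam) x with h' | h'
      · rw [max_eq_right h', max_eq_right (show -x - lam ≤ 0 by linarith)]
        field_simp
        ring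
      · rw [max_eq_left h', max_eq_left (show 0 ≤ -x - lam by linarith)]
        field_simp
        ring
    · rw [min_eq_right h, max_eq_left (show 0 ≤ x - lam by linarith),
        max_eq_right (show -lam ≤ lam by linarith), max_eq_right (show -x - lam ≤ 0 by linarith)]
      field_simp
      ring

theorem huber_convexOn {lam : ℝ} (hl : 0 < lam) : ConvexOn ℝ Set.univ (huber lam) := by
  refine Monotone.convexOn_univ_of_deriv (fun x => (hasDerivAt_huber hl x).differentiableAt) ?_
  have : deriv (huber lam) = fun x => max (-lam) (min x lam) / lam :=
    funext fun x => (hasDerivAt_huber hl x).deriv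
  rw [this]
  intro x y hxy
  simp only
  gcongr

theorem huber_bounds {lam : ℝ} (hl : 0 < lam) (x : ℝ) :
    0 ≤ huber lam x ∧ huber lam x ≤ |x| ∧ |x| ≤ huber lam x + lam / 2 := by
  unfold huber
  split_ifs with h
  · refine ⟨by positivity, ?_, ?_⟩
    · rw [div_le_iff₀ (by positivity), ← sq_abs]
      nlinarith [abs_nonneg x]
    · have : x ^ 2 / (2 * lam) + lam / 2 - |x| = (|x| - lam) ^ 2 / (2 * lam) := by
        rw [← sq_abs x]; field_simp; ring
      have h2 : 0 ≤ (|x| - lam) ^ 2 / (2 * lam) := by positivity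
      linarith
  · have := not_le.1 h
    refine ⟨by linarith, by linarith, by linarith⟩

theorem huber_zero (lam : ℝ) (hl : 0 < lam) : huber lam 0 = 0 := by
  simp [huber, hl.le]

theorem gradient_eq_zero_of_forall_le {d : ℕ} {ψ : E d → ℝ} {a : E d} (h : ∀ α, ψ a ≤ ψ α) :
    gradient ψ a = 0 := by
  have : IsLocalMin ψ a := Filter.Eventually.of_forall h
  rw [gradient, this.fderiv_eq_zero, map_zero]

theorem sqrt_add_sq_add_le (p q r w : ℝ) :
    √((p + q) ^ 2 + (r + w) ^ 2) ≤ √(p ^ 2 + r ^ 2) + √(q ^ 2 + w ^ 2) := by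
  rw [← Complex.norm_add_mul_I, ← Complex.norm_add_mul_I, ← Complex.norm_add_mul_I]
  refine le_trans (le_of_eq ?_) (norm_add_le _ _)
  congr 1
  push_cast
  ring

/-- The Euclidean norm on the plane is monotone on the positive quadrant, so it preserves convexity
of a pair of nonnegative convex functions. -/
theorem convexOn_sqrt_sq_add_norm_sq {d : ℕ} {g : E d → ℝ} (hg : ConvexOn ℝ Set.univ g)
    (h0 : ∀ α, 0 ≤ g α) : ConvexOn ℝ Set.univ fun α => √(g α ^ 2 + ‖α‖ ^ 2) := by
  refine ⟨convex_univ, fun a _ b _ s t hs ht hst => ?_⟩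
  have h1 := hg.2 (Set.mem_univ a) (Set.mem_univ b) hs ht hst
  have h2 : ‖s • a + t • b‖ ≤ s * ‖a‖ + t * ‖b‖ := by
    refine (norm_add_le _ _).trans (le_of_eq ?_)
    rw [norm_smul, norm_smul, Real.norm_of_nonneg hs, Real.norm_of_nonneg ht]
  simp only [smul_eq_mul] at h1 ⊢
  calc √(g (s • a + t • b) ^ 2 + ‖s • a + t • b‖ ^ 2)
      ≤ √((s * g a + t * g b) ^ 2 + (s * ‖a‖ + t * ‖b‖) ^ 2) := by
        apply Real.sqrt_le_sqrt
        exact add_le_add (pow_le_pow_left₀ (h0 _) h1 2) (pow_le_pow_left₀ (norm_nonneg _) h2 2)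
    _ ≤ √((s * g a) ^ 2 + (s * ‖a‖) ^ 2) + √((t * g b) ^ 2 + (t * ‖b‖) ^ 2) :=
        sqrt_add_sq_add_le _ _ _ _
    _ = s * √(g a ^ 2 + ‖a‖ ^ 2) + t * √(g b ^ 2 + ‖b‖ ^ 2) := by
        rw [mul_pow, mul_pow, mul_pow, mul_pow, ← mul_add, ← mul_add,
          Real.sqrt_mul (sq_nonneg s), Real.sqrt_mul (sq_nonneg t), Real.sqrt_sq hs,
          Real.sqrt_sq ht]

theorem moreau_discreteAssumption {d : ℕ} {τ lam : ℝ} (hd : 0 < d) (hτ : 0 < τ) (h0 : 0 < lam)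
    (hl : lam ≤ 2 * τ / d) :
    DiscreteAssumption (l1Ball d) τ (moreauPotential d lam) (fun α => ‖α‖) 2 1 (√5) := by
  have hd' : (0 : ℝ) < d := by exact_mod_cast hd
  set g : E d → ℝ := fun α => ∑ i, huber lam (α i) + d * lam / 2 with hg
  have hψ : moreauPotential d lam = fun α => g α ^ 2 + ‖α‖ ^ 2 := by
    funext α; simp [moreauPotential, hg]
  have hg0 : ∀ α, 0 ≤ g α := fun α =>
    add_nonneg (Finset.sum_nonneg fun i _ => (huber_bounds h0 _).1) (by positivity)
  have hgc : ConvexOn ℝ Set.univ g := by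
    refine ⟨convex_univ, fun a _ b _ s t hs ht hst => ?_⟩
    have h1 : ∑ i, huber lam ((s • a + t • b) i) ≤
        ∑ i, (s * huber lam (a i) + t * huber lam (b i)) :=
      Finset.sum_le_sum fun i _ =>
        (huber_convexOn h0).2 (Set.mem_univ _) (Set.mem_univ _) hs ht hst
    rw [Finset.sum_add_distrib, ← Finset.mul_sum, ← Finset.mul_sum] at h1
    simp only [hg, smul_eq_mul]
    have h2 : d * lam / 2 = s * (d * lam / 2) + t * (d * lam / 2) := by
      rw [← add_mul, hst, one_mul]
    linarith
  have hgd : Differentiable ℝ g := by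
    refine Differentiable.add_const _ (Differentiable.fun_sum fun i _ => ?_)
    exact Differentiable.comp (g := huber lam)
      (fun x => (hasDerivAt_huber h0 x).differentiableAt)
      (EuclideanSpace.proj i : E d →L[ℝ] ℝ).differentiable
  have hdiff : Differentiable ℝ (moreauPotential d lam) := by
    rw [hψ]
    exact (hgd.pow 2).add (differentiable_id.norm_sq ℝ)
  have hl1 : ∀ α, ∑ i, |α i| ≤ g α := by
    intro α
    have h1 : ∑ i, |α i| ≤ ∑ i, (huber lam (α i) + lam / 2) :=
      Finset.sum_le_sum fun i _ => (huber_bounds h0 _).2.2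
    rw [Finset.sum_add_distrib] at h1
    simp only [Finset.sum_const, Finset.card_univ, Fintype.card_fin, nsmul_eq_mul] at h1
    simp only [hg]
    linarith
  refine
    { nonneg := fun α => by rw [hψ]; positivity
      differentiable := hdiff
      gradient_zero := gradient_eq_zero_of_forall_le fun α => ?_
      sqrt_convex := by rw [hψ]; exact convexOn_sqrt_sq_add_norm_sq hgc hg0
      cl_pos := one_pos
      cu_pos := by positivity
      lower := fun α => ?_
      upper := fun α hα => ?_
      isNorm := isNorm_norm d
      rho_pos := two_pos
      stronglyConvex := fun a b => ?_ }
  · rw [hψ]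
    have h1 : g 0 ≤ g α := by
      simp only [hg]
      have : 0 ≤ ∑ i, huber lam (α i) := Finset.sum_nonneg fun i _ => (huber_bounds h0 _).1
      simpa [huber_zero lam h0] using this
    have h2 := pow_le_pow_left₀ (hg0 0) h1 2
    simp only [norm_zero]
    nlinarith [sq_nonneg ‖α‖]
  · rw [gauge_l1Ball, one_mul, hψ]
    exact (hl1 α).trans (Real.le_sqrt_of_sq_le (by nlinarith [sq_nonneg ‖α‖]))
  · have h1 := (mem_smul_l1Ball hτ α).1 hα
    -- The Huber sum and the additive constant contribute `τ` each; with `‖α‖ ≤ τ` this makes `√(4 +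
    -- 1) τ`.
    have h2 : g α ≤ 2 * τ := by
      have h3 : ∑ i, huber lam (α i) ≤ ∑ i, |α i| :=
        Finset.sum_le_sum fun i _ => (huber_bounds h0 _).2.1
      rw [le_div_iff₀ hd'] at hl
      simp only [hg]
      linarith
    have h4 := pow_le_pow_left₀ (hg0 α) h2 2
    have h5 := pow_le_pow_left₀ (norm_nonneg α) ((norm_le_sum_abs α).trans h1) 2
    rw [hψ, ← Real.sqrt_sq hτ.le, ← Real.sqrt_mul (by norm_num)]
    apply Real.sqrt_le_sqrt
    show g α ^ 2 + ‖α‖ ^ 2 ≤ 5 * τ ^ 2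
    linarith
  -- `g²` is convex as the square of a nonnegative convex function; all the strong convexity comes
  -- from `‖α‖²`, which leaves an affine function of `t`.
  · refine le_bregman_of_convexOn_line hdiff ?_
    have hgs : ConvexOn ℝ Set.univ fun α => g α ^ 2 := hgc.pow (fun α _ => hg0 α) 2
    have e : (fun t : ℝ => moreauPotential d lam (b + t • (a - b)) - 2 / 2 * ‖a - b‖ ^ 2 * t ^ 2) =
        fun t => g (b + t • (a - b)) ^ 2 + (‖b‖ ^ 2 + 2 * t * inner ℝ b (a - b)) := by
      funext t
      rw [hψ]
      simp only
      rw [norm_add_sq_real, inner_smul_right, norm_smul, mul_pow, Real.norm_eq_abs, sq_abs]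
      ring
    rw [e]
    refine ⟨convex_univ, fun x _ y _ s t hs ht hst => ?_⟩
    have h1 := hgs.2 (Set.mem_univ (b + x • (a - b))) (Set.mem_univ (b + y • (a - b))) hs ht hst
    have h2 : s • (b + x • (a - b)) + t • (b + y • (a - b)) =
        b + (s * x + t * y) • (a - b) := by
      have : s = 1 - t := by linarith
      rw [this]; module
    rw [h2] at h1
    simp only [smul_eq_mul] at h1 ⊢
    have h3 : ‖b‖ ^ 2 = s * ‖b‖ ^ 2 + t * ‖b‖ ^ 2 := by rw [← add_mul, hst, one_mul]
    nlinarith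

/-! ### The `ℓ_p` potential -/

theorem lpNorm_nonneg {d : ℕ} (p : ℝ) (α : E d) : 0 ≤ lpNorm p α :=
  Real.rpow_nonneg (Finset.sum_nonneg fun _ _ => Real.rpow_nonneg (abs_nonneg _) _) _

theorem lpNorm_smul {d : ℕ} {p : ℝ} (hp : 1 < p) (c : ℝ) (α : E d) :
    lpNorm p (c • α) = |c| * lpNorm p α := by
  have hs : 0 ≤ ∑ i, |α i| ^ p :=
    Finset.sum_nonneg fun _ _ => Real.rpow_nonneg (abs_nonneg _) _
  simp only [lpNorm, PiLp.smul_apply, smul_eq_mul, abs_mul,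
    Real.mul_rpow (abs_nonneg _) (abs_nonneg _)]
  rw [← Finset.mul_sum, Real.mul_rpow (Real.rpow_nonneg (abs_nonneg _) _) hs,
    ← Real.rpow_mul (abs_nonneg _), mul_one_div_cancel (by linarith), Real.rpow_one]

theorem isNorm_lpNorm (d : ℕ) {p : ℝ} (hp : 1 < p) : IsNorm (lpNorm (d := d) p) where
  triangle x y := Real.Lp_add_le Finset.univ (fun i => x i) (fun i => y i) hp.le
  homogeneous := lpNorm_smul hp
  nonneg := lpNorm_nonneg p
  definite x hx := by
    have hs : 0 ≤ ∑ i, |x i| ^ p :=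
      Finset.sum_nonneg fun _ _ => Real.rpow_nonneg (abs_nonneg _) _
    rw [lpNorm, Real.rpow_eq_zero hs (by positivity),
      Finset.sum_eq_zero_iff_of_nonneg fun _ _ => Real.rpow_nonneg (abs_nonneg _) _] at hx
    ext i
    have := hx i (Finset.mem_univ i)
    rw [Real.rpow_eq_zero (abs_nonneg _) (by linarith), abs_eq_zero] at this
    simpa using this

theorem sqrt_lpPotential {d : ℕ} (p : ℝ) (α : E d) : √(lpPotential d p α) = lpNorm p α :=
  Real.sqrt_sq (lpNorm_nonneg p α)

theorem lpPotential_eq {d : ℕ} (p : ℝ) (α : E d) :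
    lpPotential d p α = (∑ i, |α i| ^ p) ^ (2 / p) := by
  rw [lpPotential, lpNorm, ← Real.rpow_natCast, ← Real.rpow_mul
    (Finset.sum_nonneg fun _ _ => Real.rpow_nonneg (abs_nonneg _) _)]
  congr 1
  push_cast
  ring

theorem differentiable_lpPotential (d : ℕ) {p : ℝ} (hp : 1 < p) (hp2 : p ≤ 2) :
    Differentiable ℝ (lpPotential d p) := by
  have : lpPotential d p = fun α : E d => (∑ i, |α i| ^ p) ^ (2 / p) :=
    funext fun α => lpPotential_eq p α
  rw [this]
  intro α
  refine DifferentiableAt.rpow_const ?_ (Or.inr ((one_le_div (by linarith)).2 hp2))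
  refine DifferentiableAt.fun_sum fun i _ => ?_
  exact DifferentiableAt.comp (g := fun x : ℝ => |x| ^ p) α
    (hasDerivAt_abs_rpow (α i) hp).differentiableAt
    (EuclideanSpace.proj i : E d →L[ℝ] ℝ).differentiableAt

/-- Hölder gives the factor `d^(1 - 1/p)`, and `1 - 1/p ≤ p - 1` makes its logarithm at most 1. -/
theorem sum_abs_le_lpNorm {d : ℕ} (hd : 0 < d) {p : ℝ} (hp : 1 < p)
    (hpd : (p - 1) * Real.log d ≤ 1) (α : E d) :
    ∑ i, |α i| ≤ Real.exp 1 * lpNorm p α := by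
  have hd' : (0 : ℝ) < d := by exact_mod_cast hd
  have hd1 : (1 : ℝ) ≤ d := by exact_mod_cast hd
  have h := Real.inner_le_weight_mul_Lp_of_nonneg Finset.univ hp.le (fun _ : Fin d => (1 : ℝ))
    (fun i => |α i|) (fun _ => zero_le_one) (fun _ => abs_nonneg _)
  simp only [one_mul, Finset.sum_const, Finset.card_univ, Fintype.card_fin, nsmul_eq_mul,
    mul_one] at h
  refine h.trans ?_
  rw [← one_div p, ← lpNorm]
  refine mul_le_mul_of_nonneg_right ?_ (lpNorm_nonneg p α)
  rw [Real.rpow_def_of_pos hd']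
  apply Real.exp_le_exp.2
  have h1 : 1 - 1 / p ≤ p - 1 := by
    rw [sub_le_iff_le_add, ← sub_le_iff_le_add', le_div_iff₀ (by linarith)]
    nlinarith [sq_nonneg (p - 1)]
  have h2 := mul_le_mul_of_nonneg_left h1 (Real.log_nonneg hd1)
  linarith

theorem lpNorm_le_sum_abs {d : ℕ} {p : ℝ} (hp : 1 < p) (α : E d) :
    lpNorm p α ≤ ∑ i, |α i| := by
  set A := ∑ i, |α i| with hA
  have hA0 : 0 ≤ A := Finset.sum_nonneg fun _ _ => abs_nonneg _
  have key : ∀ x : ℝ, 0 ≤ x → x ^ p = x * x ^ (p - 1) := fun x hx => by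
    rw [← Real.rpow_one_add' hx (by linarith)]
    congr 1
    ring
  have h : ∑ i, |α i| ^ p ≤ A ^ p := by
    rw [key A hA0]
    nth_rewrite 1 [hA]
    rw [Finset.sum_mul]
    refine Finset.sum_le_sum fun i _ => ?_
    rw [key _ (abs_nonneg _)]
    refine mul_le_mul_of_nonneg_left ?_ (abs_nonneg _)
    exact Real.rpow_le_rpow (abs_nonneg _)
      (Finset.single_le_sum (f := fun i => |α i|) (fun j _ => abs_nonneg _) (Finset.mem_univ i))
      (by linarith)
  have h2 := Real.rpow_le_rpow
    (Finset.sum_nonneg fun _ _ => Real.rpow_nonneg (abs_nonneg _) _) h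
    (show 0 ≤ 1 / p by positivity)
  rwa [← Real.rpow_mul hA0, mul_one_div_cancel (by linarith), Real.rpow_one] at h2

/-- Hölder's inequality, in the form of a lower bound for a weighted sum of squares. -/
theorem lpNorm_sq_le_weighted {d : ℕ} {p : ℝ} (hp : 1 < p) (hp2 : p ≤ 2) (v : E d)
    {r : Fin d → ℝ} (hr : ∀ i, 0 < r i) :
    lpPotential d p v ≤ (∑ i, r i ^ (p / 2)) ^ (2 / p - 1) * ∑ i, r i ^ (p / 2 - 1) * v i ^ 2 := by
  have hp0 : 0 < p := by linarith
  have hq : 1 ≤ 2 / p := (one_le_div hp0).2 hp2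
  have h := Real.inner_le_weight_mul_Lp_of_nonneg Finset.univ hq (fun i => r i ^ (p / 2))
    (fun i => |v i| ^ p * r i ^ (-(p / 2))) (fun i => (Real.rpow_pos_of_pos (hr i) _).le)
    (fun i => mul_nonneg (Real.rpow_nonneg (abs_nonneg _) _) (Real.rpow_pos_of_pos (hr i) _).le)
  have e1 : ∀ i, r i ^ (p / 2) * (|v i| ^ p * r i ^ (-(p / 2))) = |v i| ^ p := by
    intro i
    rw [mul_left_comm, ← Real.rpow_add (hr i), add_neg_cancel, Real.rpow_zero, mul_one]
  have e2 : ∀ i, r i ^ (p / 2) * (|v i| ^ p * r i ^ (-(p / 2))) ^ (2 / p) =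
      r i ^ (p / 2 - 1) * v i ^ 2 := by
    intro i
    rw [Real.mul_rpow (Real.rpow_nonneg (abs_nonneg _) _) (Real.rpow_pos_of_pos (hr i) _).le,
      ← Real.rpow_mul (abs_nonneg _), ← Real.rpow_mul (hr i).le, mul_div_cancel₀ _ hp0.ne',
      show -(p / 2) * (2 / p) = -1 by field_simp, Real.rpow_two, sq_abs, mul_left_comm,
      ← Real.rpow_add (hr i), mul_comm]
    rfl
  simp only [e1, e2] at h
  set S := ∑ i, r i ^ (p / 2)
  set W := ∑ i, r i ^ (p / 2 - 1) * v i ^ 2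
  have hS : 0 ≤ S := Finset.sum_nonneg fun i _ => (Real.rpow_pos_of_pos (hr i) _).le
  have hW : 0 ≤ W := Finset.sum_nonneg fun i _ =>
    mul_nonneg (Real.rpow_pos_of_pos (hr i) _).le (sq_nonneg _)
  rw [lpPotential_eq]
  have h2 := Real.rpow_le_rpow
    (Finset.sum_nonneg fun _ _ => Real.rpow_nonneg (abs_nonneg _) _) h
    (show 0 ≤ 2 / p by positivity)
  rw [Real.mul_rpow (Real.rpow_nonneg hS _) (Real.rpow_nonneg hW _), ← Real.rpow_mul hS,
    ← Real.rpow_mul hW, inv_mul_cancel₀ (by positivity), Real.rpow_one] at h2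
  convert! h2 using 3
  field_simp

/-- The smooth approximation `(x² + ε)^{p/2}` of `|x|^p` has the expected derivatives. -/
theorem hasDerivAt_smoothAbs {ε : ℝ} (hε : 0 < ε) (q x : ℝ) :
    HasDerivAt (fun x : ℝ => (x ^ 2 + ε) ^ q) (2 * q * x * (x ^ 2 + ε) ^ (q - 1)) x := by
  have h := (((hasDerivAt_id x).pow 2).add_const ε).rpow_const (p := q)
    (Or.inl (by simp; positivity))
  convert! h using 1
  change _ = ((2 : ℕ) : ℝ) * id x ^ (2 - 1) * 1 * q * (x ^ 2 + ε) ^ (q - 1)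
  simp only [id, Nat.cast_ofNat, Nat.add_one_sub_one, pow_one, mul_one]
  ring

theorem smoothAbs_second_ge {ε p : ℝ} (hε : 0 < ε) (hp2 : p ≤ 2) (hp : 1 < p) (x : ℝ) :
    p * (p - 1) * (x ^ 2 + ε) ^ (p / 2 - 1) ≤
      p * (x ^ 2 + ε) ^ (p / 2 - 1) +
        p * x * (2 * (p / 2 - 1) * x * (x ^ 2 + ε) ^ (p / 2 - 1 - 1)) := by
  have hr : 0 < x ^ 2 + ε := by positivity
  have h1 : (x ^ 2 + ε) ^ (p / 2 - 1) = (x ^ 2 + ε) * (x ^ 2 + ε) ^ (p / 2 - 1 - 1) := by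
    rw [Real.rpow_sub_one hr.ne' (p / 2 - 1)]; field_simp
  have h2 := Real.rpow_pos_of_pos hr (p / 2 - 1 - 1)
  rw [h1]
  set z := (x ^ 2 + ε) ^ (p / 2 - 1 - 1)
  have : p * ((x ^ 2 + ε) * z) + p * x * (2 * (p / 2 - 1) * x * z) -
      p * (p - 1) * ((x ^ 2 + ε) * z) = p * (2 - p) * ε * z := by ring
  have h3 : 0 ≤ p * (2 - p) * ε * z := by
    have : 0 ≤ 2 - p := by linarith
    positivity
  linarith

/-- For `p < 2`, `|x|^p` has no second derivative at `0`, hence the regularization. The second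
derivative of `S^(2/p)` is at least `(2/p) S^(2/p - 1) S₂`, and `S₂` dominates `p (p - 1)` times a
weighted sum of squares, which `lpNorm_sq_le_weighted` compares with `‖v‖_p²`. The resulting modulus
is free of `ε`. -/
theorem convexOn_smooth_lp_line {d : ℕ} (hd : 0 < d) {p ε : ℝ} (hp : 1 < p) (hp2 : p ≤ 2)
    (hε : 0 < ε) (b v : E d) :
    ConvexOn ℝ Set.univ fun t : ℝ =>
      (∑ i, ((b i + t * v i) ^ 2 + ε) ^ (p / 2)) ^ (2 / p) -
        (p - 1) * lpPotential d p v * t ^ 2 := by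
  have hp0 : 0 < p := by linarith
  have hq : 1 ≤ 2 / p := (one_le_div hp0).2 hp2
  have : Nonempty (Fin d) := ⟨⟨0, hd⟩⟩
  set x : ℝ → Fin d → ℝ := fun t i => b i + t * v i with hx
  have hr : ∀ t i, 0 < x t i ^ 2 + ε := fun t i => by positivity
  have hxd : ∀ t i, HasDerivAt (fun t => x t i) (v i) t := fun t i => by
    convert! ((hasDerivAt_id t).mul_const (v i)).const_add (b i) using 1
    simp
  set S : ℝ → ℝ := fun t => ∑ i, (x t i ^ 2 + ε) ^ (p / 2) with hS
  set S₁ : ℝ → ℝ := fun t => ∑ i, p * x t i * (x t i ^ 2 + ε) ^ (p / 2 - 1) * v i with hS₁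
  set S₂ : ℝ → ℝ := fun t => ∑ i, (p * (x t i ^ 2 + ε) ^ (p / 2 - 1) +
    p * x t i * (2 * (p / 2 - 1) * x t i * (x t i ^ 2 + ε) ^ (p / 2 - 1 - 1))) * v i ^ 2 with hS₂
  have hSpos : ∀ t, 0 < S t := fun t =>
    Finset.sum_pos (fun i _ => Real.rpow_pos_of_pos (hr t i) _) Finset.univ_nonempty
  have hd1 : ∀ t, HasDerivAt S (S₁ t) t := by
    intro t
    refine HasDerivAt.fun_sum fun i _ => ?_
    have h := (hasDerivAt_smoothAbs hε (p / 2) (x t i)).comp t (hxd t i)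
    convert! h using 1
    ring
  have hd2 : ∀ t, HasDerivAt S₁ (S₂ t) t := by
    intro t
    refine HasDerivAt.fun_sum fun i _ => ?_
    have h := (((hasDerivAt_id (x t i)).const_mul p).mul
      (hasDerivAt_smoothAbs hε (p / 2 - 1) (x t i))).comp t (hxd t i) |>.mul_const (v i)
    convert! h using 1
    simp only [id]
    ring
  set c := (p - 1) * lpPotential d p v with hc
  have hF1 : ∀ t, HasDerivAt (fun t => S t ^ (2 / p) - c * t ^ 2)
      (S₁ t * (2 / p) * S t ^ (2 / p - 1) - c * (2 * t)) t := by
    intro t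
    have h := ((hd1 t).rpow_const (p := 2 / p) (Or.inl (hSpos t).ne')).sub
      (((hasDerivAt_id t).pow 2).const_mul c)
    convert! h using 1
    simp
  have hF2 : ∀ t, HasDerivAt (fun t => S₁ t * (2 / p) * S t ^ (2 / p - 1) - c * (2 * t))
      (S₂ t * (2 / p) * S t ^ (2 / p - 1) +
        S₁ t * (2 / p) * (S₁ t * (2 / p - 1) * S t ^ (2 / p - 1 - 1)) - c * 2) t := by
    intro t
    have h := (((hd2 t).mul_const (2 / p)).mul
      ((hd1 t).rpow_const (p := 2 / p - 1) (Or.inl (hSpos t).ne'))).sub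
      (((hasDerivAt_id t).const_mul 2).const_mul c)
    convert! h using 1
    simp
  refine convexOn_of_hasDerivWithinAt2_nonneg convex_univ
    (fun t _ => (hF1 t).continuousAt.continuousWithinAt)
    (fun t _ => (hF1 t).hasDerivWithinAt) (fun t _ => (hF2 t).hasDerivWithinAt) fun t _ => ?_
  have h1 := lpNorm_sq_le_weighted hp hp2 v (hr t)
  have h2 : p * (p - 1) * ∑ i, (x t i ^ 2 + ε) ^ (p / 2 - 1) * v i ^ 2 ≤ S₂ t := by
    rw [Finset.mul_sum]
    refine Finset.sum_le_sum fun i _ => ?_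
    rw [← mul_assoc]
    exact mul_le_mul_of_nonneg_right (smoothAbs_second_ge hε hp2 hp _) (sq_nonneg _)
  have h3 : 0 ≤ S t ^ (2 / p - 1) := (Real.rpow_pos_of_pos (hSpos t) _).le
  have h4 : 0 ≤ S t ^ (2 / p - 1 - 1) := (Real.rpow_pos_of_pos (hSpos t) _).le
  have h5 : 0 ≤ S₁ t * (2 / p) * (S₁ t * (2 / p - 1) * S t ^ (2 / p - 1 - 1)) := by
    have : S₁ t * (2 / p) * (S₁ t * (2 / p - 1) * S t ^ (2 / p - 1 - 1)) =
        S₁ t ^ 2 * (2 / p * (2 / p - 1) * S t ^ (2 / p - 1 - 1)) := by ring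
    rw [this]
    have : 0 ≤ 2 / p - 1 := by linarith
    positivity
  have h6 : c * 2 ≤ S₂ t * (2 / p) * S t ^ (2 / p - 1) := by
    calc c * 2 ≤ (p - 1) * (S t ^ (2 / p - 1) *
          ∑ i, (x t i ^ 2 + ε) ^ (p / 2 - 1) * v i ^ 2) * 2 := by
          rw [hc]
          have : 0 ≤ p - 1 := by linarith
          gcongr
      _ = (p * (p - 1) * ∑ i, (x t i ^ 2 + ε) ^ (p / 2 - 1) * v i ^ 2) * (2 / p) *
          S t ^ (2 / p - 1) := by field_simp
      _ ≤ _ := by gcongr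
  linarith

theorem convexOn_lp_line {d : ℕ} (hd : 0 < d) {p : ℝ} (hp : 1 < p) (hp2 : p ≤ 2) (b v : E d) :
    ConvexOn ℝ Set.univ fun t : ℝ =>
      lpPotential d p (b + t • v) - (p - 1) * lpPotential d p v * t ^ 2 := by
  have hp0 : 0 < p := by linarith
  have hlim : ∀ t : ℝ, Filter.Tendsto (fun ε : ℝ =>
      (∑ i, ((b i + t * v i) ^ 2 + ε) ^ (p / 2)) ^ (2 / p) - (p - 1) * lpPotential d p v * t ^ 2)
      (nhdsWithin 0 (Set.Ioi 0))
      (nhds (lpPotential d p (b + t • v) - (p - 1) * lpPotential d p v * t ^ 2)) := by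
    intro t
    have hc : Continuous fun ε : ℝ => (∑ i, ((b i + t * v i) ^ 2 + ε) ^ (p / 2)) ^ (2 / p) -
        (p - 1) * lpPotential d p v * t ^ 2 := by
      refine Continuous.sub (Continuous.rpow_const ?_ fun _ => Or.inr (by positivity))
        continuous_const
      exact continuous_finsetSum _ fun i _ =>
        Continuous.rpow_const (by fun_prop) fun _ => Or.inr (by positivity)
    have h := (hc.tendsto 0).mono_left (nhdsWithin_le_nhds (s := Set.Ioi 0))
    convert! h using 2
    rw [lpPotential_eq]
    congr 2
    refine Finset.sum_congr rfl fun i _ => ?_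
    rw [add_zero, ← sq_abs, ← Real.rpow_natCast, ← Real.rpow_mul (abs_nonneg _)]
    simp only [PiLp.add_apply, PiLp.smul_apply, smul_eq_mul]
    congr 1
    push_cast
    ring
  refine ⟨convex_univ, fun x _ y _ s t hs ht hst => ?_⟩
  refine le_of_tendsto_of_tendsto (hlim _) (((hlim x).const_mul s).add ((hlim y).const_mul t)) ?_
  filter_upwards [self_mem_nhdsWithin] with ε hε
  exact (convexOn_smooth_lp_line hd hp hp2 hε b v).2 (Set.mem_univ x) (Set.mem_univ y) hs ht hst

theorem lp_discreteAssumption {d : ℕ} {τ p : ℝ} (hd : 0 < d) (hτ : 0 < τ) (hp : 1 < p)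
    (hp2 : p ≤ 2) (hpd : (p - 1) * Real.log d ≤ 1) :
    DiscreteAssumption (l1Ball d) τ (lpPotential d p) (lpNorm p) (2 * (p - 1)) (Real.exp 1) 1 := by
  have hN := isNorm_lpNorm d hp
  refine
    { nonneg := fun α => sq_nonneg _
      differentiable := differentiable_lpPotential d hp hp2
      gradient_zero := gradient_eq_zero_of_forall_le fun α => ?_
      sqrt_convex := ?_
      cl_pos := Real.exp_pos 1
      cu_pos := one_pos
      lower := fun α => ?_
      upper := fun α hα => ?_
      isNorm := hN
      rho_pos := by linarith
      stronglyConvex := fun a b => ?_ }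
  · have : lpNorm p (0 : E d) = 0 := by simpa using lpNorm_smul hp 0 (0 : E d)
    simpa [lpPotential, this] using sq_nonneg (lpNorm p α)
  · simp only [sqrt_lpPotential]
    refine ⟨convex_univ, fun a _ b _ s t hs ht hst => ?_⟩
    refine (hN.triangle _ _).trans (le_of_eq ?_)
    rw [hN.homogeneous, hN.homogeneous, abs_of_nonneg hs, abs_of_nonneg ht]
    rfl
  · rw [gauge_l1Ball, sqrt_lpPotential]
    exact sum_abs_le_lpNorm hd hp hpd α
  · rw [sqrt_lpPotential, one_mul]
    exact (lpNorm_le_sum_abs hp α).trans ((mem_smul_l1Ball hτ α).1 hα)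
  · have e : 2 * (p - 1) / 2 * lpNorm p (a - b) ^ 2 = (p - 1) * lpPotential d p (a - b) := by
      rw [lpPotential]; ring
    rw [e]
    exact le_bregman_of_convexOn_line (differentiable_lpPotential d hp hp2)
      (convexOn_lp_line hd hp hp2 b (a - b))

/-! ### Existence of the continuous-time trajectory -/

/-- A bounded Lipschitz vector field has an integral curve on every interval `[0, T]`. -/
theorem exists_integralCurve_Icc {F : Type*} [NormedAddCommGroup F] [NormedSpace ℝ F]
    [CompleteSpace F] {f : F → F} {K L : NNReal} (hf : LipschitzWith K f) (hL : ∀ x, ‖f x‖ ≤ L)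
    (x₀ : F) {T : ℝ} (hT : 0 ≤ T) : ∃ α : ℝ → F, α 0 = x₀ ∧
      ∀ t ∈ Set.Icc 0 T, HasDerivWithinAt α (f (α t)) (Set.Icc 0 T) t := by
  have hP : IsPicardLindelof (fun _ => f) (tmin := 0) (tmax := T) ⟨0, le_rfl, hT⟩ x₀
      (L * T.toNNReal) 0 L K :=
    IsPicardLindelof.of_time_independent (fun x _ => hL x) hf.lipschitzOnWith (by
      simp [hT])
  exact hP.exists_eq_forall_mem_Icc_hasDerivWithinAt₀

/-- A bounded Lipschitz vector field has a global forward integral curve. -/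
theorem exists_forward_integralCurve {F : Type*} [NormedAddCommGroup F] [NormedSpace ℝ F]
    [CompleteSpace F] {f : F → F} {K L : NNReal} (hf : LipschitzWith K f) (hL : ∀ x, ‖f x‖ ≤ L)
    (x₀ : F) : ∃ α : ℝ → F, α 0 = x₀ ∧
      ∀ t, 0 ≤ t → HasDerivWithinAt α (f (α t)) (Set.Ici 0) t := by
  have hloc : ∀ T : ℝ, ∃ α : ℝ → F, 0 ≤ T → α 0 = x₀ ∧
      ∀ t ∈ Set.Icc 0 T, HasDerivWithinAt α (f (α t)) (Set.Icc 0 T) t := by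
    intro T
    by_cases hT : 0 ≤ T
    · obtain ⟨α, hα⟩ := exists_integralCurve_Icc hf hL x₀ hT
      exact ⟨α, fun _ => hα⟩
    · exact ⟨fun _ => x₀, fun h => absurd h hT⟩
  choose γ hγ using hloc
  have hright : ∀ T, 0 ≤ T → ∀ t ∈ Set.Ico 0 T,
      HasDerivWithinAt (γ T) (f (γ T t)) (Set.Ici t) t := by
    intro T hT t ht
    refine ((hγ T hT).2 t ⟨ht.1, ht.2.le⟩).mono_of_mem_nhdsWithin ?_
    exact Filter.mem_of_superset (Icc_mem_nhdsGE ht.2) (Set.Icc_subset_Icc_left ht.1)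
  have huniq : ∀ S T, 0 ≤ S → S ≤ T → Set.EqOn (γ S) (γ T) (Set.Icc 0 S) := by
    intro S T hS hST
    refine ODE_solution_unique (v := fun _ => f) (K := K) (fun _ => hf)
      (fun t ht => ((hγ S hS).2 t ht).continuousWithinAt) (hright S hS)
      (fun t ht => (((hγ T (hS.trans hST)).2 t
        ⟨ht.1, ht.2.trans hST⟩).continuousWithinAt.mono (Set.Icc_subset_Icc_right hST)))
      (fun t ht => hright T (hS.trans hST) t ⟨ht.1, ht.2.trans_le hST⟩) ?_
    rw [(hγ S hS).1, (hγ T (hS.trans hST)).1]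
  have heq : ∀ s T, 0 ≤ s → s ≤ T → γ (s + 1) s = γ T s := by
    intro s T hs hsT
    rcases le_total (s + 1) T with h | h
    · exact huniq _ _ (by linarith) h ⟨hs, by linarith⟩
    · exact (huniq _ _ (hs.trans hsT) h ⟨hs, hsT⟩).symm
  -- Evaluating the solution on `[0, t + 1]` keeps `t` away from the right end of its interval;
  -- uniqueness makes the pieces agree.
  refine ⟨fun t => γ (t + 1) t, (hγ (0 + 1) (by norm_num)).1, fun t ht => ?_⟩
  have hmem : Set.Icc 0 (t + 1) ∈ nhdsWithin t (Set.Ici 0) := by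
    rw [← Set.Ici_inter_Iic]
    exact Filter.inter_mem self_mem_nhdsWithin
      (mem_nhdsWithin_of_mem_nhds (Iic_mem_nhds (lt_add_one t)))
  have h1 : HasDerivWithinAt (γ (t + 1)) (f (γ (t + 1) t)) (Set.Ici 0) t :=
    ((hγ (t + 1) (by linarith)).2 t ⟨ht, by linarith⟩).mono_of_mem_nhdsWithin hmem
  refine h1.congr_of_eventuallyEq ?_ rfl
  filter_upwards [self_mem_nhdsWithin,
    mem_nhdsWithin_of_mem_nhds (Iic_mem_nhds (lt_add_one t))] with s hs hs'
  exact heq s _ hs hs'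

/-- The point `a` comes from projecting `y` onto the range of `X`. The sign condition makes `D(a,
·)` nonincreasing along the flow. -/
theorem exists_normal_equations {n d : ℕ} (X : Matrix (Fin n) (Fin d) ℝ) (y : E n) :
    ∃ a : E d, ∀ α, inner ℝ (gradient (empRisk X y) α) (a - α) ≤ 0 := by
  obtain ⟨_, ⟨a, rfl⟩, z, hz, hyz⟩ :=
    (LinearMap.range (Matrix.toEuclideanLin X)).exists_add_mem_mem_orthogonal y
  refine ⟨a, fun α => ?_⟩
  rw [inner_gradient_empRisk]
  have h1 : inner ℝ z (Matrix.toEuclideanLin X (a - α)) = 0 :=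
    (Submodule.mem_orthogonal' _ _).1 hz _ ⟨_, rfl⟩
  have h2 : Matrix.toEuclideanLin X α - y = -Matrix.toEuclideanLin X (a - α) - z := by
    rw [hyz, map_sub]; abel
  rw [h2, inner_sub_left, inner_neg_left, h1, real_inner_self_eq_norm_sq]
  have : 0 ≤ 2 / (n : ℝ) * ‖Matrix.toEuclideanLin X (a - α)‖ ^ 2 := by positivity
  linarith

/-- The field is cut off outside a ball containing the sublevel set of `D(a, ·)` at its initial
value, which makes it bounded and Lipschitz. The cutoff factor is nonnegative, so `D(a, ·)` still
does not increase, and the trajectory never reaches the region where the cutoff acts. -/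
theorem exists_isContinuousMD {d : ℕ} {τ : ℝ} {ψ : E d → ℝ} {cl cu : ℝ}
    (hm : IsContinuousMirrorMap ψ) (hs : ContDiff ℝ 2 (gradient ψ))
    (h : CommonAssumption (l1Ball d) τ ψ cl cu) {n : ℕ} (X : Matrix (Fin n) (Fin d) ℝ)
    (y : E n) : ∃ α : ℝ → E d, IsContinuousMD ψ X y α := by
  obtain ⟨a, ha⟩ := exists_normal_equations X y
  set M := cl * (√(ψ a) + √(bregman ψ a 0)) with hM
  have hM0 : 0 ≤ M := mul_nonneg h.cl_pos.le (by positivity)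
  have hbound : ∀ α, bregman ψ a α ≤ bregman ψ a 0 → ‖α‖ ≤ M := by
    intro α hα
    have h1 := (h.sq_sub_le a α).trans hα
    have h2 : √(ψ α) - √(ψ a) ≤ √(bregman ψ a 0) := by
      apply Real.le_sqrt_of_sq_le
      linarith [sub_sq_comm (√(ψ α)) (√(ψ a))]
    have h3 := h.lower α
    rw [gauge_l1Ball] at h3
    exact (norm_le_sum_abs α).trans (h3.trans
      (mul_le_mul_of_nonneg_left (by linarith) h.cl_pos.le))
  set f : E d → E d := fun α => -((hessian ψ α).inverse (gradient (empRisk X y) α)) with hf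
  have hhess : ContDiff ℝ 1 (hessian ψ) := hs.fderiv_right (by norm_num)
  have hfC : ContDiff ℝ 1 f := by
    refine ContDiff.neg (ContDiff.clm_apply ?_ (contDiff_gradient_empRisk X y))
    exact contDiff_iff_contDiffAt.2 fun α =>
      (hm.hessian_isInvertible α).contDiffAt_map_inverse.comp α hhess.contDiffAt
  let χ : ContDiffBump (0 : E d) := ⟨M + 1, M + 2, by linarith, by linarith⟩
  set g : E d → E d := fun α => χ α • f α with hg
  have hgC : ContDiff ℝ 1 g := χ.contDiff.smul hfC
  have hgs : HasCompactSupport g := χ.hasCompactSupport.smul_right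
  obtain ⟨K, hK⟩ := ContDiff.lipschitzWith_of_hasCompactSupport hgs hgC one_ne_zero
  obtain ⟨L, hL⟩ := hgC.continuous.bounded_above_of_compact_support hgs
  obtain ⟨α, h0, hα⟩ := exists_forward_integralCurve (L := L.toNNReal) hK
    (fun x => (hL x).trans (Real.le_coe_toNNReal L)) 0
  refine ⟨α, h0, fun t ht => ?_⟩
  have hD : ∀ t, 0 ≤ t → HasDerivWithinAt (fun t => bregman ψ a (α t))
      (χ (α t) * inner ℝ (gradient (empRisk X y) (α t)) (a - α t)) (Set.Ici 0) t := by
    intro t ht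
    have := hm.hasDerivWithinAt_bregman a (hα t ht)
    convert! this using 1
    rw [hg, map_smul, hf, map_neg, hm.hessian_inverse, inner_smul_left, inner_neg_left]
    simp
    ring
  have hle := le_sub_of_deriv_le (c := 0) ht hD (fun s _ => by
    have := mul_nonneg (χ.nonneg (x := α s)) (neg_nonneg.2 (ha (α s)))
    linarith)
  simp only [h0, zero_mul, sub_zero] at hle
  have hnorm := hbound _ hle
  have hχ : χ (α t) = 1 := χ.one_of_mem_closedBall (by
    rw [mem_closedBall_zero_iff]
    change ‖α t‖ ≤ M + 1
    linarith)
  have := hα t ht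
  simp only [hg, hχ, one_smul] at this
  exact this

/-! ### The listed potentials -/

theorem DiscreteRow.discreteAssumption {d : ℕ} {τ : ℝ} (hd : 0 < d) (hτ : 0 < τ)
    {ψ N : E d → ℝ} {ρ cl cu : ℝ} (h : DiscreteRow d τ ψ N ρ cl cu) :
    DiscreteAssumption (l1Ball d) τ ψ N ρ cl cu := by
  cases h with
  | lp p h1 h2 hp => exact lp_discreteAssumption hd hτ h1 h2 hp
  | moreau lam h0 hl => exact moreau_discreteAssumption hd hτ h0 hl
  | hypentropy γ hγ => exact hγ.discreteAssumption hd hτ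

theorem DiscreteRow.constants {d : ℕ} {τ : ℝ} {ψ N : E d → ℝ} {ρ cl cu : ℝ}
    (h : DiscreteRow d τ ψ N ρ cl cu) : 1 ≤ cl * cu ∧ cl * cu ≤ 3 := by
  cases h with
  | lp p h1 h2 hp =>
    have := Real.exp_one_gt_d9
    have := Real.exp_one_lt_d9
    constructor <;> linarith
  | moreau lam h0 hl =>
    rw [one_mul]
    exact ⟨Real.one_le_sqrt.2 (by norm_num), Real.sqrt_le_iff.2 ⟨by norm_num, by norm_num⟩⟩
  | hypentropy γ hγ => norm_num

theorem ContinuousRow.profile {d : ℕ} {τ : ℝ} (hd : 0 < d) (hτ : 0 < τ) {ψ : E d → ℝ}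
    {cl cu : ℝ} (h : ContinuousRow d τ ψ cl cu) :
    IsContinuousMirrorMap ψ ∧ ContDiff ℝ 2 (gradient ψ) ∧
      CommonAssumption (l1Ball d) τ ψ cl cu := by
  cases h with
  | hypentropy γ hγ =>
    exact ⟨(isProfile_hypentropy hγ.pos).isContinuousMirrorMap,
      (isProfile_hypentropy hγ.pos).contDiff_gradient, hγ.commonAssumption hd hτ⟩
  | sigmoidal γ hγ =>
    obtain ⟨h0, h1⟩ := sigmoidal_commonAssumption hd hτ hγ
    exact ⟨(isProfile_sigmoidal h0).isContinuousMirrorMap,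
      (isProfile_sigmoidal h0).contDiff_gradient, h1⟩

theorem ContinuousRow.constants {d : ℕ} {τ : ℝ} {ψ : E d → ℝ} {cl cu : ℝ}
    (h : ContinuousRow d τ ψ cl cu) : 1 ≤ cl * cu ∧ cl * cu ≤ 3 := by
  cases h <;> norm_num

end ESMD

end

/-! ### Assembly of the potentials, the good-noise events and the deterministic guarantees. -/

theorem theorem4p1 :
    -- the potentials satisfy the conditions with the listed constants
    (∀ (d : ℕ) (τ : ℝ), 0 < d → 0 < τ →
      (∀ (ψ N : ESMD.E d → ℝ) (ρ cl cu : ℝ), ESMD.DiscreteRow d τ ψ N ρ cl cu →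
        ESMD.IsDiscreteMirrorMap ψ ∧
        ESMD.DiscreteAssumption (ESMD.l1Ball d) τ ψ N ρ cl cu) ∧
      (∀ (ψ : ESMD.E d → ℝ) (cl cu : ℝ), ESMD.ContinuousRow d τ ψ cl cu →
        ESMD.IsContinuousMirrorMap ψ ∧
        ESMD.ContinuousAssumption (ESMD.l1Ball d) τ ψ cl cu ∧
        -- the flow is well-posed: a global trajectory exists for all data
        ∀ (n : ℕ) (X : Matrix (Fin n) (Fin d) ℝ) (y : ESMD.E n),
          ∃ α : ℝ → ESMD.E d, ESMD.IsContinuousMD ψ X y α) ∧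
      -- the bounds on the strong convexity parameters
      (∀ p : ℝ, 2 ≤ d → p ≤ 1 + 1 / Real.log d → 2 * (p - 1) ≤ 2 / Real.log d) ∧
      (∀ γ : ℝ, ESMD.HypentropyParam d τ γ →
        ((Real.arsinh γ⁻¹) ^ 2)⁻¹ ≤ (τ / d) ^ 2)) ∧
    -- the risk bounds, with an absolute constant
    (∃ C : ℝ, 0 < C ∧ ∀ (n d : ℕ) (τ : ℝ), 0 < n → 0 < τ → τ * √(n : ℝ) ≤ d →
      -- fixed column-normalized design
      (∀ (X : Matrix (Fin n) (Fin d) ℝ), ESMD.ColumnNormalized X →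
        ∀ δ : ℝ, 0 < δ → δ < 1 →
        (∀ (ψ N : ESMD.E d → ℝ) (ρ cl cu : ℝ), ESMD.DiscreteRow d τ ψ N ρ cl cu →
          ESMD.WithProbAtLeast (ESMD.noiseLaw n) (1 - Real.exp (-0.1 * n) - δ) fun ξ =>
            ∀ αs ∈ τ • ESMD.l1Ball d, ESMD.DiscreteGuarantee ψ cu τ X αs ξ
              (C * ESMD.fixedRate X (cl * cu) τ δ)) ∧
        (∀ (ψ : ESMD.E d → ℝ) (cl cu : ℝ), ESMD.ContinuousRow d τ ψ cl cu →
          ESMD.WithProbAtLeast (ESMD.noiseLaw n) (1 - Real.exp (-0.1 * n) - δ) fun ξ =>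
            ∀ αs ∈ τ • ESMD.l1Ball d, ESMD.ContinuousGuarantee ψ cu τ X αs ξ
              (C * ESMD.fixedRate X (cl * cu) τ δ))) ∧
      -- Gaussian design, independent of the noise
      (2 ≤ d →
        (∀ (ψ N : ESMD.E d → ℝ) (ρ cl cu : ℝ), ESMD.DiscreteRow d τ ψ N ρ cl cu →
          ESMD.WithProbAtLeast ((ESMD.designLaw n d).prod (ESMD.noiseLaw n))
            (0.99 - 2 * Real.exp (-0.1 * n)) fun ω =>
            ∀ αs ∈ τ • ESMD.l1Ball d, ESMD.DiscreteGuarantee ψ cu τ (Matrix.of ω.1) αs ω.2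
              (C * ESMD.gaussianRate n d (cl * cu) τ)) ∧
        (∀ (ψ : ESMD.E d → ℝ) (cl cu : ℝ), ESMD.ContinuousRow d τ ψ cl cu →
          ESMD.WithProbAtLeast ((ESMD.designLaw n d).prod (ESMD.noiseLaw n))
            (0.99 - 2 * Real.exp (-0.1 * n)) fun ω =>
            ∀ αs ∈ τ • ESMD.l1Ball d, ESMD.ContinuousGuarantee ψ cu τ (Matrix.of ω.1) αs ω.2
              (C * ESMD.gaussianRate n d (cl * cu) τ)))) := by
  refine ⟨fun d τ hd hτ => ⟨fun ψ N ρ cl cu h => ?_, fun ψ cl cu h => ?_, fun p _ hp => ?_,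
    fun γ hγ => ?_⟩, 1000, by norm_num, fun n d τ hn hτ hnd => ?_⟩
  · exact ⟨(h.discreteAssumption hd hτ).isDiscreteMirrorMap, h.discreteAssumption hd hτ⟩
  · obtain ⟨hm, hs, hc⟩ := h.profile hd hτ
    exact ⟨hm, ⟨hc, hm.gradient_differentiable, hm.strictConvexOn⟩,
      fun n X y => ESMD.exists_isContinuousMD hm hs hc X y⟩
  · have : 2 / Real.log d = 2 * (1 / Real.log d) := by ring
    linarith
  · have h1 := hγ.div_le_arsinh hd hτ
    have hd' : (0 : ℝ) < d := by exact_mod_cast hd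
    rw [← inv_div, inv_pow]
    gcongr
  · have hnR : (0 : ℝ) < n := by exact_mod_cast hn
    have hd : 0 < d := by
      have : (0 : ℝ) < d := lt_of_lt_of_le (by positivity) hnd
      exact_mod_cast this
    refine ⟨fun X hX δ hδ hδ1 => ⟨fun ψ N ρ cl cu h => ?_, fun ψ cl cu h => ?_⟩,
      fun hd2 => ⟨fun ψ N ρ cl cu h => ?_, fun ψ cl cu h => ?_⟩⟩
    · refine (ESMD.fixed_design_event hn hτ hnd hX hδ hδ1 h.constants.1).mono le_rfl
        fun ξ hξ αs hs => ?_
      exact ESMD.discreteGuarantee_of_goodNoise hn hτ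
        (h.discreteAssumption hd hτ).toCommonAssumption h.constants.2 hs hξ
    · obtain ⟨hm, _, hc⟩ := h.profile hd hτ
      refine (ESMD.fixed_design_event hn hτ hnd hX hδ hδ1 h.constants.1).mono le_rfl
        fun ξ hξ αs hs => ?_
      exact ESMD.continuousGuarantee_of_goodNoise hτ hm hc h.constants.2 hs hξ
    · refine (ESMD.gaussian_design_event hn hd2 hτ h.constants.1).mono le_rfl
        fun ω hω αs hs => ?_
      exact ESMD.discreteGuarantee_of_goodNoise hn hτ
        (h.discreteAssumption hd hτ).toCommonAssumption h.constants.2 hs hω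
    · obtain ⟨hm, _, hc⟩ := h.profile hd hτ
      refine (ESMD.gaussian_design_event hn hd2 hτ h.constants.1).mono le_rfl
        fun ω hω αs hs => ?_
      exact ESMD.continuousGuarantee_of_goodNoise hτ hm hc h.constants.2 hs hω
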